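/- Let $p,q\in\mathbb C$ with $0<|p|<1$ and $0<|q|<1$, and let $$\Gamma(z)=\prod_{j,k=0}^\infty\frac{1-p^{j+1}q^{k+1}/z}{1-p^jq^kz}$$ be the elliptic gamma function. A product of gamma values over all choices of signs is abbreviated by $\pm$, so that $\Gamma(az^\pm)=\Gamma(az)\Gamma(a/z)$, $\Gamma(z^{\pm2})=\Gamma(z^2)\Gamma(z^{-2})$ and $\Gamma(az^\pm w^\pm)=\Gamma(azw)\Gamma(az/w)\Gamma(aw/z)\Gamma(a/(zw))$. Put $C=\prod_{j=1}^\infty(1-p^j)(1-q^j)$. Let $n\ge1$ be an integer and let $t_1,\dots,t_6\in\mathbb C$ satisfy $|t_k|<1$ for all $k$ and $q^{2n-2}t_1t_2t_3t_4t_5t_6=pq$. Then the following integrand is integrable over the torus $|z_1|=\dots=|z_n|=1$ (each circle positively oriented), and $$\frac{C^n}{2^nn!}\int_{|z_1|=\dots=|z_n|=1}\ \prod_{1\le j<k\le n}\frac{\Gamma(qz_j^\pm z_k^\pm)}{\Gamma(z_j^\pm z_k^\pm)}\ \prod_{j=1}^n\frac{\prod_{k=1}^6\Gamma(t_kz_j^\pm)}{\Gamma(z_j^{\pm2})}\,\frac{dz_j}{2\pi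 i z_j} =\prod_{m=1}^n\left(\frac{\Gamma(q^m)}{\Gamma(q)}\prod_{1\le j<k\le6}\Gamma(q^{m-1}t_jt_k)\right).$$ -/

import Mathlib

noncomputable section

/-- Ruijsenaars' elliptic gamma function
`Γ(z) = ∏_{j,k ≥ 0} (1 - p^{j+1} q^{k+1} / z) / (1 - p^j q^k z)`, for `|p|, |q| < 1`.
Both infinite products converge absolutely when `|p|, |q| < 1`. -/
def ellipticGamma (p q z : ℂ) : ℂ :=
  (∏' i : ℕ × ℕ, (1 - p ^ (i.1 + 1) * q ^ (i.2 + 1) / z)) /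
    ∏' i : ℕ × ℕ, (1 - p ^ i.1 * q ^ i.2 * z)

/-- `Γ(a w^±) = Γ(a w) Γ(a / w)`. -/
def ellipticGammaPM (p q a w : ℂ) : ℂ :=
  ellipticGamma p q (a * w) * ellipticGamma p q (a / w)

/-- `Γ(a z^± w^±) = Γ(a z w) Γ(a z / w) Γ(a w / z) Γ(a / (z w))`. -/
def ellipticGammaPMPM (p q a z w : ℂ) : ℂ :=
  ellipticGamma p q (a * z * w) * ellipticGamma p q (a * z / w) *
    ellipticGamma p q (a * w / z) * ellipticGamma p q (a / (z * w))

/-- The constant `C = ∏_{j ≥ 1} (1 - p^j)(1 - q^j)`. -/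
def selbergConst (p q : ℂ) : ℂ :=
  ∏' j : ℕ, ((1 - p ^ (j + 1)) * (1 - q ^ (j + 1)))

/-- The integrand of the elliptic Selberg integral with coupling parameter `s` and parameters
`t 0, …, t 5`, without the measure `∏_j dz_j / (2 π i z_j)`. -/
def selbergWeight (p q s : ℂ) {n : ℕ} (t : Fin 6 → ℂ) (z : Fin n → ℂ) : ℂ :=
  (∏ j : Fin n, ∏ k ∈ Finset.Ioi j,
      ellipticGammaPMPM p q s (z j) (z k) / ellipticGammaPMPM p q 1 (z j) (z k)) *
    ∏ j : Fin n,
      (∏ k : Fin 6, ellipticGammaPM p q (t k) (z j)) / ellipticGammaPM p q 1 (z j ^ 2)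

/-- The integrand together with the density `∏_j 1 / (2 π i z_j)`, to be integrated against
`dz_1 ⋯ dz_n`. -/
def selbergIntegrand (p q s : ℂ) {n : ℕ} (t : Fin 6 → ℂ) (z : Fin n → ℂ) : ℂ :=
  selbergWeight p q s t z * ∏ j : Fin n, 1 / (2 * (Real.pi : ℂ) * Complex.I * z j)

end

noncomputable section

open Filter Topology Set MeasureTheory

/-! When the coupling parameter is `q`, the interaction factor of the integrand is, on the torus,
the square of an elliptic Vandermonde factor built from θ( · ; p) (`ellipticGammaPMPM_q_div_one`).
Put n = m + 1. For any a and b, the Vandermonde product is, up to a constant, the determinant of the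
functions ∏_{i<k} θ(a q^i z^±) ∏_{i<m-k} θ(b q^i z^±), 0 ≤ k ≤ m; this follows by column operations
from Weierstrass' addition formula (`det_thetaPair`, `thetaBracket_plucker`). One copy is written
with (a, b) = (t 0, t 1), the other with (t 2, t 3), and Andréief's identity
(`torusAverage_det_mul_det`) turns the n-fold integral into n! times a determinant of one-variable
integrals.

In these integrals the theta factors only multiply t 0, …, t 3 by powers of `q` with total exponent
2m. Hence every entry is an elliptic beta integral, balanced exactly because the Selberg integral
is. Its value splits into a row factor, a column factor and a function of the same determinantal
type evaluated at t 2 q^l (`betaValue_shift`), so the determinant lemma applies a second time. The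
theta products that remain match one by one (`thetaPoint_mul_thetaCoeff`). The constants divided out
can vanish for special parameters; these are reached by continuity.

The elliptic beta integral itself (`betaIntegral_eq`) rests on a contour argument. The kernel
`betaKernel` changes sign under z ↦ 1/(qz), so its average over the circle |z| = |q|^{-1/2} is zero,
and so is its average over the unit circle when no pole lies between. Symmetrized under z ↦ 1/z, the
kernel contains an odd theta function of degree six; such functions form a space of dimension at
most two, and interpolation in it (`oddTheta_eq`) gives a difference of two beta integrands. This
relates the integrals at (qa, b) and (a, qb) just as the conjectural values are related. If instead
c 3 · b = 1, one of the two integrals drops out while one pole is crossed, so the residue evaluates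
the other. Induction then gives the evaluation whenever c 3 · b = q^m. With `p` as the variable and
a, c fixed, these cases are values of `p` accumulating at 0, where the defect is still holomorphic,
so the identity theorem gives all `p` subject to inequalities on c 3. A second continuation, in c 3,
removes the inequalities. -/

/-! ### Double Pochhammer symbols and theta functions -/

/-- The double `q`-Pochhammer symbol `∏_{j,k ≥ 0} (1 - p^j q^k x)`. -/
def doublePochhammer (p q x : ℂ) : ℂ := ∏' i : ℕ × ℕ, (1 - p ^ i.1 * q ^ i.2 * x)

/-- The infinite `p`-Pochhammer symbol `∏_{j ≥ 0} (1 - p^j x)`. -/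
def pochhammerInf (p x : ℂ) : ℂ := ∏' i : ℕ, (1 - p ^ i * x)

/-- The modified theta function `θ(x; p) = (x; p)_∞ (p / x; p)_∞`. -/
def modTheta (p x : ℂ) : ℂ := pochhammerInf p x * pochhammerInf p (p / x)

lemma summable_geometric_prod {r s : ℝ} (hr0 : 0 ≤ r) (hr : r < 1) (hs0 : 0 ≤ s) (hs : s < 1)
    (R : ℝ) : Summable fun i : ℕ × ℕ => r ^ i.1 * s ^ i.2 * R :=
  ((summable_geometric_of_lt_one hr0 hr).mul_of_nonneg (summable_geometric_of_lt_one hs0 hs)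
    (fun _ => by positivity) (fun _ => by positivity)).mul_right R

lemma summable_norm_doublePochhammer {p q : ℂ} (hp : ‖p‖ < 1) (hq : ‖q‖ < 1) (x : ℂ) :
    Summable fun i : ℕ × ℕ => ‖-(p ^ i.1 * q ^ i.2 * x)‖ := by
  simpa using summable_geometric_prod (norm_nonneg p) hp (norm_nonneg q) hq ‖x‖

lemma summable_norm_pochhammerInf {p : ℂ} (hp : ‖p‖ < 1) (x : ℂ) :
    Summable fun i : ℕ => ‖-(p ^ i * x)‖ := by
  simpa using (summable_geometric_of_lt_one (norm_nonneg p) hp).mul_right ‖x‖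

lemma multipliable_doublePochhammer {p q : ℂ} (hp : ‖p‖ < 1) (hq : ‖q‖ < 1) (x : ℂ) :
    Multipliable fun i : ℕ × ℕ => 1 - p ^ i.1 * q ^ i.2 * x := by
  simpa [sub_eq_add_neg] using
    multipliable_one_add_of_summable (summable_norm_doublePochhammer hp hq x)

lemma multipliable_pochhammerInf {p : ℂ} (hp : ‖p‖ < 1) (x : ℂ) :
    Multipliable fun i : ℕ => 1 - p ^ i * x := by
  simpa [sub_eq_add_neg] using
    multipliable_one_add_of_summable (summable_norm_pochhammerInf hp x)

lemma doublePochhammer_comm (p q x : ℂ) : doublePochhammer p q x = doublePochhammer q p x := by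
  unfold doublePochhammer
  rw [← (Equiv.prodComm ℕ ℕ).tprod_eq]
  simp [mul_comm]

lemma pochhammerInf_eq {p : ℂ} (hp : ‖p‖ < 1) (x : ℂ) :
    pochhammerInf p x = (1 - x) * pochhammerInf p (p * x) := by
  unfold pochhammerInf
  have h : (fun i : ℕ => 1 - p ^ i * (p * x)) = fun i : ℕ => 1 - p ^ (i + 1) * x := by
    ext i; ring
  have := multipliable_pochhammerInf hp (p * x)
  rw [h] at this ⊢
  rw [tprod_eq_zero_mul' (f := fun i : ℕ => 1 - p ^ i * x) this]
  simp

/-- Grouping the double product by powers of `q` gives ∏_j (q^j x; p)_∞, and the factor j = 0 is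
peeled off. Every difference equation for Γ comes from this. -/
lemma doublePochhammer_eq {p q : ℂ} (hp : ‖p‖ < 1) (hq : ‖q‖ < 1) (x : ℂ) :
    doublePochhammer p q x = pochhammerInf p x * doublePochhammer p q (q * x) := by
  have key : ∀ y, HasProd (fun j : ℕ => pochhammerInf p (q ^ j * y)) (doublePochhammer p q y) := by
    intro y
    rw [doublePochhammer_comm]
    have h1 := (multipliable_doublePochhammer hq hp y).hasProd
    refine h1.prod_fiberwise fun j => ?_
    have := (multipliable_pochhammerInf hp (q ^ j * y)).hasProd
    refine this.congr_fun ?_ |> fun h => h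
    intro i; ring
  have h1 := key x
  have h2 := key (q * x)
  rw [← h1.tprod_eq, ← h2.tprod_eq]
  have h : (fun j : ℕ => pochhammerInf p (q ^ j * (q * x)))
      = fun j : ℕ => pochhammerInf p (q ^ (j + 1) * x) := by
    ext i; congr 1; ring
  have h3 := h2.multipliable
  rw [h] at h3 ⊢
  rw [tprod_eq_zero_mul' (f := fun j : ℕ => pochhammerInf p (q ^ j * x)) h3]
  simp

lemma doublePochhammer_eq' {p q : ℂ} (hp : ‖p‖ < 1) (hq : ‖q‖ < 1) (x : ℂ) :
    doublePochhammer p q x = pochhammerInf q x * doublePochhammer p q (p * x) := by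
  rw [doublePochhammer_comm, doublePochhammer_eq hq hp, doublePochhammer_comm]

lemma pochhammerInf_ne_zero {p x : ℂ} (hp : ‖p‖ < 1) (hx : ∀ i : ℕ, p ^ i * x ≠ 1) :
    pochhammerInf p x ≠ 0 := by
  have := tprod_one_add_ne_zero_of_summable (f := fun i : ℕ => -(p ^ i * x))
    (fun i => by simpa [← sub_eq_add_neg, sub_eq_zero] using (hx i).symm)
    (summable_norm_pochhammerInf hp x)
  simpa [pochhammerInf, sub_eq_add_neg] using this

lemma pochhammerInf_ne_zero_of_norm_lt {p x : ℂ} (hp : ‖p‖ < 1) (hx : ‖x‖ < 1) :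
    pochhammerInf p x ≠ 0 := by
  refine pochhammerInf_ne_zero hp fun i h => ?_
  have h1 := congrArg norm h
  have h2 : ‖p‖ ^ i ≤ 1 := pow_le_one₀ (norm_nonneg _) hp.le
  simp only [norm_mul, norm_pow, norm_one] at h1
  nlinarith [norm_nonneg x]

lemma doublePochhammer_ne_zero {p q x : ℂ} (hp : ‖p‖ < 1) (hq : ‖q‖ < 1)
    (hx : ∀ i j : ℕ, p ^ i * q ^ j * x ≠ 1) : doublePochhammer p q x ≠ 0 := by
  have := tprod_one_add_ne_zero_of_summable (f := fun i : ℕ × ℕ => -(p ^ i.1 * q ^ i.2 * x))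
    (fun i => by simpa [← sub_eq_add_neg, sub_eq_zero] using (hx i.1 i.2).symm)
    (summable_norm_doublePochhammer hp hq x)
  simpa [doublePochhammer, sub_eq_add_neg] using this

lemma doublePochhammer_ne_zero_of_norm_lt {p q x : ℂ} (hp : ‖p‖ < 1) (hq : ‖q‖ < 1)
    (hx : ‖x‖ < 1) : doublePochhammer p q x ≠ 0 := by
  refine doublePochhammer_ne_zero hp hq fun i j h => ?_
  have h1 := congrArg norm h
  have h2 : ‖p‖ ^ i ≤ 1 := pow_le_one₀ (norm_nonneg _) hp.le
  have h3 : ‖q‖ ^ j ≤ 1 := pow_le_one₀ (norm_nonneg _) hq.le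
  have h4 : ‖p‖ ^ i * ‖q‖ ^ j ≤ 1 := mul_le_one₀ h2 (by positivity) h3
  simp only [norm_mul, norm_pow, norm_one] at h1
  nlinarith [norm_nonneg x]

lemma ellipticGamma_eq (p q z : ℂ) :
    ellipticGamma p q z = doublePochhammer p q (p * q / z) / doublePochhammer p q z := by
  unfold ellipticGamma doublePochhammer
  congr 1
  refine tprod_congr fun i => ?_
  ring

/-- On a compact set the factors are dominated by a double geometric series. The base is allowed to
vary together with the argument because the beta integral is later continued in `p`, through p = 0.
-/
lemma tendstoLocallyUniformlyOn_doublePochhammer {X : Type*} [TopologicalSpace X]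
    [LocallyCompactSpace X] {q : ℂ} (hq : ‖q‖ < 1) {U : Set X} (hU : IsOpen U) {P Y : X → ℂ}
    (hP : ContinuousOn P U) (hY : ContinuousOn Y U) (hP1 : ∀ s ∈ U, ‖P s‖ < 1) :
    TendstoLocallyUniformlyOn
      (fun (F : Finset (ℕ × ℕ)) s => ∏ i ∈ F, (1 + -(P s ^ i.1 * q ^ i.2 * Y s)))
      (fun s => doublePochhammer (P s) q (Y s)) atTop U := by
  rw [← hasProdLocallyUniformlyOn_iff_tendstoLocallyUniformlyOn
    (f := fun (i : ℕ × ℕ) s => 1 + -(P s ^ i.1 * q ^ i.2 * Y s))]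
  have h1 : (fun s => doublePochhammer (P s) q (Y s))
      = fun s => ∏' i : ℕ × ℕ, (1 + -(P s ^ i.1 * q ^ i.2 * Y s)) := by
    ext s; simp [doublePochhammer, sub_eq_add_neg]
  rw [h1]
  refine hasProdLocallyUniformlyOn_of_forall_compact hU fun K hKU hK => ?_
  rcases K.eq_empty_or_nonempty with rfl | hne
  · rw [hasProdUniformlyOn_iff_tendstoUniformlyOn]
    exact tendstoUniformlyOn_empty
  obtain ⟨a, haK, ha⟩ := hK.exists_isMaxOn hne (hP.mono hKU).norm
  obtain ⟨b, hbK, hb⟩ := hK.exists_isMaxOn hne (hY.mono hKU).norm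
  rw [isMaxOn_iff] at ha hb
  have hbound : ∀ i : ℕ × ℕ, ∀ s ∈ K,
      ‖-(P s ^ i.1 * q ^ i.2 * Y s)‖ ≤ ‖P a‖ ^ i.1 * ‖q‖ ^ i.2 * ‖Y b‖ := by
    intro i s hs
    have h2 : ‖P s‖ ≤ ‖P a‖ := ha s hs
    have h3 : ‖Y s‖ ≤ ‖Y b‖ := hb s hs
    rw [norm_neg, norm_mul, norm_mul, norm_pow, norm_pow]
    gcongr
  have hP' := hP.mono hKU
  have hY' := hY.mono hKU
  have hcts : ∀ i : ℕ × ℕ, ContinuousOn (fun s => -(P s ^ i.1 * q ^ i.2 * Y s)) K := fun i =>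
    (((hP'.pow i.1).mul continuousOn_const).mul hY').neg
  exact Summable.hasProdUniformlyOn_one_add hK
    (summable_geometric_prod (norm_nonneg _) (hP1 a (hKU haK)) (norm_nonneg _) hq ‖Y b‖)
    (Eventually.of_forall hbound) hcts

lemma ContinuousOn.doublePochhammer {X : Type*} [TopologicalSpace X]
    [LocallyCompactSpace X] {q : ℂ} (hq : ‖q‖ < 1) {U : Set X} (hU : IsOpen U) {P Y : X → ℂ}
    (hP : ContinuousOn P U) (hY : ContinuousOn Y U) (hP1 : ∀ s ∈ U, ‖P s‖ < 1) :
    ContinuousOn (fun s => doublePochhammer (P s) q (Y s)) U := by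
  refine (tendstoLocallyUniformlyOn_doublePochhammer hq hU hP hY hP1).continuousOn
    (Eventually.of_forall fun s => ?_).frequently
  fun_prop

lemma DifferentiableOn.doublePochhammer {q : ℂ} (hq : ‖q‖ < 1) {U : Set ℂ} (hU : IsOpen U)
    {P Y : ℂ → ℂ} (hP : DifferentiableOn ℂ P U) (hY : DifferentiableOn ℂ Y U)
    (hP1 : ∀ s ∈ U, ‖P s‖ < 1) :
    DifferentiableOn ℂ (fun s => doublePochhammer (P s) q (Y s)) U := by
  refine (tendstoLocallyUniformlyOn_doublePochhammer hq hU hP.continuousOn hY.continuousOn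
    hP1).differentiableOn (Eventually.of_forall fun s => ?_) hU
  exact DifferentiableOn.fun_finsetProd fun i _ => by fun_prop

/-- `(x; p)_∞` is the double Pochhammer symbol with second base `0`. -/
lemma pochhammerInf_eq_doublePochhammer {p : ℂ} (hp : ‖p‖ < 1) (x : ℂ) :
    pochhammerInf p x = doublePochhammer p 0 x := by
  rw [doublePochhammer_eq hp (by simp)]
  simp [doublePochhammer]

lemma DifferentiableOn.pochhammerInf {U : Set ℂ} (hU : IsOpen U)
    {p : ℂ} {Y : ℂ → ℂ} (hY : DifferentiableOn ℂ Y U)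
    (hp : ‖p‖ < 1) : DifferentiableOn ℂ (fun s => pochhammerInf p (Y s)) U := by
  simp only [pochhammerInf_eq_doublePochhammer hp]
  exact DifferentiableOn.doublePochhammer (by simp) hU (differentiableOn_const p) hY fun _ _ => hp

lemma modTheta_one {p : ℂ} (hp : ‖p‖ < 1) : modTheta p 1 = 0 := by
  simp [modTheta, pochhammerInf_eq hp 1]

lemma modTheta_p_mul {p x : ℂ} (hp0 : p ≠ 0) (hp : ‖p‖ < 1) (hx : x ≠ 0) :
    modTheta p (p * x) = -x⁻¹ * modTheta p x := by
  have h : p / (p * x) = x⁻¹ := by field_simp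
  rw [modTheta, modTheta, h, pochhammerInf_eq hp x, pochhammerInf_eq hp x⁻¹, div_eq_mul_inv]
  field_simp
  ring

lemma modTheta_div {p x : ℂ} (hp0 : p ≠ 0) (hx : x ≠ 0) :
    modTheta p (p / x) = modTheta p x := by
  rw [modTheta, modTheta, mul_comm]
  congr 2
  field_simp

lemma modTheta_inv {p x : ℂ} (hp0 : p ≠ 0) (hp : ‖p‖ < 1) (hx : x ≠ 0) :
    modTheta p x⁻¹ = -x⁻¹ * modTheta p x := by
  rw [← modTheta_div hp0 (inv_ne_zero hx), div_inv_eq_mul, modTheta_p_mul hp0 hp hx]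

lemma modTheta_ne_zero_of_norm {p x : ℂ} (hp : ‖p‖ < 1) (hx : ‖x‖ < 1) (hpx : ‖p‖ < ‖x‖) :
    modTheta p x ≠ 0 := by
  refine mul_ne_zero (pochhammerInf_ne_zero_of_norm_lt hp hx)
    (pochhammerInf_ne_zero_of_norm_lt hp ?_)
  rwa [norm_div, div_lt_one ((norm_nonneg _).trans_lt hpx)]

lemma modTheta_ne_zero {p x : ℂ} (hp0 : p ≠ 0) (hp : ‖p‖ < 1) (hx0 : x ≠ 0)
    (hx : ∀ k : ℤ, x ≠ p ^ k) : modTheta p x ≠ 0 := by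
  refine mul_ne_zero (pochhammerInf_ne_zero hp fun i h => hx (-i) ?_)
    (pochhammerInf_ne_zero hp fun i h => hx (i + 1) ?_)
  · rw [zpow_neg, zpow_natCast]; exact eq_inv_of_mul_eq_one_right h
  · rw [zpow_add₀ hp0, zpow_natCast, zpow_one]; field_simp at h; rw [← h]

lemma DifferentiableOn.modTheta {U : Set ℂ} (hU : IsOpen U) {p : ℂ} {Y : ℂ → ℂ}
    (hY : DifferentiableOn ℂ Y U) (hY0 : ∀ s ∈ U, Y s ≠ 0) (hp : ‖p‖ < 1) :
    DifferentiableOn ℂ (fun s => modTheta p (Y s)) U :=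
  (DifferentiableOn.pochhammerInf hU hY hp).mul
    (DifferentiableOn.pochhammerInf hU ((differentiableOn_const p).div hY hY0) hp)

/-! ### Genericity, contour shifts and Laurent coefficients -/

/-- For each k there are finitely many solutions. These sets contain the parameters x ≠ 0 at which
θ(a x^m; p) vanishes, so deforming parameters by powers of x avoids zeros of theta functions outside
a countable set. -/
lemma countable_mul_pow_eq_zpow {a p : ℂ} (ha : a ≠ 0) {m : ℕ} (hm : m ≠ 0) :
    {x : ℂ | ∃ k : ℤ, a * x ^ m = p ^ k}.Countable := by
  have h : {x : ℂ | ∃ k : ℤ, a * x ^ m = p ^ k}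
      = ⋃ k : ℤ, {x : ℂ | a * x ^ m = p ^ k} := by ext; simp
  rw [h]
  refine countable_iUnion fun k => Set.Finite.countable ?_
  refine (Polynomial.nthRoots m (p ^ k / a)).toFinset.finite_toSet.subset fun x hx => ?_
  simp only [mem_ofPred_eq] at hx
  simp only [Finset.mem_coe, Multiset.mem_toFinset, Polynomial.mem_nthRoots (Nat.pos_of_ne_zero hm)]
  rw [← hx]
  field_simp

lemma eq_zero_of_continuousAt_of_countable {f : ℂ → ℂ} {x : ℂ} (hf : ContinuousAt f x) {S : Set ℂ}
    (hS : S.Countable) (h : ∀ y ∉ S, f y = 0) : f x = 0 := by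
  have hne : (𝓝[Sᶜ] x).NeBot := mem_closure_iff_nhdsWithin_neBot.mp (hS.dense_compl ℝ x)
  have h1 : Tendsto f (𝓝[Sᶜ] x) (𝓝 (f x)) := hf.continuousWithinAt
  have h2 : Tendsto f (𝓝[Sᶜ] x) (𝓝 0) :=
    tendsto_const_nhds.congr' (by filter_upwards [self_mem_nhdsWithin] with y hy using (h y hy).symm)
  exact tendsto_nhds_unique h1 h2

lemma circleAverage_eq_of_differentiableOn {F : ℂ → ℂ} {U : Set ℂ} (hU : IsOpen U)
    (hF : DifferentiableOn ℂ F U) {r R : ℝ} (hr : 0 < r) (hle : r ≤ R)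
    (h : ∀ z, r ≤ ‖z‖ → ‖z‖ ≤ R → z ∈ U) :
    Real.circleAverage F 0 r = Real.circleAverage F 0 R := by
  rw [Real.circleAverage_eq_circleIntegral hr.ne',
    Real.circleAverage_eq_circleIntegral (hr.trans_le hle).ne']
  congr 1
  refine (Complex.circleIntegral_sub_center_inv_smul_eq_of_differentiable_on_annulus_off_countable
    hr hle countable_empty (hF.continuousOn.mono fun z hz => ?_) fun z hz => ?_).symm
  · simp only [Set.mem_sdiff, Metric.mem_closedBall, dist_zero_right, Metric.mem_ball, not_lt] at hz
    exact h z hz.2 hz.1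
  · simp only [Set.mem_sdiff, Metric.mem_closedBall, dist_zero_right, Metric.mem_ball, not_le] at hz
    exact hF.differentiableAt (hU.mem_nhds (h z hz.1.2.le hz.1.1.le))

lemma circleAverage_comp_mul (F : ℂ → ℂ) (a : ℂ) (r : ℝ) :
    Real.circleAverage (fun z => F (a * z)) 0 r = Real.circleAverage F 0 (‖a‖ * r) := by
  rw [Real.circleAverage_eq_integral_add (f := F) (Complex.arg a), Real.circleAverage_def]
  congr 2
  ext θ
  congr 1
  simp only [circleMap, zero_add]
  conv_lhs => rw [← Complex.norm_mul_exp_arg_mul_I a]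
  push_cast
  rw [add_mul, Complex.exp_add]
  ring

/-- The `n`-th Laurent coefficient at `0`, computed on the unit circle. -/
def laurentCoeff (F : ℂ → ℂ) (n : ℤ) : ℂ := Real.circleAverage (fun z => z ^ (-n) * F z) 0 1

lemma differentiableOn_zpow_mul {F : ℂ → ℂ} (hF : DifferentiableOn ℂ F {0}ᶜ) (n : ℤ) :
    DifferentiableOn ℂ (fun z => z ^ n * F z) {0}ᶜ :=
  (differentiableOn_zpow n _ (Or.inl (by simp))).mul hF

lemma circleAverage_zpow_mul {F : ℂ → ℂ} (hF : DifferentiableOn ℂ F {0}ᶜ) (n : ℤ) {r : ℝ}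
    (hr : 0 < r) : Real.circleAverage (fun z => z ^ (-n) * F z) 0 r = laurentCoeff F n := by
  have key : ∀ s t : ℝ, 0 < s → s ≤ t → Real.circleAverage (fun z => z ^ (-n) * F z) 0 s
      = Real.circleAverage (fun z => z ^ (-n) * F z) 0 t := fun s t hs hst =>
    circleAverage_eq_of_differentiableOn isOpen_compl_singleton
      (differentiableOn_zpow_mul hF _) hs hst fun z hz _ => by
        simpa using norm_pos_iff.mp (hs.trans_le hz)
  rcases le_total r 1 with h | h
  · exact key r 1 hr h
  · exact (key 1 r one_pos h).symm

/-- By Cauchy, the coefficients may be computed on the circle through z. There they are, up to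
powers of |z|, the Fourier coefficients of a continuous function, whose Fourier series is then
trivially summable and represents it. -/
lemma eq_zero_of_laurentCoeff_eq_zero {F : ℂ → ℂ} (hF : DifferentiableOn ℂ F {0}ᶜ)
    (h : ∀ n, laurentCoeff F n = 0) {z : ℂ} (hz : z ≠ 0) : F z = 0 := by
  have hr : 0 < ‖z‖ := norm_pos_iff.mpr hz
  have : Fact (0 < 2 * Real.pi) := ⟨Real.two_pi_pos⟩
  have hcont : Continuous fun x : AddCircle (2 * Real.pi) =>
      F (‖z‖ * (AddCircle.toCircle x : ℂ)) := by
    refine hF.continuousOn.comp_continuous (by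
      have := AddCircle.continuous_toCircle (T := 2 * Real.pi)
      fun_prop) fun x => ?_
    simp [hz]
  let f : C(AddCircle (2 * Real.pi), ℂ) := ⟨_, hcont⟩
  have hcoef : ∀ n, fourierCoeff f n = 0 := by
    intro n
    rw [fourierCoeff_eq_intervalIntegral f n 0]
    have h1 := circleAverage_zpow_mul hF n hr
    rw [h n, Real.circleAverage_def, smul_eq_zero] at h1
    have h2 := h1.resolve_left (by positivity)
    rw [smul_eq_zero]
    right
    have h3 : ∀ x : ℝ, fourier (-n) (x : AddCircle (2 * Real.pi)) • f x
        = (‖z‖ : ℂ) ^ n * (circleMap 0 ‖z‖ x ^ (-n) * F (circleMap 0 ‖z‖ x)) := by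
      intro x
      have h4 : (AddCircle.toCircle (x : AddCircle (2 * Real.pi)) : ℂ) = Complex.exp (x * Complex.I) := by
        rw [AddCircle.toCircle_apply_mk, Circle.coe_exp]
        congr 2
        push_cast
        field_simp
      have h5 : (‖z‖ : ℂ) ≠ 0 := by simpa using hz
      simp only [f, ContinuousMap.coe_mk, h4, circleMap, zero_add, smul_eq_mul, fourier_apply,
        AddCircle.toCircle_zsmul, Circle.coe_zpow, mul_zpow]
      rw [zpow_neg (‖z‖ : ℂ)]
      field_simp
    simp only [h3, zero_add]
    rw [intervalIntegral.integral_const_mul, h2, mul_zero]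
  have hs : HasSum (fun i => fourierCoeff f i • fourier i) f :=
    hasSum_fourier_series_of_summable (by
      have : fourierCoeff f = 0 := funext hcoef
      rw [this]; exact summable_zero)
  simp only [hcoef, zero_smul] at hs
  have hf0 : f = 0 := hs.unique hasSum_zero
  have := congrArg (fun g : C(AddCircle (2 * Real.pi), ℂ) => g (Complex.arg z : ℝ)) hf0
  simp only [f, ContinuousMap.coe_mk, ContinuousMap.zero_apply] at this
  rw [AddCircle.toCircle_apply_mk, Circle.coe_exp] at this
  convert this using 2
  conv_lhs => rw [← Complex.norm_mul_exp_arg_mul_I z]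
  congr 3
  field_simp

/-- Compute the coefficient on the circle |z| = |p| and rescale to the unit circle:
quasi-periodicity becomes a recurrence of step m. -/
lemma laurentCoeff_add_period {F : ℂ → ℂ} (hF : DifferentiableOn ℂ F {0}ᶜ) {p A : ℂ} (hp0 : p ≠ 0)
    {m : ℤ} (h : ∀ z ≠ 0, F (p * z) = A * z ^ (-m) * F z) (n : ℤ) :
    laurentCoeff F n = p ^ (-n) * A * laurentCoeff F (n + m) := by
  rw [← circleAverage_zpow_mul hF n (r := ‖p‖ * 1) (by simpa using hp0),
    ← circleAverage_comp_mul (fun z => z ^ (-n) * F z), laurentCoeff, ← smul_eq_mul,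
    ← Real.circleAverage_fun_smul]
  refine Real.circleAverage_congr_sphere fun z hz => ?_
  have hz0 : z ≠ 0 := by rintro rfl; simp at hz
  simp only [smul_eq_mul]
  rw [h z hz0, mul_zpow, neg_add, zpow_add₀ hz0]
  ring

lemma laurentCoeff_neg_of_odd {F : ℂ → ℂ} (h : ∀ z ≠ 0, F z⁻¹ = -F z) (n : ℤ) :
    laurentCoeff F (-n) = -laurentCoeff F n := by
  rw [laurentCoeff, ← Real.circleAverage_zero_one_congr_inv, laurentCoeff,
    ← neg_one_smul ℂ (Real.circleAverage _ _ _), ← Real.circleAverage_fun_smul]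
  refine Real.circleAverage_congr_sphere fun z hz => ?_
  have hz0 : z ≠ 0 := by rintro rfl; simp at hz
  simp only [h z hz0, smul_eq_mul, inv_zpow', neg_neg]
  ring

lemma laurentCoeff_combination {F G H : ℂ → ℂ} (hF : DifferentiableOn ℂ F {0}ᶜ)
    (hG : DifferentiableOn ℂ G {0}ᶜ) (hH : DifferentiableOn ℂ H {0}ᶜ) (a b c : ℂ) (n : ℤ) :
    laurentCoeff (fun z => a * F z + b * G z + c * H z) n
      = a * laurentCoeff F n + b * laurentCoeff G n + c * laurentCoeff H n := by
  have hi : ∀ {f : ℂ → ℂ}, DifferentiableOn ℂ f {0}ᶜ → ∀ d : ℂ,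
      CircleIntegrable (fun z => d * (z ^ (-n) * f z)) 0 1 := fun hf d =>
    ContinuousOn.circleIntegrable zero_le_one ((((differentiableOn_zpow_mul hf _).const_mul
      d).continuousOn).mono fun z hz => by
        rintro rfl
        simp at hz)
  have hs : ∀ (f : ℂ → ℂ) (d : ℂ), d * laurentCoeff f n
      = Real.circleAverage (fun z => d * (z ^ (-n) * f z)) 0 1 := fun f d => by
    simp only [laurentCoeff, ← smul_eq_mul (a := d), Real.circleAverage_fun_smul]
  rw [hs, hs, hs, ← Real.circleAverage_fun_add (hi hF a) (hi hG b),
    ← Real.circleAverage_fun_add ((hi hF a).fun_add (hi hG b)) (hi hH c), laurentCoeff]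
  congr 1
  ext z
  ring

/-! ### Dimension bounds for spaces of theta functions -/

/-- Three vectors of `ℂ²` are linearly dependent. -/
lemma exists_linear_relation (u v : Fin 3 → ℂ) :
    ∃ a : Fin 3 → ℂ, a ≠ 0 ∧ ∑ i, a i * u i = 0 ∧ ∑ i, a i * v i = 0 := by
  let f : (Fin 3 → ℂ) →ₗ[ℂ] (Fin 2 → ℂ) := Matrix.toLin' !![u 0, u 1, u 2; v 0, v 1, v 2]
  have hk : LinearMap.ker f ≠ ⊥ := LinearMap.ker_ne_bot_of_finrank_lt (by simp)
  obtain ⟨a, ha, ha0⟩ := (Submodule.ne_bot_iff _).mp hk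
  refine ⟨a, ha0, ?_, ?_⟩
  · have := congrFun (LinearMap.mem_ker.mp ha) 0
    simp [f, Matrix.mulVec, dotProduct, Fin.sum_univ_three] at this
    simp only [Fin.sum_univ_three]
    linear_combination this
  · have := congrFun (LinearMap.mem_ker.mp ha) 1
    simp [f, Matrix.mulVec, dotProduct, Fin.sum_univ_three] at this
    simp only [Fin.sum_univ_three]
    linear_combination this

/-- Any two Laurent coefficients impose at most two conditions: if they determine a function in a
class closed under linear combinations, then three functions of the class are dependent. -/
lemma exists_relation_of_laurentCoeff {F G H : ℂ → ℂ} (hF : DifferentiableOn ℂ F {0}ᶜ)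
    (hG : DifferentiableOn ℂ G {0}ᶜ) (hH : DifferentiableOn ℂ H {0}ᶜ) (m n : ℤ)
    (h : ∀ a b c : ℂ, laurentCoeff (fun z => a * F z + b * G z + c * H z) m = 0 →
      laurentCoeff (fun z => a * F z + b * G z + c * H z) n = 0 →
      ∀ k, laurentCoeff (fun z => a * F z + b * G z + c * H z) k = 0) :
    ∃ a b c : ℂ, (a ≠ 0 ∨ b ≠ 0 ∨ c ≠ 0) ∧ ∀ z ≠ 0, a * F z + b * G z + c * H z = 0 := by
  obtain ⟨a, ha0, h1, h2⟩ := exists_linear_relation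
    ![laurentCoeff F m, laurentCoeff G m, laurentCoeff H m]
    ![laurentCoeff F n, laurentCoeff G n, laurentCoeff H n]
  simp only [Fin.sum_univ_three, Matrix.cons_val_zero, Matrix.cons_val_one, Matrix.cons_val] at h1 h2
  refine ⟨a 0, a 1, a 2, ?_, fun z hz => ?_⟩
  · by_contra! hcon
    refine ha0 (funext fun i => ?_)
    fin_cases i
    · exact hcon.1
    · exact hcon.2.1
    · exact hcon.2.2
  · refine eq_zero_of_laurentCoeff_eq_zero (F := fun z => a 0 * F z + a 1 * G z + a 2 * H z)
      (((hF.const_mul _).add (hG.const_mul _)).add (hH.const_mul _)) (h _ _ _ ?_ ?_) hz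
    · rw [laurentCoeff_combination hF hG hH, h1]
    · rw [laurentCoeff_combination hF hG hH, h2]

/-- Functions on `ℂˣ` with `F (p z) = A z⁻² F z` form a space of dimension at most two. -/
lemma exists_relation_of_degree_two {F G H : ℂ → ℂ} (hF : DifferentiableOn ℂ F {0}ᶜ)
    (hG : DifferentiableOn ℂ G {0}ᶜ) (hH : DifferentiableOn ℂ H {0}ᶜ) {p A : ℂ} (hp0 : p ≠ 0)
    (hA : A ≠ 0) (hF2 : ∀ z ≠ 0, F (p * z) = A * z ^ (-2 : ℤ) * F z)
    (hG2 : ∀ z ≠ 0, G (p * z) = A * z ^ (-2 : ℤ) * G z)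
    (hH2 : ∀ z ≠ 0, H (p * z) = A * z ^ (-2 : ℤ) * H z) :
    ∃ a b c : ℂ, (a ≠ 0 ∨ b ≠ 0 ∨ c ≠ 0) ∧ ∀ z ≠ 0, a * F z + b * G z + c * H z = 0 := by
  refine exists_relation_of_laurentCoeff hF hG hH 0 1 fun a b c h0 h1 => ?_
  have hper := laurentCoeff_add_period (F := fun z => a * F z + b * G z + c * H z)
    (((hF.const_mul _).add (hG.const_mul _)).add (hH.const_mul _)) (A := A) hp0 (m := 2)
    (fun z hz => by simp only [hF2 z hz, hG2 z hz, hH2 z hz]; ring)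
  set C := laurentCoeff (fun z => a * F z + b * G z + c * H z)
  have hstep : ∀ n, C n = 0 ↔ C (n + 2) = 0 := fun n => by
    rw [hper n]
    simp [hA, hp0, zpow_ne_zero]
  have hall : ∀ n : ℤ, C n = 0 ∧ C (n + 1) = 0 := by
    intro n
    induction n using Int.induction_on with
    | zero => exact ⟨h0, h1⟩
    | succ n ih =>
      refine ⟨ih.2, ?_⟩
      rw [add_assoc]
      exact (hstep _).mp ih.1
    | pred n ih =>
      refine ⟨(hstep _).mpr ?_, by simpa using ih.1⟩
      convert ih.2 using 2
      ring
  exact fun k => (hall k).1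

/-- Functions on `ℂˣ` with `F (p z) = p⁻³ z⁻⁶ F z` and `F z⁻¹ = - F z` form a space of dimension
at most two. -/
lemma exists_relation_of_degree_six_odd {F G H : ℂ → ℂ} (hF : DifferentiableOn ℂ F {0}ᶜ)
    (hG : DifferentiableOn ℂ G {0}ᶜ) (hH : DifferentiableOn ℂ H {0}ᶜ) {p : ℂ} (hp0 : p ≠ 0)
    (hF2 : ∀ z ≠ 0, F (p * z) = p ^ (-3 : ℤ) * z ^ (-6 : ℤ) * F z)
    (hG2 : ∀ z ≠ 0, G (p * z) = p ^ (-3 : ℤ) * z ^ (-6 : ℤ) * G z)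
    (hH2 : ∀ z ≠ 0, H (p * z) = p ^ (-3 : ℤ) * z ^ (-6 : ℤ) * H z)
    (hF3 : ∀ z ≠ 0, F z⁻¹ = -F z) (hG3 : ∀ z ≠ 0, G z⁻¹ = -G z) (hH3 : ∀ z ≠ 0, H z⁻¹ = -H z) :
    ∃ a b c : ℂ, (a ≠ 0 ∨ b ≠ 0 ∨ c ≠ 0) ∧ ∀ z ≠ 0, a * F z + b * G z + c * H z = 0 := by
  -- Modulo 6, oddness pairs the coefficients 1 with 5 and 2 with 4 and kills 0 and 3, so the
  -- coefficients 1 and 2 determine the function.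
  refine exists_relation_of_laurentCoeff hF hG hH 1 2 fun a b c h1 h2 => ?_
  have hper := laurentCoeff_add_period (F := fun z => a * F z + b * G z + c * H z)
    (((hF.const_mul _).add (hG.const_mul _)).add (hH.const_mul _)) (A := p ^ (-3 : ℤ)) hp0 (m := 6)
    (fun z hz => by simp only [hF2 z hz, hG2 z hz, hH2 z hz]; ring)
  have hodd := laurentCoeff_neg_of_odd (F := fun z => a * F z + b * G z + c * H z)
    (fun z hz => by simp only [hF3 z hz, hG3 z hz, hH3 z hz]; ring)
  set C := laurentCoeff (fun z => a * F z + b * G z + c * H z)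
  have hstep : ∀ n, C n = 0 ↔ C (n + 6) = 0 := fun n => by
    rw [hper n]
    simp [hp0, zpow_ne_zero]
  have h0 : C 0 = 0 := by
    have := hodd 0
    rw [neg_zero] at this
    linear_combination (1 / 2) * this
  -- The recurrence takes -3 to 3 with multiplier exactly 1, whereas oddness gives C (-3) = -C 3.
  have h3 : C 3 = 0 := by
    have e1 := hodd 3
    have e2 := hper (-3)
    have e3 : p ^ (- -3 : ℤ) * p ^ (-3 : ℤ) = 1 := by
      rw [← zpow_add₀ hp0]; simp
    rw [e3, one_mul] at e2
    norm_num at e1 e2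
    linear_combination (1 / 2) * e1 - (1 / 2) * e2
  have h4 : C 4 = 0 := by
    have := (hstep (-2)).mp (by rw [hodd, h2, neg_zero])
    simpa using this
  have h5 : C 5 = 0 := by
    have := (hstep (-1)).mp (by rw [hodd, h1, neg_zero])
    simpa using this
  have hall : ∀ n : ℤ, C n = 0 ∧ C (n + 1) = 0 ∧ C (n + 2) = 0 ∧ C (n + 3) = 0 ∧ C (n + 4) = 0 ∧
      C (n + 5) = 0 := by
    intro n
    induction n using Int.induction_on with
    | zero => exact ⟨h0, h1, h2, h3, h4, h5⟩
    | succ n ih =>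
      obtain ⟨i0, i1, i2, i3, i4, i5⟩ := ih
      refine ⟨i1, ?_, ?_, ?_, ?_, ?_⟩ <;> rw [add_assoc]
      exacts [i2, i3, i4, i5, (hstep _).mp i0]
    | pred n ih =>
      obtain ⟨i0, i1, i2, i3, i4, i5⟩ := ih
      refine ⟨(hstep _).mpr ?_, ?_, ?_, ?_, ?_, ?_⟩
      · convert i5 using 2; ring
      · convert i0 using 2; ring
      · convert i1 using 2; ring
      · convert i2 using 2; ring
      · convert i3 using 2; ring
      · convert i4 using 2; ring
  exact fun k => (hall k).1

/-! ### Weierstrass' addition formula and interpolation of odd theta functions -/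

/-- `θ(a z^±; p) = θ(a z; p) θ(a / z; p)`. -/
def modThetaPM (p a z : ℂ) : ℂ := modTheta p (a * z) * modTheta p (a / z)

/-- The antisymmetric function `a⁻¹ θ(a z^±; p)`. -/
def thetaBracket (p a z : ℂ) : ℂ := a⁻¹ * modThetaPM p a z

lemma modTheta_div_p {p x : ℂ} (hp0 : p ≠ 0) (hp : ‖p‖ < 1) (hx : x ≠ 0) :
    modTheta p (x / p) = -(x / p) * modTheta p x := by
  have h := modTheta_p_mul hp0 hp (div_ne_zero hx hp0)
  rw [mul_div_cancel₀ x hp0] at h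
  rw [h]
  field_simp

lemma modTheta_div_comm {p : ℂ} (hp0 : p ≠ 0) (hp : ‖p‖ < 1) {a b : ℂ} (ha : a ≠ 0) (hb : b ≠ 0) :
    modTheta p (b / a) = -(b / a) * modTheta p (a / b) := by
  have h := modTheta_inv hp0 hp (div_ne_zero ha hb)
  rwa [inv_div] at h

lemma DifferentiableAt.modTheta {p : ℂ} {f : ℂ → ℂ} {x : ℂ} (hf : DifferentiableAt ℂ f x)
    (h0 : f x ≠ 0) (hp : ‖p‖ < 1) : DifferentiableAt ℂ (fun y => modTheta p (f y)) x := by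
  have h1 : DifferentiableOn ℂ (fun y => _root_.modTheta p y) {0}ᶜ :=
    DifferentiableOn.modTheta isOpen_compl_singleton differentiableOn_id (fun s hs => hs) hp
  exact (h1.differentiableAt (isOpen_compl_singleton.mem_nhds h0)).comp x hf

lemma DifferentiableAt.modThetaPM {p : ℂ} {f g : ℂ → ℂ} {x : ℂ} (hf : DifferentiableAt ℂ f x)
    (hg : DifferentiableAt ℂ g x) (hf0 : f x ≠ 0) (hg0 : g x ≠ 0) (hp : ‖p‖ < 1) :
    DifferentiableAt ℂ (fun y => modThetaPM p (f y) (g y)) x :=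
  (DifferentiableAt.modTheta (hf.mul hg) (mul_ne_zero hf0 hg0) hp).mul
    (DifferentiableAt.modTheta (hf.div hg hg0) (div_ne_zero hf0 hg0) hp)

lemma modThetaPM_inv (p a z : ℂ) : modThetaPM p a z⁻¹ = modThetaPM p a z := by
  rw [modThetaPM, modThetaPM, div_inv_eq_mul, ← div_eq_mul_inv, mul_comm]

lemma modThetaPM_self {p a : ℂ} (hp : ‖p‖ < 1) (ha : a ≠ 0) : modThetaPM p a a = 0 := by
  rw [modThetaPM, div_self ha, modTheta_one hp, mul_zero]

lemma modThetaPM_p_mul {p a z : ℂ} (hp0 : p ≠ 0) (hp : ‖p‖ < 1) (ha : a ≠ 0) (hz : z ≠ 0) :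
    modThetaPM p a (p * z) = p⁻¹ * z ^ (-2 : ℤ) * modThetaPM p a z := by
  have h1 : a * (p * z) = p * (a * z) := by ring
  have h2 : a / (p * z) = (a / z) / p := by field_simp
  rw [modThetaPM, h1, h2, modTheta_p_mul hp0 hp (mul_ne_zero ha hz),
    modTheta_div_p hp0 hp (div_ne_zero ha hz), modThetaPM, zpow_neg]
  norm_cast
  field_simp

lemma modThetaPM_comm {p a b : ℂ} (hp0 : p ≠ 0) (hp : ‖p‖ < 1) (ha : a ≠ 0) (hb : b ≠ 0) :
    modThetaPM p b a = -(b / a) * modThetaPM p a b := by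
  rw [modThetaPM, modThetaPM, modTheta_div_comm hp0 hp ha hb, mul_comm b a]
  ring

lemma thetaBracket_comm {p a b : ℂ} (hp0 : p ≠ 0) (hp : ‖p‖ < 1) (ha : a ≠ 0) (hb : b ≠ 0) :
    thetaBracket p b a = -thetaBracket p a b := by
  rw [thetaBracket, thetaBracket, modThetaPM_comm hp0 hp ha hb]
  field_simp

lemma thetaBracket_self {p a : ℂ} (hp : ‖p‖ < 1) (ha : a ≠ 0) : thetaBracket p a a = 0 := by
  rw [thetaBracket, modThetaPM_self hp ha, mul_zero]

/-- Weierstrass' three-term addition formula for theta functions. -/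
lemma thetaBracket_plucker {p a b c d : ℂ} (hp0 : p ≠ 0) (hp : ‖p‖ < 1) (ha : a ≠ 0) (hb : b ≠ 0)
    (hc : c ≠ 0) (hd : d ≠ 0) :
    thetaBracket p a b * thetaBracket p c d - thetaBracket p a c * thetaBracket p b d
      + thetaBracket p a d * thetaBracket p b c = 0 := by
  have hdiff : ∀ x : ℂ, x ≠ 0 → DifferentiableOn ℂ (fun z => thetaBracket p x z) {0}ᶜ :=
    fun x hx z hz => ((DifferentiableAt.modThetaPM (differentiableAt_const x) differentiableAt_id
      hx hz hp).const_mul _).differentiableWithinAt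
  have hper : ∀ x : ℂ, x ≠ 0 → ∀ z ≠ 0,
      thetaBracket p x (p * z) = p⁻¹ * z ^ (-2 : ℤ) * thetaBracket p x z := fun x hx z hz => by
    rw [thetaBracket, thetaBracket, modThetaPM_p_mul hp0 hp hx hz]
    ring
  obtain ⟨α, β, γ, hne, hrel⟩ := exists_relation_of_degree_two (hdiff a ha) (hdiff b hb)
    (hdiff c hc) hp0 (inv_ne_zero hp0) (hper a ha) (hper b hb) (hper c hc)
  -- At a, b, c the relation becomes a skew-symmetric linear system for α, β, γ. Combined with its
  -- value at d, each coefficient times the claimed expression is zero, and some coefficient is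
  -- non-zero.
  have e1 := hrel a ha
  have e2 := hrel b hb
  have e3 := hrel c hc
  have e4 := hrel d hd
  simp only [thetaBracket_self hp ha, thetaBracket_self hp hb, thetaBracket_self hp hc,
    thetaBracket_comm hp0 hp ha hb, thetaBracket_comm hp0 hp ha hc,
    thetaBracket_comm hp0 hp hb hc] at e1 e2 e3
  set x := thetaBracket p a b
  set y := thetaBracket p a c
  set w := thetaBracket p b c
  rcases hne with h | h | h <;> refine mul_left_cancel₀ h ?_
  · linear_combination thetaBracket p c d * e2 - thetaBracket p b d * e3 + w * e4
  · linear_combination -thetaBracket p c d * e1 + thetaBracket p a d * e3 - y * e4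
  · linear_combination thetaBracket p b d * e1 - thetaBracket p a d * e2 + x * e4

/-- The odd theta function of degree six attached to `s₁, …, s₆`, where `s₁ ⋯ s₆ = p`. -/
def oddTheta (p a b : ℂ) (c : Fin 4 → ℂ) (z : ℂ) : ℂ :=
  z ^ (-2 : ℤ) * (modTheta p (a * z) * modTheta p (b * z) * ∏ k, modTheta p (c k * z))
    - z ^ 2 * (modTheta p (a / z) * modTheta p (b / z) * ∏ k, modTheta p (c k / z))

lemma modTheta_sq_p_mul {p z : ℂ} (hp0 : p ≠ 0) (hp : ‖p‖ < 1) (hz : z ≠ 0) :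
    modTheta p ((p * z) ^ 2) = p⁻¹ * z ^ (-4 : ℤ) * modTheta p (z ^ 2) := by
  have h : (p * z) ^ 2 = p * (p * z ^ 2) := by ring
  rw [h, modTheta_p_mul hp0 hp (by positivity), modTheta_p_mul hp0 hp (by positivity), zpow_neg]
  norm_cast
  field_simp

/-- The six theta factors contribute the inverse product of the parameters in one term and the
product itself in the other. Balancing to `p`, with the prefactors z^{∓2}, makes the two multipliers
equal. -/
lemma oddTheta_p_mul {p a b : ℂ} {c : Fin 4 → ℂ} (hp0 : p ≠ 0) (hp : ‖p‖ < 1) (ha : a ≠ 0)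
    (hb : b ≠ 0) (hc : ∀ k, c k ≠ 0) (hbal : a * b * ∏ k, c k = p) {z : ℂ} (hz : z ≠ 0) :
    oddTheta p a b c (p * z) = p ^ (-3 : ℤ) * z ^ (-6 : ℤ) * oddTheta p a b c z := by
  have h1 : ∀ x : ℂ, x ≠ 0 → modTheta p (x * (p * z)) = -(x * z)⁻¹ * modTheta p (x * z) := by
    intro x hx
    rw [← modTheta_p_mul hp0 hp (mul_ne_zero hx hz)]
    congr 1; ring
  have h2 : ∀ x : ℂ, x ≠ 0 → modTheta p (x / (p * z)) = -(x / z / p) * modTheta p (x / z) := by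
    intro x hx
    rw [← modTheta_div_p hp0 hp (div_ne_zero hx hz)]
    congr 1; field_simp
  have hc0 := hc 0
  have hc1 := hc 1
  have hc2 := hc 2
  have hc3 := hc 3
  have e1 : (z ^ (-6 : ℤ) : ℂ) = (z ^ 6)⁻¹ := by rw [zpow_neg]; norm_cast
  have e2 : (p ^ (-3 : ℤ) : ℂ) = (p ^ 3)⁻¹ := by rw [zpow_neg]; norm_cast
  have e3 : ∀ y : ℂ, (y ^ (-2 : ℤ) : ℂ) = (y ^ 2)⁻¹ := fun y => by rw [zpow_neg]; norm_cast
  simp only [Fin.prod_univ_four] at hbal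
  simp only [oddTheta, Fin.prod_univ_four, h1 _ ha, h1 _ hb, h1 _ (hc _), h2 _ ha, h2 _ hb,
    h2 _ (hc _), e1, e2, e3]
  have e4 : (a * b * (c 0 * c 1 * c 2 * c 3))⁻¹ = p⁻¹ := by rw [hbal]
  rw [mul_sub]
  congr 1
  · calc _ = (a * b * (c 0 * c 1 * c 2 * c 3))⁻¹ * (p ^ 2)⁻¹ * (z ^ 6)⁻¹ * ((z ^ 2)⁻¹ *
        (modTheta p (a * z) * modTheta p (b * z) * (modTheta p (c 0 * z) * modTheta p (c 1 * z) *
        modTheta p (c 2 * z) * modTheta p (c 3 * z)))) := by field_simp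
      _ = _ := by rw [e4]; field_simp
  · calc _ = (a * b * (c 0 * c 1 * c 2 * c 3)) * (p ^ 4)⁻¹ * (z ^ 6)⁻¹ * (z ^ 2 *
        (modTheta p (a / z) * modTheta p (b / z) * (modTheta p (c 0 / z) * modTheta p (c 1 / z) *
        modTheta p (c 2 / z) * modTheta p (c 3 / z)))) := by field_simp
      _ = _ := by rw [hbal]; field_simp

lemma oddTheta_inv (p a b : ℂ) (c : Fin 4 → ℂ) (z : ℂ) :
    oddTheta p a b c z⁻¹ = -oddTheta p a b c z := by
  simp only [oddTheta, div_inv_eq_mul, ← div_eq_mul_inv, inv_zpow', inv_pow, zpow_neg]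
  norm_cast
  simp only [inv_inv]
  ring

lemma differentiableOn_oddTheta {p a b : ℂ} {c : Fin 4 → ℂ} (hp : ‖p‖ < 1) (ha : a ≠ 0)
    (hb : b ≠ 0) (hc : ∀ k, c k ≠ 0) : DifferentiableOn ℂ (oddTheta p a b c) {0}ᶜ := by
  intro z hz
  have hz0 : z ≠ 0 := hz
  have h1 : ∀ x : ℂ, x ≠ 0 → DifferentiableAt ℂ (fun z => modTheta p (x * z)) z := fun x hx =>
    DifferentiableAt.modTheta (by fun_prop) (mul_ne_zero hx hz0) hp
  have h2 : ∀ x : ℂ, x ≠ 0 → DifferentiableAt ℂ (fun z => modTheta p (x / z)) z := fun x hx =>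
    DifferentiableAt.modTheta (by fun_prop (disch := exact hz0)) (div_ne_zero hx hz0) hp
  refine DifferentiableAt.differentiableWithinAt (DifferentiableAt.sub ?_ ?_)
  · exact (differentiableAt_zpow.mpr (Or.inl hz0)).mul (((h1 a ha).mul (h1 b hb)).mul
      (DifferentiableAt.fun_finsetProd fun k _ => h1 _ (hc k)))
  · exact (differentiableAt_pow 2).mul (((h2 a ha).mul (h2 b hb)).mul
      (DifferentiableAt.fun_finsetProd fun k _ => h2 _ (hc k)))

/-- The three functions lie in a space of dimension at most two, hence are dependent. At z = a and z
= b one term of `oddTheta` and one of the two interpolating functions vanish, which fixes the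
coefficients; genericity allows the remaining common theta factors to be cancelled. -/
lemma oddTheta_eq_of_generic {p a b : ℂ} {c : Fin 4 → ℂ} (hp0 : p ≠ 0) (hp : ‖p‖ < 1) (ha : a ≠ 0)
    (hb : b ≠ 0) (hc : ∀ k, c k ≠ 0) (hbal : a * b * ∏ k, c k = p)
    (h1 : modTheta p (a * a) ≠ 0) (h2 : modTheta p (b * b) ≠ 0) (h3 : modTheta p (a * b) ≠ 0)
    (h4 : modTheta p (a / b) ≠ 0) {z : ℂ} (hz : z ≠ 0) :
    b * modTheta p (a / b) * oddTheta p a b c z = z⁻¹ * modTheta p (z ^ 2) *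
      ((∏ k, modTheta p (c k * b)) * modThetaPM p a z
        - (∏ k, modTheta p (c k * a)) * modThetaPM p b z) := by
  have hdiff : ∀ x : ℂ, x ≠ 0 →
      DifferentiableOn ℂ (fun z => z⁻¹ * modTheta p (z ^ 2) * modThetaPM p x z) {0}ᶜ :=
    fun x hx z hz => (((differentiableAt_inv hz).mul (DifferentiableAt.modTheta
      (differentiableAt_pow 2) (pow_ne_zero 2 hz) hp)).mul (DifferentiableAt.modThetaPM
      (differentiableAt_const x) differentiableAt_id hx hz hp)).differentiableWithinAt
  have hper : ∀ x : ℂ, x ≠ 0 → ∀ z ≠ 0,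
      (p * z)⁻¹ * modTheta p ((p * z) ^ 2) * modThetaPM p x (p * z)
        = p ^ (-3 : ℤ) * z ^ (-6 : ℤ) * (z⁻¹ * modTheta p (z ^ 2) * modThetaPM p x z) := by
    intro x hx z hz
    rw [modThetaPM_p_mul hp0 hp hx hz, modTheta_sq_p_mul hp0 hp hz]
    simp only [zpow_neg]
    norm_cast
    field_simp
  have hodd : ∀ x : ℂ, x ≠ 0 → ∀ z ≠ 0, z⁻¹⁻¹ * modTheta p (z⁻¹ ^ 2) * modThetaPM p x z⁻¹
      = -(z⁻¹ * modTheta p (z ^ 2) * modThetaPM p x z) := by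
    intro x hx z hz
    rw [modThetaPM_inv, inv_pow, modTheta_inv hp0 hp (pow_ne_zero 2 hz), inv_inv]
    field_simp
  obtain ⟨α, β, γ, hne, hrel⟩ := exists_relation_of_degree_six_odd
    (differentiableOn_oddTheta hp ha hb hc) (hdiff a ha) (hdiff b hb) hp0
    (fun z hz => oddTheta_p_mul hp0 hp ha hb hc hbal hz) (hper a ha) (hper b hb)
    (fun z _ => oddTheta_inv p a b c z) (hodd a ha) (hodd b hb)
  have e1 := hrel a ha
  have e2 := hrel b hb
  have e3 := hrel z hz
  simp only [modThetaPM_self hp ha, modThetaPM_self hp hb, oddTheta, div_self ha, div_self hb,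
    modTheta_one hp, mul_zero, zero_mul, sub_zero, add_zero, mul_comm b a] at e1 e2
  rw [modThetaPM_comm hp0 hp ha hb] at e1
  simp only [modThetaPM, zpow_neg] at e1 e2
  norm_cast at e1 e2
  rw [← pow_two] at h1 h2
  simp only [← pow_two] at e1 e2
  set A := ∏ k, modTheta p (c k * a)
  set B := ∏ k, modTheta p (c k * b)
  set x := modTheta p (a / b)
  have e1' : α * A - γ * (b * x) = 0 := by
    have : modTheta p (a ^ 2) * modTheta p (a * b) * (α * A - γ * (b * x)) = 0 := by
      field_simp at e1
      linear_combination e1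
    exact (mul_eq_zero.mp this).resolve_left (mul_ne_zero h1 h3)
  have e2' : α * B + β * (b * x) = 0 := by
    have : modTheta p (b ^ 2) * modTheta p (a * b) * (α * B + β * (b * x)) = 0 := by
      field_simp at e2
      rw [mul_comm b a] at e2
      linear_combination e2
    exact (mul_eq_zero.mp this).resolve_left (mul_ne_zero h2 h3)
  -- With α = 0 the two evaluations would force β = γ = 0, since b θ(a/b) ≠ 0.
  have hα : α ≠ 0 := by
    rintro rfl
    simp [hb, h4] at e1' e2'
    simp [e1', e2'] at hne
  refine mul_left_cancel₀ hα ?_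
  linear_combination b * x * e3 - (z⁻¹ * modTheta p (z ^ 2) * modThetaPM p a z) * e2' +
    (z⁻¹ * modTheta p (z ^ 2) * modThetaPM p b z) * e1'

lemma modTheta_ne_zero_of_notMem {p a x : ℂ} {m : ℕ} (hp0 : p ≠ 0) (hp : ‖p‖ < 1) (ha : a ≠ 0)
    (hx0 : x ≠ 0) (hx : x ∉ {x : ℂ | ∃ k : ℤ, a * x ^ m = p ^ k}) :
    modTheta p (a * x ^ m) ≠ 0 :=
  modTheta_ne_zero hp0 hp (mul_ne_zero ha (pow_ne_zero m hx0)) fun k h => hx ⟨k, h⟩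

/-- Interpolation of an odd theta function of degree six at two of its parameters. -/
theorem oddTheta_eq {p a b : ℂ} {c : Fin 4 → ℂ} (hp0 : p ≠ 0) (hp : ‖p‖ < 1) (ha : a ≠ 0)
    (hb : b ≠ 0) (hc : ∀ k, c k ≠ 0) (hbal : a * b * ∏ k, c k = p) {z : ℂ} (hz : z ≠ 0) :
    b * modTheta p (a / b) * oddTheta p a b c z = z⁻¹ * modTheta p (z ^ 2) *
      ((∏ k, modTheta p (c k * b)) * modThetaPM p a z
        - (∏ k, modTheta p (c k * a)) * modThetaPM p b z) := by
  -- The deformation a x, b x², c 0 / x³ preserves the balancing. The exponents 1 and 2 differ so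
  -- that a/b moves as well as a², b² and ab; the generic case then holds off a countable set and
  -- continuity gives x = 1.
  let d : ℂ → Fin 4 → ℂ := fun x => ![c 0 / x ^ 3, c 1, c 2, c 3]
  let f : ℂ → ℂ := fun x => b * x ^ 2 * modTheta p ((a * x) / (b * x ^ 2)) *
    oddTheta p (a * x) (b * x ^ 2) (d x) z - z⁻¹ * modTheta p (z ^ 2) *
      ((∏ k, modTheta p (d x k * (b * x ^ 2))) * modThetaPM p (a * x) z
        - (∏ k, modTheta p (d x k * (a * x))) * modThetaPM p (b * x ^ 2) z)
  have hc0 := hc 0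
  have hc1 := hc 1
  have hc2 := hc 2
  have hc3 := hc 3
  suffices f 1 = 0 by
    have hd : d 1 = c := by
      ext k; fin_cases k <;> simp [d]
    simpa [f, hd, sub_eq_zero] using this
  have hθ : ∀ g : ℂ → ℂ, DifferentiableAt ℂ g 1 → g 1 ≠ 0 →
      DifferentiableAt ℂ (fun x => modTheta p (g x)) 1 := fun g hg h0 =>
    DifferentiableAt.modTheta hg h0 hp
  have hcont : DifferentiableAt ℂ f 1 := by
    simp only [f, d, oddTheta, modThetaPM, Fin.prod_univ_four, Matrix.cons_val_zero,
      Matrix.cons_val_one, Matrix.cons_val]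
    fun_prop (disch := first | (simp; done) | (simp [*]; done))
  refine eq_zero_of_continuousAt_of_countable hcont.continuousAt
    (((((countable_singleton (0 : ℂ)).union (countable_mul_pow_eq_zpow (p := p)
      (mul_ne_zero ha ha) two_ne_zero)).union (countable_mul_pow_eq_zpow (p := p)
      (mul_ne_zero hb hb) four_ne_zero)).union (countable_mul_pow_eq_zpow (p := p)
      (mul_ne_zero ha hb) three_ne_zero)).union (countable_mul_pow_eq_zpow (p := p)
      (div_ne_zero hb ha) one_ne_zero)) fun x hx => ?_
  simp only [mem_union, not_or] at hx
  obtain ⟨⟨⟨⟨x0, x1⟩, x2⟩, x3⟩, x4⟩ := hx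
  have x0' : x ≠ 0 := x0
  rw [sub_eq_zero]
  refine oddTheta_eq_of_generic hp0 hp (by positivity) (by positivity) (fun k => ?_) ?_ ?_ ?_ ?_ ?_ hz
  · fin_cases k <;> simp [d, hc, x0']
  · rw [← hbal]
    simp only [Fin.prod_univ_four, d, Matrix.cons_val_zero, Matrix.cons_val_one, Matrix.cons_val]
    field_simp
  · convert modTheta_ne_zero_of_notMem hp0 hp (mul_ne_zero ha ha) x0' x1 using 2; ring
  · convert modTheta_ne_zero_of_notMem hp0 hp (mul_ne_zero hb hb) x0' x2 using 2; ring
  · convert modTheta_ne_zero_of_notMem hp0 hp (mul_ne_zero ha hb) x0' x3 using 2; ring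
  · rw [modTheta_div_comm hp0 hp (by positivity) (by positivity)]
    refine mul_ne_zero (neg_ne_zero.mpr (div_ne_zero (by positivity) (by positivity))) ?_
    convert modTheta_ne_zero_of_notMem hp0 hp (div_ne_zero hb ha) x0' x4 using 2
    field_simp

/-! ### Gamma functional equations and the contiguous relation of the beta integral -/

lemma selbergConst_eq {p q : ℂ} (hp : ‖p‖ < 1) (hq : ‖q‖ < 1) :
    selbergConst p q = pochhammerInf p p * pochhammerInf q q := by
  have h := (multipliable_pochhammerInf hp p).tprod_mul (multipliable_pochhammerInf hq q)
  rw [pochhammerInf, pochhammerInf, ← h, selbergConst]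
  refine tprod_congr fun j => ?_
  ring

/-- The factor (z; p)_∞ of θ must cancel against the same factor in the denominator of Γ(z), hence
the non-vanishing hypothesis. -/
lemma ellipticGamma_q_mul {p q z : ℂ} (hp : ‖p‖ < 1) (hq0 : q ≠ 0) (hq : ‖q‖ < 1)
    (hz : pochhammerInf p z ≠ 0) :
    ellipticGamma p q (q * z) = modTheta p z * ellipticGamma p q z := by
  have h1 : p * q / (q * z) = p / z := by field_simp
  have h2 : q * (p / z) = p * q / z := by ring
  rw [ellipticGamma_eq, ellipticGamma_eq, h1, doublePochhammer_eq hp hq (p / z),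
    doublePochhammer_eq hp hq z, h2, modTheta]
  field_simp

/-- This combines the reflection Γ(x) Γ(pq/x) = 1 with one q-shift. It supplies the cancellations
that identify the residue with the value of the beta integral. -/
lemma ellipticGamma_mul_modTheta {p q x : ℂ} (hp0 : p ≠ 0) (hp : ‖p‖ < 1) (hq : ‖q‖ < 1)
    (hx : ‖x‖ < 1) (hpx : ‖p‖ < ‖x‖) :
    ellipticGamma p q x * ellipticGamma p q (p / x) * modTheta p x = 1 := by
  have hx0 : x ≠ 0 := norm_pos_iff.mp ((norm_nonneg _).trans_lt hpx)
  have hpx1 : ‖p / x‖ < 1 := by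
    rwa [norm_div, div_lt_one (norm_pos_iff.mpr hx0)]
  have h1 : p * q / (p / x) = q * x := by field_simp
  have h2 : q * (p / x) = p * q / x := by ring
  have e1 := doublePochhammer_eq hp hq x
  have e2 := doublePochhammer_eq hp hq (p / x)
  have n1 := doublePochhammer_ne_zero_of_norm_lt hp hq hx
  have n2 := doublePochhammer_ne_zero_of_norm_lt hp hq hpx1
  rw [h2] at e2
  rw [ellipticGamma_eq, ellipticGamma_eq, h1, modTheta]
  field_simp
  rw [e1, e2]
  ring

/-- `E(x) E(x⁻¹) = θ(x; p) θ(x⁻¹; q) E(p q x) E(p q / x)` for the double Pochhammer symbol `E`. -/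
lemma doublePochhammer_mul_inv {p q : ℂ} (hp : ‖p‖ < 1) (hq : ‖q‖ < 1) (x : ℂ) :
    doublePochhammer p q x * doublePochhammer p q x⁻¹ = modTheta p x * modTheta q x⁻¹ *
      (doublePochhammer p q (p * q * x) * doublePochhammer p q (p * q / x)) := by
  rw [doublePochhammer_eq hp hq x, doublePochhammer_eq' hp hq (q * x),
    doublePochhammer_eq' hp hq x⁻¹, doublePochhammer_eq hp hq (p * x⁻¹), modTheta, modTheta,
    div_inv_eq_mul, div_eq_mul_inv p x]
  have h1 : p * (q * x) = p * q * x := by ring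
  have h2 : q * (p * x⁻¹) = p * q / x := by ring
  rw [h1, h2]
  ring

/-- On the unit circle `1 / Γ(x^±) = θ(x; p) θ(x⁻¹; q)`, also where `Γ` has its poles. -/
lemma inv_ellipticGammaPM_one {p q x : ℂ} (hp : ‖p‖ < 1) (hq : ‖q‖ < 1) (hx : ‖x‖ = 1) :
    (ellipticGammaPM p q 1 x)⁻¹ = modTheta p x * modTheta q x⁻¹ := by
  have hpq : ‖p * q‖ < 1 := by
    rw [norm_mul]; exact mul_lt_one_of_nonneg_of_lt_one_left (norm_nonneg _) hp hq.le
  have n1 : doublePochhammer p q (p * q * x) ≠ 0 :=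
    doublePochhammer_ne_zero_of_norm_lt hp hq (by rwa [norm_mul, hx, mul_one])
  have n2 : doublePochhammer p q (p * q / x) ≠ 0 :=
    doublePochhammer_ne_zero_of_norm_lt hp hq (by rwa [norm_div, hx, div_one])
  rw [ellipticGammaPM, one_mul, one_div, ellipticGamma_eq, ellipticGamma_eq, div_inv_eq_mul,
    mul_inv, inv_div, inv_div, div_mul_div_comm, doublePochhammer_mul_inv hp hq, mul_comm
    (doublePochhammer p q (p * q / x))]
  exact mul_div_cancel_right₀ _ (mul_ne_zero n1 n2)

/-- The integrand of the elliptic beta integral, with two of the parameters singled out. -/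
def betaWeight (p q a b : ℂ) (c : Fin 4 → ℂ) (z : ℂ) : ℂ :=
  ellipticGammaPM p q a z * ellipticGammaPM p q b z * (∏ k, ellipticGammaPM p q (c k) z) /
    ellipticGammaPM p q 1 (z ^ 2)

/-- The value of the elliptic beta integral, with two of the parameters singled out. -/
def betaValue (p q a b : ℂ) (c : Fin 4 → ℂ) : ℂ :=
  ellipticGamma p q (a * b) * (∏ k, ellipticGamma p q (a * c k)) *
    (∏ k, ellipticGamma p q (b * c k)) * ∏ j, ∏ k ∈ Finset.Ioi j, ellipticGamma p q (c j * c k)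

/-- The factor `Γ(q s z) Γ(s / z)`. -/
def gammaPair (p q s z : ℂ) : ℂ := ellipticGamma p q (q * s * z) * ellipticGamma p q (s / z)

/-- The function whose `q`-difference is a contiguous combination of integrands. -/
def betaKernel (p q a b : ℂ) (c : Fin 4 → ℂ) (z : ℂ) : ℂ :=
  gammaPair p q a z * gammaPair p q b z * (∏ k, gammaPair p q (c k) z) *
    modTheta q (z ^ 2)⁻¹ * z⁻¹

lemma gammaPair_eq {p q s z : ℂ} (hp : ‖p‖ < 1) (hq0 : q ≠ 0) (hq : ‖q‖ < 1)
    (h : pochhammerInf p (s * z) ≠ 0) :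
    gammaPair p q s z = modTheta p (s * z) * ellipticGammaPM p q s z := by
  rw [gammaPair, mul_assoc, ellipticGamma_q_mul hp hq0 hq h, ellipticGammaPM, mul_assoc]

lemma ellipticGammaPM_inv (p q s z : ℂ) : ellipticGammaPM p q s z⁻¹ = ellipticGammaPM p q s z := by
  rw [ellipticGammaPM, ellipticGammaPM, div_inv_eq_mul, ← div_eq_mul_inv, mul_comm]

lemma ellipticGammaPM_q_mul {p q s z : ℂ} (hp : ‖p‖ < 1) (hq0 : q ≠ 0) (hq : ‖q‖ < 1)
    (h1 : pochhammerInf p (s * z) ≠ 0) (h2 : pochhammerInf p (s / z) ≠ 0) :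
    ellipticGammaPM p q (q * s) z = modThetaPM p s z * ellipticGammaPM p q s z := by
  rw [ellipticGammaPM, mul_assoc, mul_div_assoc, ellipticGamma_q_mul hp hq0 hq h1,
    ellipticGamma_q_mul hp hq0 hq h2, ellipticGammaPM, modThetaPM]
  ring

/-- The contiguous relation between integrands of elliptic beta integrals on the unit circle. -/
lemma betaKernel_add_inv {p q a b : ℂ} {c : Fin 4 → ℂ} (hp0 : p ≠ 0) (hp : ‖p‖ < 1) (hq0 : q ≠ 0)
    (hq : ‖q‖ < 1) (ha : a ≠ 0) (hb : b ≠ 0) (hc : ∀ k, c k ≠ 0) (hbal : a * b * ∏ k, c k = p)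
    (ha1 : ∀ z : ℂ, ‖z‖ = 1 → pochhammerInf p (a * z) ≠ 0)
    (hb1 : ∀ z : ℂ, ‖z‖ = 1 → pochhammerInf p (b * z) ≠ 0)
    (hc1 : ∀ k, ∀ z : ℂ, ‖z‖ = 1 → pochhammerInf p (c k * z) ≠ 0) {z : ℂ} (hz : ‖z‖ = 1) :
    b * modTheta p (a / b) * (betaKernel p q a b c z + betaKernel p q a b c z⁻¹)
      = (∏ k, modTheta p (c k * b)) * betaWeight p q (q * a) b c z
        - (∏ k, modTheta p (c k * a)) * betaWeight p q a (q * b) c z := by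
  have hz0 : z ≠ 0 := by rintro rfl; simp at hz
  have hz' : ‖z⁻¹‖ = 1 := by rw [norm_inv, hz, inv_one]
  have hw : ‖z ^ 2‖ = 1 := by rw [norm_pow, hz, one_pow]
  have key := oddTheta_eq hp0 hp ha hb hc hbal hz0
  have hdiv : ∀ s : ℂ, (∀ z : ℂ, ‖z‖ = 1 → pochhammerInf p (s * z) ≠ 0) →
    pochhammerInf p (s / z) ≠ 0 := fun s hs => by rw [div_eq_mul_inv]; exact hs _ hz'
  simp only [betaWeight, div_eq_mul_inv _ (ellipticGammaPM p q 1 (z ^ 2)),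
    inv_ellipticGammaPM_one hp hq hw,
    ellipticGammaPM_q_mul hp hq0 hq (ha1 z hz) (hdiv a ha1),
    ellipticGammaPM_q_mul hp hq0 hq (hb1 z hz) (hdiv b hb1)]
  -- The gamma pair with parameter s equals θ(s z; p) times a factor invariant under z ↦ 1/z, and
  -- inverting z multiplies θ(z^{-2}; q) by -z². The sum over z and 1/z is therefore an invariant
  -- factor, the q-theta factor and z times `oddTheta`.
  have hK : betaKernel p q a b c z + betaKernel p q a b c z⁻¹ = ellipticGammaPM p q a z *
      ellipticGammaPM p q b z * (∏ k, ellipticGammaPM p q (c k) z) * modTheta q (z ^ 2)⁻¹ *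
      (z * oddTheta p a b c z) := by
    have e3 : modTheta q (z ^ 2) = -(z ^ 2) * modTheta q (z ^ 2)⁻¹ := by
      have := modTheta_inv hq0 hq (inv_ne_zero (pow_ne_zero 2 hz0))
      rwa [inv_inv] at this
    simp only [betaKernel, gammaPair_eq hp hq0 hq (ha1 z hz), gammaPair_eq hp hq0 hq (hb1 z hz),
      gammaPair_eq hp hq0 hq (hc1 _ z hz), gammaPair_eq hp hq0 hq (ha1 _ hz'),
      gammaPair_eq hp hq0 hq (hb1 _ hz'), gammaPair_eq hp hq0 hq (hc1 _ _ hz'),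
      ellipticGammaPM_inv, Finset.prod_mul_distrib, oddTheta, inv_pow, inv_inv, e3, zpow_neg,
      ← div_eq_mul_inv _ z]
    norm_cast
    field_simp
    ring
  rw [hK]
  linear_combination ellipticGammaPM p q a z * ellipticGammaPM p q b z *
    (∏ k, ellipticGammaPM p q (c k) z) * modTheta q (z ^ 2)⁻¹ * z * key +
    ellipticGammaPM p q a z * ellipticGammaPM p q b z *
    (∏ k, ellipticGammaPM p q (c k) z) * modTheta q (z ^ 2)⁻¹ * modTheta p (z ^ 2) *
      ((∏ k, modTheta p (c k * b)) * modThetaPM p a z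
        - (∏ k, modTheta p (c k * a)) * modThetaPM p b z) * mul_inv_cancel₀ hz0

/-- The map z ↦ 1/(qz) swaps the two gamma functions in every pair. The sign comes from θ(z^{-2};
q), whose multiplier -1/(q z²) meets the factor q z² coming from z⁻¹. -/
lemma betaKernel_reflect {p q : ℂ} (a b : ℂ) (c : Fin 4 → ℂ) (hq0 : q ≠ 0) (hq : ‖q‖ < 1) {z : ℂ}
    (hz : z ≠ 0) : betaKernel p q a b c (q * z)⁻¹ = -betaKernel p q a b c z := by
  have h1 : ∀ s, gammaPair p q s (q * z)⁻¹ = gammaPair p q s z := by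
    intro s
    rw [gammaPair, gammaPair, mul_comm]
    congr 2
    · rw [div_inv_eq_mul]; ring
    · field_simp
  have h2 : modTheta q (((q * z)⁻¹ ^ 2)⁻¹) = -(q * z ^ 2)⁻¹ * modTheta q (z ^ 2)⁻¹ := by
    have e : ((q * z)⁻¹ ^ 2)⁻¹ = q * (q * z ^ 2) := by field_simp
    rw [e, modTheta_p_mul hq0 hq (by positivity), modTheta_p_mul hq0 hq (by positivity),
      modTheta_inv hq0 hq (by positivity)]
  simp only [betaKernel, h1, h2]
  field_simp

/-- The radius `|q|^{-1/2}` of the circle fixed by `z ↦ 1 / (q z)`. -/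
def reflectRadius (q : ℂ) : ℝ := (Real.sqrt ‖q‖)⁻¹

lemma one_lt_reflectRadius {q : ℂ} (hq0 : q ≠ 0) (hq : ‖q‖ < 1) : 1 < reflectRadius q :=
  (one_lt_inv₀ (Real.sqrt_pos.mpr (norm_pos_iff.mpr hq0))).mpr
    (by rw [Real.sqrt_lt' one_pos]; simpa using hq)

lemma norm_mul_reflectRadius_sq {q : ℂ} (hq0 : q ≠ 0) : ‖q‖ * reflectRadius q ^ 2 = 1 := by
  rw [reflectRadius, inv_pow, Real.sq_sqrt (norm_nonneg _)]
  exact mul_inv_cancel₀ (norm_ne_zero_iff.mpr hq0)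

/-- The circle is invariant under z ↦ 1/(qz) and the kernel is antisymmetric, so the average equals
its own negative. No regularity of the kernel is needed. -/
lemma circleAverage_betaKernel_reflectRadius {p q : ℂ} (a b : ℂ) (c : Fin 4 → ℂ) (hq0 : q ≠ 0)
    (hq : ‖q‖ < 1) : Real.circleAverage (betaKernel p q a b c) 0 (reflectRadius q) = 0 := by
  set r := reflectRadius q with hr
  have hr1 : 1 < r := one_lt_reflectRadius hq0 hq
  have hr0 : (r : ℂ) ≠ 0 := by exact_mod_cast (zero_lt_one.trans hr1).ne'
  have h1 : Real.circleAverage (fun z => betaKernel p q a b c (q * z)⁻¹) 0 r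
      = Real.circleAverage (betaKernel p q a b c) 0 r := by
    rw [Real.circleAverage_eq_circleAverage_zero_one, ← Real.circleAverage_zero_one_congr_inv]
    have h2 : (fun z : ℂ => betaKernel p q a b c (q * (r * z⁻¹ + 0))⁻¹)
        = fun z => betaKernel p q a b c ((q * r)⁻¹ * z) := by
      ext z; congr 1; rw [add_zero]; simp; ring
    rw [h2, circleAverage_comp_mul (betaKernel p q a b c)]
    congr 1
    have h3 := norm_mul_reflectRadius_sq hq0
    rw [← hr] at h3
    have h4 : 0 < ‖q‖ := norm_pos_iff.mpr hq0
    have h5 : 0 < r := zero_lt_one.trans hr1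
    rw [norm_inv, norm_mul, Complex.norm_real, Real.norm_of_nonneg h5.le, mul_one]
    field_simp
    linarith
  have h2 : Real.circleAverage (fun z => betaKernel p q a b c (q * z)⁻¹) 0 r
      = -Real.circleAverage (betaKernel p q a b c) 0 r := by
    rw [← neg_one_smul ℂ (Real.circleAverage _ _ _), ← Real.circleAverage_fun_smul]
    refine Real.circleAverage_congr_sphere fun z hz => ?_
    have hz0 : z ≠ 0 := by
      rintro rfl
      rw [abs_of_pos (zero_lt_one.trans hr1)] at hz
      simp at hz
      linarith
    simp only [betaKernel_reflect a b c hq0 hq hz0, smul_eq_mul, neg_one_mul]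
  rw [h1] at h2
  linear_combination (1 / 2) * h2

/-- Crossing a simple pole at `b` changes the circle average by the residue. -/
lemma circleAverage_sub_of_simple_pole {F : ℂ → ℂ} {U : Set ℂ} (hU : IsOpen U)
    (hF : DifferentiableOn ℂ F U) {r R : ℝ} {b : ℂ} (hr : 0 < r) (hrb : r < ‖b‖) (hbR : ‖b‖ < R)
    (h : ∀ z, r ≤ ‖z‖ → ‖z‖ ≤ R → z ∈ U) :
    Real.circleAverage (fun z => F z / (1 - b / z)) 0 R
      - Real.circleAverage (fun z => F z / (1 - b / z)) 0 r = F b := by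
  have hR : 0 < R := hr.trans (hrb.trans hbR)
  have hbU : b ∈ U := h b hrb.le hbR.le
  have hD : DifferentiableOn ℂ (fun z => z * dslope F b z) U :=
    differentiableOn_id.mul ((Complex.differentiableOn_dslope (hU.mem_nhds hbU)).mpr hF)
  -- Since F(z)/(1 - b/z) = z F(z)/(z - b), subtracting F(b) z/(z - b) leaves z times the divided
  -- difference, which is holomorphic; only the subtracted term notices the pole.
  have hdec : ∀ ρ : ℝ, 0 < ρ → r ≤ ρ → ρ ≤ R → ρ ≠ ‖b‖ →
      Real.circleAverage (fun z => F z / (1 - b / z)) 0 ρ =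
        Real.circleAverage (fun z => z * dslope F b z) 0 ρ +
          F b * ((2 * Real.pi * Complex.I)⁻¹ * ∮ z in C(0, ρ), (z - b)⁻¹) := by
    intro ρ hρ hrρ hρR hne
    have h1 : Real.circleAverage (fun z => F b * (z / (z - b))) 0 ρ
        = F b * ((2 * Real.pi * Complex.I)⁻¹ * ∮ z in C(0, ρ), (z - b)⁻¹) := by
      simp only [← smul_eq_mul (a := F b), Real.circleAverage_fun_smul]
      rw [Real.circleAverage_eq_circleIntegral hρ.ne', smul_eq_mul (a := (2 * Real.pi * Complex.I)⁻¹)]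
      congr 2
      refine circleIntegral.integral_congr hρ.le fun z hz => ?_
      have hz0 : z ≠ 0 := by
        rintro rfl
        simp at hz
        linarith
      simp only [sub_zero, smul_eq_mul]
      field_simp
    rw [← h1, ← Real.circleAverage_fun_add]
    · refine Real.circleAverage_congr_sphere fun z hz => ?_
      rw [abs_of_pos hρ] at hz
      have hzn : ‖z‖ = ρ := by simpa using hz
      have hz0 : z ≠ 0 := by
        rintro rfl
        simp at hzn
        linarith
      have hzb : z ≠ b := by
        rintro rfl
        exact hne hzn.symm
      have hzb' : z - b ≠ 0 := sub_ne_zero.mpr hzb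
      have h2 : 1 - b / z = (z - b) / z := by field_simp
      simp only [dslope_of_ne F hzb, slope_def_field, h2]
      field_simp
      ring
    · refine ContinuousOn.circleIntegrable hρ.le (hD.continuousOn.mono fun z hz => ?_)
      have hzn : ‖z‖ = ρ := by simpa using hz
      exact h z (by linarith) (by linarith)
    · refine ContinuousOn.circleIntegrable hρ.le fun z hz => ?_
      have hzn : ‖z‖ = ρ := by simpa using hz
      have hzb : z - b ≠ 0 := by
        rw [sub_ne_zero]
        rintro rfl
        exact hne hzn.symm
      exact ContinuousAt.continuousWithinAt (by fun_prop (disch := exact hzb))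
  rw [hdec R hR (hrb.trans hbR).le le_rfl hbR.ne', hdec r hr le_rfl (hrb.trans hbR).le hrb.ne,
    circleAverage_eq_of_differentiableOn hU hD hr (hrb.trans hbR).le h,
    circleIntegral.integral_sub_inv_of_mem_ball (by simpa using hbR)]
  have h0 : (∮ z in C(0, r), (z - b)⁻¹) = 0 := by
    refine Complex.circleIntegral_eq_zero_of_differentiable_on_off_countable hr.le countable_empty
      (fun z hz => ?_) (fun z hz => ?_)
    · have hzb : z - b ≠ 0 := by
        rw [sub_ne_zero]
        rintro rfl
        simp at hz
        linarith
      exact ContinuousAt.continuousWithinAt (by fun_prop (disch := exact hzb))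
    · have hzb : z - b ≠ 0 := by
        rw [sub_ne_zero]
        rintro rfl
        simp at hz
        linarith
      fun_prop (disch := exact hzb)
  rw [h0, inv_mul_cancel₀ Complex.two_pi_I_ne_zero]
  ring

/-- The elliptic beta integral, with two of the parameters singled out. -/
def betaIntegral (p q a b : ℂ) (c : Fin 4 → ℂ) : ℂ :=
  Real.circleAverage (betaWeight p q a b c) 0 1

lemma differentiableOn_ellipticGamma {p q : ℂ} (hp : ‖p‖ < 1) (hq : ‖q‖ < 1) {U : Set ℂ}
    (hU : IsOpen U) {Y : ℂ → ℂ} (hY : DifferentiableOn ℂ Y U) (h0 : ∀ z ∈ U, Y z ≠ 0)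
    (h1 : ∀ z ∈ U, ‖Y z‖ < 1) : DifferentiableOn ℂ (fun z => ellipticGamma p q (Y z)) U := by
  simp only [ellipticGamma_eq]
  exact (DifferentiableOn.doublePochhammer hq hU (differentiableOn_const p)
    ((differentiableOn_const _).div hY h0) fun _ _ => hp).div
    (DifferentiableOn.doublePochhammer hq hU (differentiableOn_const p) hY fun _ _ => hp)
    fun z hz => doublePochhammer_ne_zero_of_norm_lt hp hq (h1 z hz)

lemma isOpen_setOf_lt_norm_and (s : ℝ) (x : ℂ) : IsOpen {z : ℂ | s < ‖z‖ ∧ ‖x * z‖ < 1} :=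
  (isOpen_lt continuous_const continuous_norm).and
    (isOpen_lt (continuous_norm.comp (continuous_const.mul continuous_id)) continuous_const)

lemma differentiableOn_gammaPair {p q s : ℂ} (hp : ‖p‖ < 1) (hq0 : q ≠ 0) (hq : ‖q‖ < 1)
    (hs : s ≠ 0) :
    DifferentiableOn ℂ (gammaPair p q s) {z | ‖s‖ < ‖z‖ ∧ ‖q * s * z‖ < 1} := by
  have hz0 : ∀ z ∈ {z : ℂ | ‖s‖ < ‖z‖ ∧ ‖q * s * z‖ < 1}, z ≠ 0 := fun z hz =>
    norm_pos_iff.mp ((norm_nonneg _).trans_lt hz.1)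
  refine (differentiableOn_ellipticGamma hp hq (isOpen_setOf_lt_norm_and _ _) (by fun_prop)
    (fun z hz => mul_ne_zero (mul_ne_zero hq0 hs) (hz0 z hz)) fun z hz => hz.2).mul
    (differentiableOn_ellipticGamma hp hq (isOpen_setOf_lt_norm_and _ _)
    (DifferentiableOn.div (by fun_prop) differentiableOn_id hz0)
    (fun z hz => div_ne_zero hs (hz0 z hz)) fun z hz => ?_)
  rw [norm_div, div_lt_one (norm_pos_iff.mpr (hz0 z hz))]
  exact hz.1

lemma differentiableOn_thetaFactor {q : ℂ} (hq : ‖q‖ < 1) {U : Set ℂ} (hU : IsOpen U)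
    (h0 : ∀ z ∈ U, z ≠ 0) : DifferentiableOn ℂ (fun z : ℂ => modTheta q (z ^ 2)⁻¹) U :=
  DifferentiableOn.modTheta hU (DifferentiableOn.inv (by fun_prop)
    fun z hz => pow_ne_zero 2 (h0 z hz)) (fun z hz => inv_ne_zero (pow_ne_zero 2 (h0 z hz))) hq

lemma norm_lt_one_of_le_reflectRadius {q s z : ℂ} (hq0 : q ≠ 0)
    (hs : ‖s‖ < reflectRadius q) (hz : ‖z‖ ≤ reflectRadius q) : ‖q * s * z‖ < 1 := by
  have h1 := norm_mul_reflectRadius_sq hq0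
  have h2 : 0 < ‖q‖ := norm_pos_iff.mpr hq0
  rw [norm_mul, norm_mul, ← h1, pow_two, mul_assoc]
  refine mul_lt_mul_of_pos_left ?_ h2
  have h3 : 0 < reflectRadius q := (norm_nonneg _).trans_lt hs
  calc ‖s‖ * ‖z‖ ≤ ‖s‖ * reflectRadius q := by gcongr
    _ < reflectRadius q * reflectRadius q := by gcongr

/-- For s of norm below 1, Γ(qsz) Γ(s/z) has no pole with 1 ≤ |z| ≤ |q|^{-1/2}. The unit circle can
therefore be moved to the reflection circle, where the average vanishes. -/
lemma circleAverage_betaKernel_eq_zero {p q a b : ℂ} {c : Fin 4 → ℂ} (hp : ‖p‖ < 1) (hq0 : q ≠ 0)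
    (hq : ‖q‖ < 1) (ha : a ≠ 0) (hb : b ≠ 0) (hc : ∀ k, c k ≠ 0) (ha1 : ‖a‖ < 1) (hb1 : ‖b‖ < 1)
    (hc1 : ∀ k, ‖c k‖ < 1) : Real.circleAverage (betaKernel p q a b c) 0 1 = 0 := by
  let V : ℂ → Set ℂ := fun s => {z : ℂ | ‖s‖ < ‖z‖ ∧ ‖q * s * z‖ < 1}
  let U : Set ℂ := V a ∩ V b ∩ ⋂ k, V (c k)
  have hU : IsOpen U := ((isOpen_setOf_lt_norm_and _ _).inter (isOpen_setOf_lt_norm_and _ _)).inter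
    (isOpen_iInter_of_finite fun k => isOpen_setOf_lt_norm_and _ _)
  have h0 : ∀ z ∈ U, z ≠ 0 := fun z hz => norm_pos_iff.mp ((norm_nonneg _).trans_lt hz.1.1.1)
  have hd : DifferentiableOn ℂ (betaKernel p q a b c) U := by
    refine ((((((differentiableOn_gammaPair hp hq0 hq ha).mono ?_).mul
      ((differentiableOn_gammaPair hp hq0 hq hb).mono ?_)).mul
      (DifferentiableOn.fun_finsetProd fun k _ =>
        (differentiableOn_gammaPair hp hq0 hq (hc k)).mono ?_)).mul
      (differentiableOn_thetaFactor hq hU h0)).mul (differentiableOn_inv.mono h0))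
    · exact fun z hz => hz.1.1
    · exact fun z hz => hz.1.2
    · exact fun z hz => mem_iInter.mp hz.2 k
  have hr := one_lt_reflectRadius hq0 hq
  rw [circleAverage_eq_of_differentiableOn hU hd one_pos hr.le,
    circleAverage_betaKernel_reflectRadius a b c hq0 hq]
  have hV : ∀ s : ℂ, ‖s‖ < 1 → ∀ z : ℂ, 1 ≤ ‖z‖ → ‖z‖ ≤ reflectRadius q → z ∈ V s :=
    fun s hs z h1 h2 => ⟨hs.trans_le h1, norm_lt_one_of_le_reflectRadius hq0 (hs.trans hr) h2⟩
  exact fun z h1 h2 => ⟨⟨hV a ha1 z h1 h2, hV b hb1 z h1 h2⟩,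
    mem_iInter.mpr fun k => hV (c k) (hc1 k) z h1 h2⟩

lemma continuousOn_ellipticGammaPM {p q a : ℂ} (hp : ‖p‖ < 1) (hq : ‖q‖ < 1) (ha0 : a ≠ 0)
    (ha : ‖a‖ < 1) : ContinuousOn (ellipticGammaPM p q a) (Metric.sphere 0 1) := by
  let U : Set ℂ := {z | ‖a‖ < ‖z‖ ∧ ‖a * z‖ < 1}
  have h0 : ∀ z ∈ U, z ≠ 0 := fun z hz => norm_pos_iff.mp ((norm_nonneg _).trans_lt hz.1)
  have hd : DifferentiableOn ℂ (ellipticGammaPM p q a) U := by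
    refine (differentiableOn_ellipticGamma hp hq (isOpen_setOf_lt_norm_and _ _) (by fun_prop)
      (fun z hz => mul_ne_zero ha0 (h0 z hz)) fun z hz => hz.2).mul
      (differentiableOn_ellipticGamma hp hq (isOpen_setOf_lt_norm_and _ _)
      (DifferentiableOn.div (by fun_prop) differentiableOn_id h0)
      (fun z hz => div_ne_zero ha0 (h0 z hz)) fun z hz => ?_)
    rw [norm_div, div_lt_one (norm_pos_iff.mpr (h0 z hz))]
    exact hz.1
  refine hd.continuousOn.mono fun z hz => ?_
  have hz1 : ‖z‖ = 1 := by simpa using hz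
  exact ⟨by rwa [hz1], by rwa [norm_mul, hz1, mul_one]⟩

lemma continuousOn_inv_ellipticGammaPM_one {p q : ℂ} (hp : ‖p‖ < 1) (hq : ‖q‖ < 1) :
    ContinuousOn (fun z : ℂ => (ellipticGammaPM p q 1 (z ^ 2))⁻¹) (Metric.sphere 0 1) := by
  have hs : ∀ z ∈ Metric.sphere (0 : ℂ) 1, z ∈ ({0}ᶜ : Set ℂ) := fun z hz => by
    rintro rfl; simp at hz
  have h1 : DifferentiableOn ℂ (fun z : ℂ => modTheta p (z ^ 2) * modTheta q (z ^ 2)⁻¹) {0}ᶜ :=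
    (DifferentiableOn.modTheta isOpen_compl_singleton (by fun_prop)
      (fun z hz => pow_ne_zero 2 hz) hp).mul
      (differentiableOn_thetaFactor hq isOpen_compl_singleton fun z hz => hz)
  refine (h1.continuousOn.mono hs).congr fun z hz => ?_
  have hz1 : ‖z‖ = 1 := by simpa using hz
  exact inv_ellipticGammaPM_one hp hq (by rw [norm_pow, hz1, one_pow])

lemma continuousOn_betaWeight {p q a b : ℂ} {c : Fin 4 → ℂ} (hp : ‖p‖ < 1) (hq : ‖q‖ < 1)
    (ha0 : a ≠ 0) (ha : ‖a‖ < 1) (hb0 : b ≠ 0) (hb : ‖b‖ < 1) (hc0 : ∀ k, c k ≠ 0)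
    (hc : ∀ k, ‖c k‖ < 1) : ContinuousOn (betaWeight p q a b c) (Metric.sphere 0 1) := by
  simp only [funext fun z => show betaWeight p q a b c z = _ from div_eq_mul_inv _ _]
  exact (((continuousOn_ellipticGammaPM hp hq ha0 ha).mul
    (continuousOn_ellipticGammaPM hp hq hb0 hb)).mul (continuousOn_finsetProd _ fun k _ =>
      continuousOn_ellipticGammaPM hp hq (hc0 k) (hc k))).mul
    (continuousOn_inv_ellipticGammaPM_one hp hq)

lemma pochhammerInf_mul_ne_zero {p s z : ℂ} (hp : ‖p‖ < 1) (hs : ‖s‖ < 1) (hz : ‖z‖ = 1) :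
    pochhammerInf p (s * z) ≠ 0 :=
  pochhammerInf_ne_zero_of_norm_lt hp (by rwa [norm_mul, hz, mul_one])

lemma norm_q_mul_lt_one {q s : ℂ} (hq : ‖q‖ < 1) (hs : ‖s‖ < 1) : ‖q * s‖ < 1 := by
  rw [norm_mul]
  exact mul_lt_one_of_nonneg_of_lt_one_left (norm_nonneg _) hq hs.le

lemma circleAverage_inv (F : ℂ → ℂ) :
    Real.circleAverage (fun z => F z⁻¹) 0 1 = Real.circleAverage F 0 1 :=
  Real.circleAverage_zero_one_congr_inv

lemma norm_inv_of_sphere {z : ℂ} (hz : z ∈ Metric.sphere (0 : ℂ) |1|) : ‖z‖ = 1 := by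
  simpa using hz

lemma circleIntegrable_of_continuousOn {F : ℂ → ℂ} (h : ContinuousOn F (Metric.sphere 0 1)) :
    CircleIntegrable F 0 1 := ContinuousOn.circleIntegrable zero_le_one h

/-- The contiguous relation between elliptic beta integrals. -/
theorem betaIntegral_contiguous {p q a b : ℂ} {c : Fin 4 → ℂ} (hp0 : p ≠ 0) (hp : ‖p‖ < 1)
    (hq0 : q ≠ 0) (hq : ‖q‖ < 1) (ha : a ≠ 0) (hb : b ≠ 0) (hc : ∀ k, c k ≠ 0)
    (hbal : a * b * ∏ k, c k = p) (ha1 : ‖a‖ < 1) (hb1 : ‖b‖ < 1) (hc1 : ∀ k, ‖c k‖ < 1) :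
    (∏ k, modTheta p (c k * b)) * betaIntegral p q (q * a) b c
      = (∏ k, modTheta p (c k * a)) * betaIntegral p q a (q * b) c := by
  set K := betaKernel p q a b c with hK
  have i1 : CircleIntegrable (betaWeight p q (q * a) b c) 0 1 := circleIntegrable_of_continuousOn
    (continuousOn_betaWeight hp hq (mul_ne_zero hq0 ha) (norm_q_mul_lt_one hq ha1) hb hb1 hc hc1)
  have i2 : CircleIntegrable (betaWeight p q a (q * b) c) 0 1 := circleIntegrable_of_continuousOn
    (continuousOn_betaWeight hp hq ha ha1 (mul_ne_zero hq0 hb) (norm_q_mul_lt_one hq hb1) hc hc1)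
  have hKc : ContinuousOn K (Metric.sphere 0 1) := by
    have hz0 : ∀ z ∈ Metric.sphere (0 : ℂ) 1, z ≠ 0 := fun z hz => by rintro rfl; simp at hz
    have hg : ∀ s : ℂ, s ≠ 0 → ‖s‖ < 1 → ContinuousOn (gammaPair p q s) (Metric.sphere 0 1) :=
      fun s hs hs1 => (differentiableOn_gammaPair hp hq0 hq hs).continuousOn.mono fun z hz => by
        have hz1 : ‖z‖ = 1 := by simpa using hz
        exact ⟨by rwa [hz1], by rw [norm_mul, hz1, mul_one]; exact norm_q_mul_lt_one hq hs1⟩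
    exact ((((hg a ha ha1).mul (hg b hb hb1)).mul (continuousOn_finsetProd _ fun k _ =>
      hg _ (hc k) (hc1 k))).mul ((differentiableOn_thetaFactor hq isOpen_compl_singleton
        fun z hz => hz).continuousOn.mono hz0)).mul (continuousOn_inv₀.mono hz0)
  have hKi : ContinuousOn (fun z => K z⁻¹) (Metric.sphere 0 1) :=
    hKc.comp (continuousOn_inv₀.mono fun z hz => by rintro rfl; simp at hz)
      fun z hz => by simpa using hz
  have key : Real.circleAverage (fun z => b * modTheta p (a / b) * (K z + K z⁻¹)) 0 1
      = Real.circleAverage (fun z => (∏ k, modTheta p (c k * b)) * betaWeight p q (q * a) b c z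
        - (∏ k, modTheta p (c k * a)) * betaWeight p q a (q * b) c z) 0 1 :=
    Real.circleAverage_congr_sphere fun z hz => betaKernel_add_inv hp0 hp hq0 hq ha hb hc hbal
      (fun _ => pochhammerInf_mul_ne_zero hp ha1) (fun _ => pochhammerInf_mul_ne_zero hp hb1)
      (fun k _ => pochhammerInf_mul_ne_zero hp (hc1 k)) (norm_inv_of_sphere hz)
  have i1' := i1.const_fun_smul (a := ∏ k, modTheta p (c k * b))
  have i2' := i2.const_fun_smul (a := ∏ k, modTheta p (c k * a))
  simp only [smul_eq_mul] at i1' i2'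
  rw [Real.circleAverage_fun_sub i1' i2'] at key
  simp only [← smul_eq_mul, Real.circleAverage_fun_smul] at key
  rw [Real.circleAverage_fun_add (circleIntegrable_of_continuousOn hKc)
    (circleIntegrable_of_continuousOn hKi), circleAverage_inv K,
    circleAverage_betaKernel_eq_zero hp hq0 hq ha hb hc ha1 hb1 hc1] at key
  simp only [smul_eq_mul, add_zero, mul_zero] at key
  exact (sub_eq_zero.mp key.symm)

/-- Shifting a produces θ(c k · a) from each Γ(a · c k), and likewise for b, while Γ(q a b) is
common. Thus the values obey the same relation as the integrals. -/
lemma betaValue_contiguous {p q a b : ℂ} {c : Fin 4 → ℂ} (hp : ‖p‖ < 1)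
    (hq0 : q ≠ 0) (hq : ‖q‖ < 1) (ha1 : ‖a‖ < 1) (hb1 : ‖b‖ < 1) (hc1 : ∀ k, ‖c k‖ < 1) :
    (∏ k, modTheta p (c k * b)) * betaValue p q (q * a) b c
      = (∏ k, modTheta p (c k * a)) * betaValue p q a (q * b) c := by
  have h : ∀ s : ℂ, ‖s‖ < 1 → ∀ k, ellipticGamma p q (q * s * c k)
      = modTheta p (c k * s) * ellipticGamma p q (s * c k) := fun s hs k => by
    rw [mul_assoc, ellipticGamma_q_mul hp hq0 hq (pochhammerInf_ne_zero_of_norm_lt hp ?_),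
      mul_comm s]
    rw [norm_mul]
    exact mul_lt_one_of_nonneg_of_lt_one_left (norm_nonneg _) hs (hc1 k).le
  have e : a * (q * b) = q * a * b := by ring
  simp only [betaValue, h a ha1, h b hb1, Finset.prod_mul_distrib, e]
  ring

/-! ### The beta integral when c 3 · b is a power of q -/

/-- The factor `Γ(b / z) (1 - b / z)`, which is regular at `z = b`. -/
def gammaRegular (p q b z : ℂ) : ℂ :=
  doublePochhammer p q (p * q / (b / z)) /
    (pochhammerInf p (p * (b / z)) * doublePochhammer p q (q * (b / z)))

lemma ellipticGamma_div_eq {p q : ℂ} (hp : ‖p‖ < 1) (hq : ‖q‖ < 1) (b z : ℂ) :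
    ellipticGamma p q (b / z) = gammaRegular p q b z / (1 - b / z) := by
  rw [ellipticGamma_eq, doublePochhammer_eq hp hq (b / z), pochhammerInf_eq hp (b / z),
    gammaRegular, div_div]
  congr 1
  ring

/-- The factor of `betaKernel` that remains after removing the simple pole at `z = b`. -/
def betaKernelRegular (p q a b : ℂ) (c : Fin 4 → ℂ) (z : ℂ) : ℂ :=
  gammaPair p q a z * (ellipticGamma p q (q * b * z) * gammaRegular p q b z) *
    (∏ k, gammaPair p q (c k) z) * modTheta q (z ^ 2)⁻¹ * z⁻¹

lemma betaKernel_eq_regular {p q : ℂ} (hp : ‖p‖ < 1) (hq : ‖q‖ < 1) (a b : ℂ) (c : Fin 4 → ℂ)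
    (z : ℂ) : betaKernel p q a b c z = betaKernelRegular p q a b c z / (1 - b / z) := by
  rw [betaKernel, betaKernelRegular, gammaPair, gammaPair, ellipticGamma_div_eq hp hq b z]
  ring

lemma differentiableOn_gammaRegular {p q b : ℂ} (hp : ‖p‖ < 1) (hq : ‖q‖ < 1)
    (hb : b ≠ 0) {U : Set ℂ} (hU : IsOpen U) (h0 : ∀ z ∈ U, z ≠ 0) (h1 : ∀ z ∈ U, ‖p * b‖ < ‖z‖)
    (h2 : ∀ z ∈ U, ‖q * b‖ < ‖z‖) : DifferentiableOn ℂ (gammaRegular p q b) U := by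
  have hd : DifferentiableOn ℂ (fun z => b / z) U :=
    (differentiableOn_const b).div differentiableOn_id h0
  have h3 : ∀ s z : ℂ, z ∈ U → ‖s * b‖ < ‖z‖ → ‖s * (b / z)‖ < 1 := fun s z hz h => by
    rw [← mul_div_assoc, norm_div, div_lt_one (norm_pos_iff.mpr (h0 z hz))]
    exact h
  exact (DifferentiableOn.doublePochhammer hq hU (differentiableOn_const p)
    ((differentiableOn_const _).div hd fun z hz => div_ne_zero hb (h0 z hz)) fun _ _ => hp).div
    ((DifferentiableOn.pochhammerInf hU (hd.const_mul _) hp).mul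
      (DifferentiableOn.doublePochhammer hq hU (differentiableOn_const p) (hd.const_mul _)
        fun _ _ => hp))
    fun z hz => mul_ne_zero (pochhammerInf_ne_zero_of_norm_lt hp (h3 p z hz (h1 z hz)))
      (doublePochhammer_ne_zero_of_norm_lt hp hq (h3 q z hz (h2 z hz)))

/-- Between the unit circle and the reflection circle the only pole is the simple one at z = b: the
bounds on pb and qb keep the other poles of Γ(b/z) inside the unit disc. -/
lemma circleAverage_betaKernel_of_pole {p q a b : ℂ} {c : Fin 4 → ℂ} (hp : ‖p‖ < 1) (hq0 : q ≠ 0)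
    (hq : ‖q‖ < 1) (ha : a ≠ 0) (hc : ∀ k, c k ≠ 0) (ha1 : ‖a‖ < 1)
    (hc1 : ∀ k, ‖c k‖ < 1) (hb1 : 1 < ‖b‖) (hbr : ‖b‖ < reflectRadius q) (hpb : ‖p * b‖ < 1) :
    Real.circleAverage (betaKernel p q a b c) 0 1 = -betaKernelRegular p q a b c b := by
  have hb : b ≠ 0 := norm_pos_iff.mp (zero_lt_one.trans hb1)
  have hqb : ‖q * b‖ < 1 := by
    simpa using norm_lt_one_of_le_reflectRadius (z := 1) hq0 hbr
      (by simpa using (one_lt_reflectRadius hq0 hq).le)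
  let V : ℂ → Set ℂ := fun s => {z : ℂ | ‖s‖ < ‖z‖ ∧ ‖q * s * z‖ < 1}
  let W : Set ℂ := {z : ℂ | ‖p * b‖ < ‖z‖ ∧ ‖q * b * z‖ < 1} ∩
    {z : ℂ | ‖q * b‖ < ‖z‖ ∧ ‖q * b * z‖ < 1}
  let U : Set ℂ := V a ∩ W ∩ ⋂ k, V (c k)
  have hU : IsOpen U := ((isOpen_setOf_lt_norm_and _ _).inter
    ((isOpen_setOf_lt_norm_and _ _).inter (isOpen_setOf_lt_norm_and _ _))).inter
    (isOpen_iInter_of_finite fun k => isOpen_setOf_lt_norm_and _ _)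
  have h0 : ∀ z ∈ U, z ≠ 0 := fun z hz => norm_pos_iff.mp ((norm_nonneg _).trans_lt hz.1.1.1)
  have hd : DifferentiableOn ℂ (betaKernelRegular p q a b c) U := by
    refine ((((((differentiableOn_gammaPair hp hq0 hq ha).mono ?_).mul
      ((differentiableOn_ellipticGamma hp hq hU (by fun_prop)
      (fun z hz => mul_ne_zero (mul_ne_zero hq0 hb) (h0 z hz)) ?_).mul
      (differentiableOn_gammaRegular hp hq hb hU h0 ?_ ?_))).mul
      (DifferentiableOn.fun_finsetProd fun k _ =>
        (differentiableOn_gammaPair hp hq0 hq (hc k)).mono ?_)).mul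
      (differentiableOn_thetaFactor hq hU h0)).mul (differentiableOn_inv.mono h0))
    · exact fun z hz => hz.1.1
    · exact fun z hz => hz.1.2.1.2
    · exact fun z hz => hz.1.2.1.1
    · exact fun z hz => hz.1.2.2.1
    · exact fun z hz => mem_iInter.mp hz.2 k
  have hr := one_lt_reflectRadius hq0 hq
  have hV : ∀ s : ℂ, ‖s‖ < 1 → ∀ z : ℂ, 1 ≤ ‖z‖ → ‖z‖ ≤ reflectRadius q → z ∈ V s :=
    fun s hs z h1 h2 => ⟨hs.trans_le h1, norm_lt_one_of_le_reflectRadius hq0 (hs.trans hr) h2⟩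
  have key := circleAverage_sub_of_simple_pole hU hd one_pos hb1 hbr fun z h1 h2 =>
    ⟨⟨hV a ha1 z h1 h2, ⟨hpb.trans_le h1, norm_lt_one_of_le_reflectRadius hq0 hbr h2⟩,
      ⟨hqb.trans_le h1, norm_lt_one_of_le_reflectRadius hq0 hbr h2⟩⟩,
    mem_iInter.mpr fun k => hV (c k) (hc1 k) z h1 h2⟩
  simp only [← betaKernel_eq_regular hp hq] at key
  rw [show (fun z => betaKernel p q a b c z) = betaKernel p q a b c from rfl,
    circleAverage_betaKernel_reflectRadius a b c hq0 hq] at key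
  linear_combination -key

/-- With c 3 = 1/b, the pair of c 3 gives Γ(q) Γ(b^{-2}), which together with Γ(q b²) cancels the
q-theta factor. The regularized Γ(b/z) at z = b is the inverse of C. -/
lemma betaKernelRegular_self {p q a b : ℂ} {c : Fin 4 → ℂ} (hp0 : p ≠ 0) (hp : ‖p‖ < 1)
    (hq0 : q ≠ 0) (hq : ‖q‖ < 1) (hb1 : 1 < ‖b‖) (hbr : ‖b‖ < reflectRadius q)
    (hcb : c 3 * b = 1) :
    b * selbergConst p q * betaKernelRegular p q a b c b = ellipticGamma p q q *
      (gammaPair p q a b * (gammaPair p q (c 0) b * gammaPair p q (c 1) b *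
        gammaPair p q (c 2) b)) := by
  have hb : b ≠ 0 := norm_pos_iff.mp (zero_lt_one.trans hb1)
  have hc3 : c 3 = b⁻¹ := eq_inv_of_mul_eq_one_left hcb
  have hb2 : ‖(b ^ 2)⁻¹‖ < 1 := by
    rw [norm_inv, norm_pow]
    exact inv_lt_one_of_one_lt₀ (one_lt_pow₀ hb1 two_ne_zero)
  have hqb2 : ‖q * b ^ 2‖ < 1 := by
    have := norm_lt_one_of_le_reflectRadius hq0 hbr hbr.le
    rwa [mul_assoc, ← pow_two] at this
  have e1 : gammaPair p q (c 3) b = ellipticGamma p q q * ellipticGamma p q (b ^ 2)⁻¹ := by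
    rw [gammaPair, hc3]
    congr 2
    · field_simp
    · field_simp
  have e2 : gammaRegular p q b b = doublePochhammer p q (p * q) /
      (pochhammerInf p p * doublePochhammer p q q) := by
    rw [gammaRegular, div_self hb, div_one, mul_one, mul_one]
  have e3 : ellipticGamma p q (q * b * b) * ellipticGamma p q (b ^ 2)⁻¹ * modTheta q (b ^ 2)⁻¹
      = 1 := by
    have f1 : q * b * b = q * b ^ 2 := by ring
    have f2 : p * q / (q * b ^ 2) = p * (b ^ 2)⁻¹ := by field_simp
    have f3 : p * q / (b ^ 2)⁻¹ = p * (q * b ^ 2) := by field_simp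
    have n1 := doublePochhammer_ne_zero_of_norm_lt hp hq hb2
    have n2 := doublePochhammer_ne_zero_of_norm_lt hp hq hqb2
    rw [f1, ellipticGamma_eq, ellipticGamma_eq, f2, f3, modTheta, div_inv_eq_mul]
    have g1 := doublePochhammer_eq' hp hq (b ^ 2)⁻¹
    have g2 := doublePochhammer_eq' hp hq (q * b ^ 2)
    rw [div_mul_div_comm, div_mul_eq_mul_div, div_eq_one_iff_eq (mul_ne_zero n2 n1), g1, g2]
    ring
  have e4 : selbergConst p q * gammaRegular p q b b = 1 := by
    rw [selbergConst_eq hp hq, e2]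
    have g := doublePochhammer_eq' hp hq q
    have n1 := pochhammerInf_ne_zero_of_norm_lt hp hp
    have n2 := doublePochhammer_ne_zero_of_norm_lt hp hq hq
    rw [← mul_div_assoc, div_eq_one_iff_eq (mul_ne_zero n1 n2), g]
    ring
  have e5 : b * b⁻¹ = 1 := mul_inv_cancel₀ hb
  rw [betaKernelRegular, Fin.prod_univ_four, e1]
  set K := gammaPair p q a b * (gammaPair p q (c 0) b * gammaPair p q (c 1) b *
        gammaPair p q (c 2) b) * ellipticGamma p q q
  linear_combination K * (ellipticGamma p q (q * b * b) * ellipticGamma p q (b ^ 2)⁻¹ *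
    modTheta q (b ^ 2)⁻¹ * (selbergConst p q * gammaRegular p q b b)) * e5 +
    K * (selbergConst p q * gammaRegular p q b b) * e3 + K * e4

lemma one_lt_norm_of_pole {b d : ℂ} (hd1 : ‖d‖ < 1) (hdb : d * b = 1) : 1 < ‖b‖ := by
  have h := congrArg norm hdb
  rw [norm_mul, norm_one] at h
  by_contra! hcon
  nlinarith [norm_nonneg b, norm_nonneg d]

lemma norm_lt_reflectRadius_of_pole {q b d : ℂ} (hq0 : q ≠ 0) (hq : ‖q‖ < 1) (hqd : ‖q‖ < ‖d‖ ^ 2)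
    (hdb : d * b = 1) : ‖b‖ < reflectRadius q := by
  have h := congrArg norm hdb
  rw [norm_mul, norm_one] at h
  have h1 := norm_mul_reflectRadius_sq hq0
  have h2 := one_lt_reflectRadius hq0 hq
  have h3 : 0 < ‖b‖ := by
    rw [norm_pos_iff]; rintro rfl; simp at h
  refine lt_of_pow_lt_pow_left₀ 2 (by linarith) ?_
  have h4 : 0 < reflectRadius q ^ 2 := by positivity
  by_contra! hcon
  have h5 : ‖d‖ ^ 2 * ‖b‖ ^ 2 = 1 := by rw [← mul_pow, h, one_pow]
  have h6 : ‖q‖ * reflectRadius q ^ 2 < ‖d‖ ^ 2 * ‖b‖ ^ 2 := by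
    calc ‖q‖ * reflectRadius q ^ 2 < ‖d‖ ^ 2 * reflectRadius q ^ 2 := by gcongr
      _ ≤ _ := by gcongr
  linarith

/-- The elliptic beta integral when a pair of parameters has product `q`. -/
theorem betaIntegral_of_pole {p q a b : ℂ} {c : Fin 4 → ℂ} (hp0 : p ≠ 0) (hp : ‖p‖ < 1)
    (hq0 : q ≠ 0) (hq : ‖q‖ < 1) (ha : a ≠ 0) (hc : ∀ k, c k ≠ 0)
    (hbal : a * b * ∏ k, c k = p) (ha1 : ‖a‖ < 1) (hc1 : ∀ k, ‖c k‖ < 1) (hcb : c 3 * b = 1)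
    (hqc : ‖q‖ < ‖c 3‖ ^ 2) (hcc : ‖c 0 * c 1 * c 2‖ < ‖c 3‖) :
    selbergConst p q * betaIntegral p q a (q * b) c = 2 * betaValue p q a (q * b) c := by
  have hb1 := one_lt_norm_of_pole (hc1 3) hcb
  have hbr := norm_lt_reflectRadius_of_pole hq0 hq hqc hcb
  have hb : b ≠ 0 := norm_pos_iff.mp (zero_lt_one.trans hb1)
  have hab : a / b = c 3 * a := by
    rw [eq_inv_of_mul_eq_one_left hcb]; ring
  -- Since c 3 · b = 1, the balancing involves only a, c 0, c 1, c 2; so p / (c 0 · a) = c 1 · c 2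
  -- and its analogues feed the reflection formula.
  have hp' : a * (c 0 * c 1 * c 2) = p := by
    rw [← hbal, Fin.prod_univ_four]
    linear_combination -(a * (c 0 * c 1 * c 2)) * hcb
  have hpn : ‖p‖ = ‖a‖ * ‖c 0 * c 1 * c 2‖ := by rw [← hp', norm_mul]
  -- This bound gives both |pb| < 1, needed at the crossed pole, and θ(c 3 · a) ≠ 0, needed to
  -- divide at the end.
  have hpc : ‖p‖ < ‖c 3‖ * ‖a‖ := by
    rw [hpn, mul_comm]
    exact mul_lt_mul_of_pos_right hcc (norm_pos_iff.mpr ha)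
  have hpb : ‖p * b‖ < 1 := by
    have h := congrArg norm hcb
    rw [norm_mul, norm_one] at h
    rw [norm_mul, ← h]
    refine mul_lt_mul_of_pos_right (hpc.trans ?_) (norm_pos_iff.mpr hb)
    exact mul_lt_of_lt_one_right (norm_pos_iff.mpr (hc 3)) ha1
  have hbp : ∀ z : ℂ, ‖z‖ = 1 → pochhammerInf p (b * z) ≠ 0 := fun z hz => by
    rw [pochhammerInf_eq hp]
    refine mul_ne_zero (fun h => ?_) (pochhammerInf_ne_zero_of_norm_lt hp ?_)
    · have h1 := congrArg norm (sub_eq_zero.mp h)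
      rw [norm_one, norm_mul, hz] at h1
      linarith
    · rwa [← mul_assoc, norm_mul, hz, mul_one]
  have hmul : ∀ x y : ℂ, ‖x‖ < 1 → ‖y‖ < 1 → ‖x * y‖ < 1 := fun x y hx hy => by
    rw [norm_mul]; exact mul_lt_one_of_nonneg_of_lt_one_left (norm_nonneg _) hx hy.le
  set K := betaKernel p q a b c with hK
  have hKc : ContinuousOn K (Metric.sphere 0 1) := by
    have hz0 : ∀ z ∈ Metric.sphere (0 : ℂ) 1, z ≠ 0 := fun z hz => by rintro rfl; simp at hz
    have hg : ∀ s : ℂ, s ≠ 0 → ‖s‖ < 1 → ContinuousOn (gammaPair p q s) (Metric.sphere 0 1) :=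
      fun s hs hs1 => (differentiableOn_gammaPair hp hq0 hq hs).continuousOn.mono fun z hz => by
        have hz1 : ‖z‖ = 1 := by simpa using hz
        exact ⟨by rwa [hz1], by rw [norm_mul, hz1, mul_one]; exact norm_q_mul_lt_one hq hs1⟩
    have hqb : ‖q * b‖ < 1 := by
      simpa using norm_lt_one_of_le_reflectRadius (z := 1) hq0 hbr
        (by simpa using (one_lt_reflectRadius hq0 hq).le)
    have hgb : ContinuousOn (gammaPair p q b) (Metric.sphere 0 1) := by
      let U : Set ℂ := {z : ℂ | ‖p * b‖ < ‖z‖ ∧ ‖q * b * z‖ < 1} ∩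
        {z : ℂ | ‖q * b‖ < ‖z‖ ∧ ‖q * b * z‖ < 1}
      have hU : IsOpen U :=
        (isOpen_setOf_lt_norm_and _ _).inter (isOpen_setOf_lt_norm_and _ _)
      have h0 : ∀ z ∈ U, z ≠ 0 := fun z hz => norm_pos_iff.mp ((norm_nonneg _).trans_lt hz.1.1)
      have hsU : Metric.sphere (0 : ℂ) 1 ⊆ U := fun z hz => by
        have hz1 : ‖z‖ = 1 := by simpa using hz
        have h3 : ‖q * b * z‖ < 1 := by rwa [norm_mul, hz1, mul_one]
        exact ⟨⟨by rwa [hz1], h3⟩, ⟨by rwa [hz1], h3⟩⟩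
      have h1 : ContinuousOn (fun z => ellipticGamma p q (q * b * z)) (Metric.sphere 0 1) :=
        (differentiableOn_ellipticGamma hp hq hU (by fun_prop)
          (fun z hz => mul_ne_zero (mul_ne_zero hq0 hb) (h0 z hz))
          fun z hz => hz.1.2).continuousOn.mono hsU
      have h2 : ContinuousOn (gammaRegular p q b) (Metric.sphere 0 1) :=
        (differentiableOn_gammaRegular hp hq hb hU h0 (fun z hz => hz.1.1)
          fun z hz => hz.2.1).continuousOn.mono hsU
      refine h1.mul (ContinuousOn.congr (h2.div (continuousOn_const.sub
        (continuousOn_const.div continuousOn_id hz0)) fun z hz h => ?_)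
        fun z _ => ellipticGamma_div_eq hp hq b z)
      have hz1 : ‖z‖ = 1 := by simpa using hz
      have h4 := congrArg norm (sub_eq_zero.mp h)
      rw [norm_one, Pi.div_apply, norm_div, id, hz1] at h4
      linarith
    exact ((((hg a ha ha1).mul hgb).mul (continuousOn_finsetProd _ fun k _ =>
      hg _ (hc k) (hc1 k))).mul ((differentiableOn_thetaFactor hq isOpen_compl_singleton
        fun z hz => hz).continuousOn.mono hz0)).mul (continuousOn_inv₀.mono hz0)
  have hKi : ContinuousOn (fun z => K z⁻¹) (Metric.sphere 0 1) :=
    hKc.comp (continuousOn_inv₀.mono fun z hz => by rintro rfl; simp at hz)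
      fun z hz => by simpa using hz
  -- The factor θ(c 3 · b) = θ(1) removes the integral at (qa, b), where b would lie outside the
  -- unit disc. What is left of the contiguous relation equates one integral with a residue.
  have hB : ∏ k, modTheta p (c k * b) = 0 := by
    rw [Finset.prod_eq_zero (Finset.mem_univ 3)]
    rw [hcb, modTheta_one hp]
  have key : Real.circleAverage (fun z => b * modTheta p (a / b) * (K z + K z⁻¹)) 0 1
      = Real.circleAverage (fun z => -(∏ k, modTheta p (c k * a)) *
        betaWeight p q a (q * b) c z) 0 1 :=
    Real.circleAverage_congr_sphere fun z hz => by
      have := betaKernel_add_inv hp0 hp hq0 hq ha hb hc hbal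
        (fun _ => pochhammerInf_mul_ne_zero hp ha1) hbp
        (fun k _ => pochhammerInf_mul_ne_zero hp (hc1 k)) (norm_inv_of_sphere hz)
      rw [hB, zero_mul, zero_sub] at this
      simp only [this, hK, neg_mul]
  simp only [← smul_eq_mul, Real.circleAverage_fun_smul] at key
  rw [Real.circleAverage_fun_add (circleIntegrable_of_continuousOn hKc)
    (circleIntegrable_of_continuousOn hKi), circleAverage_inv K,
    circleAverage_betaKernel_of_pole hp hq0 hq ha hc ha1 hc1 hb1 hbr hpb] at key
  simp only [smul_eq_mul] at key
  have hreg := betaKernelRegular_self (a := a) hp0 hp hq0 hq hb1 hbr hcb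
  have hθ : modTheta p (c 3 * a) ≠ 0 :=
    modTheta_ne_zero_of_norm hp (hmul _ _ (hc1 3) ha1) (by rwa [norm_mul])
  have hlt : ∀ x y : ℂ, x ≠ 0 → ‖y‖ < 1 → ‖x * y‖ < ‖x‖ := fun x y hx hy => by
    rw [norm_mul]; exact mul_lt_of_lt_one_right (norm_pos_iff.mpr hx) hy
  have g0 := ellipticGamma_mul_modTheta hp0 hp hq (x := c 0 * a) (hmul _ _ (hc1 0) ha1) (by
    rw [← hp', show a * (c 0 * c 1 * c 2) = c 0 * a * (c 1 * c 2) by ring]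
    exact hlt _ _ (mul_ne_zero (hc 0) ha) (hmul _ _ (hc1 1) (hc1 2)))
  have g1 := ellipticGamma_mul_modTheta hp0 hp hq (x := c 1 * a) (hmul _ _ (hc1 1) ha1) (by
    rw [← hp', show a * (c 0 * c 1 * c 2) = c 1 * a * (c 0 * c 2) by ring]
    exact hlt _ _ (mul_ne_zero (hc 1) ha) (hmul _ _ (hc1 0) (hc1 2)))
  have g2 := ellipticGamma_mul_modTheta hp0 hp hq (x := c 2 * a) (hmul _ _ (hc1 2) ha1) (by
    rw [← hp', show a * (c 0 * c 1 * c 2) = c 2 * a * (c 0 * c 1) by ring]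
    exact hlt _ _ (mul_ne_zero (hc 2) ha) (hmul _ _ (hc1 0) (hc1 1)))
  have hc0' := hc 0
  have hc1' := hc 1
  have hc2' := hc 2
  have d0 : p / (c 0 * a) = c 1 * c 2 := by rw [← hp']; field_simp
  have d1 : p / (c 1 * a) = c 0 * c 2 := by rw [← hp']; field_simp
  have d2 : p / (c 2 * a) = c 0 * c 1 := by rw [← hp']; field_simp
  rw [d0] at g0
  rw [d1] at g1
  rw [d2] at g2
  have hx : ∀ x : ℂ, x / b = x * c 3 := fun x => by
    rw [eq_inv_of_mul_eq_one_left hcb]; ring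
  have hqb3 : q * b * c 3 = q := by linear_combination q * hcb
  have i0 : (Finset.Ioi (0 : Fin 4)) = {1, 2, 3} := by decide
  have i1 : (Finset.Ioi (1 : Fin 4)) = {2, 3} := by decide
  have i2 : (Finset.Ioi (2 : Fin 4)) = {3} := by decide
  have i3 : (Finset.Ioi (3 : Fin 4)) = ∅ := by decide
  have hval : betaValue p q a (q * b) c * (modTheta p (c 0 * a) * modTheta p (c 1 * a) *
      modTheta p (c 2 * a)) = ellipticGamma p q q * (gammaPair p q a b * (gammaPair p q (c 0) b *
        gammaPair p q (c 1) b * gammaPair p q (c 2) b)) := by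
    simp only [betaValue, gammaPair, Fin.prod_univ_four, i0, i1, i2, i3, hx, hqb3]
    rw [Finset.prod_insert (by decide), Finset.prod_insert (by decide), Finset.prod_singleton,
      Finset.prod_insert (by decide), Finset.prod_singleton, Finset.prod_singleton,
      Finset.prod_empty]
    have r1 : ∀ k, q * b * c k = q * c k * b := fun k => by ring
    have r2 : a * (q * b) = q * a * b := by ring
    have r3 : ∀ k, a * c k = c k * a := fun k => mul_comm _ _
    simp only [r1, r2, r3]
    set G0 := ellipticGamma p q (c 0 * a) * ellipticGamma p q (c 1 * c 2) * modTheta p (c 0 * a)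
    set G1 := ellipticGamma p q (c 1 * a) * ellipticGamma p q (c 0 * c 2) * modTheta p (c 1 * a)
    set G2 := ellipticGamma p q (c 2 * a) * ellipticGamma p q (c 0 * c 1) * modTheta p (c 2 * a)
    set X := ellipticGamma p q q * (ellipticGamma p q (q * a * b) * ellipticGamma p q (c 3 * a) *
      (ellipticGamma p q (q * c 0 * b) * ellipticGamma p q (c 0 * c 3) *
        (ellipticGamma p q (q * c 1 * b) * ellipticGamma p q (c 1 * c 3)) *
        (ellipticGamma p q (q * c 2 * b) * ellipticGamma p q (c 2 * c 3))))
    have hX : X * (G0 * G1 * G2) = X := by rw [g0, g1, g2]; ring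
    refine Eq.trans ?_ hX
    ring
  have hθ3 : modTheta p (c 0 * a) * modTheta p (c 1 * a) * modTheta p (c 2 * a) ≠ 0 := by
    intro h0
    rcases mul_eq_zero.mp h0 with h1 | h1
    · rcases mul_eq_zero.mp h1 with h2 | h2
      · rw [h2, mul_zero] at g0; exact zero_ne_one g0
      · rw [h2, mul_zero] at g1; exact zero_ne_one g1
    · rw [h1, mul_zero] at g2; exact zero_ne_one g2
  have hI : betaIntegral p q a (q * b) c = Real.circleAverage (betaWeight p q a (q * b) c) 0 1 := rfl
  rw [← hI, Fin.prod_univ_four, hab] at key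
  refine mul_right_cancel₀ (mul_ne_zero hθ3 hθ) ?_
  linear_combination selbergConst p q * key + 2 * modTheta p (c 3 * a) * hreg -
    2 * modTheta p (c 3 * a) * hval

lemma norm_lt_norm_mul_of_prod {p a b : ℂ} {c : Fin 4 → ℂ} (ha : a ≠ 0) (hc : ∀ k, c k ≠ 0)
    (hbal : a * b * ∏ k, c k = p) (hb1 : ‖b‖ < 1) (hc1 : ∀ k, ‖c k‖ < 1) (k : Fin 4) :
    ‖p‖ < ‖c k * a‖ := by
  rw [← hbal, ← Finset.mul_prod_erase _ _ (Finset.mem_univ k),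
    show a * b * (c k * ∏ x ∈ Finset.univ.erase k, c x) = c k * a *
      (b * ∏ x ∈ Finset.univ.erase k, c x) by ring, norm_mul (c k * a)]
  refine mul_lt_of_lt_one_right (norm_pos_iff.mpr (mul_ne_zero (hc k) ha)) ?_
  rw [norm_mul, norm_prod]
  exact mul_lt_one_of_nonneg_of_lt_one_left (norm_nonneg _) hb1
    (Finset.prod_le_one (fun _ _ => norm_nonneg _) fun i _ => (hc1 i).le)

/-- The elliptic beta integral when a pair of parameters has product `q ^ (m + 1)`. -/
theorem betaIntegral_of_q_pow {p q : ℂ} (hp0 : p ≠ 0) (hp : ‖p‖ < 1) (hq0 : q ≠ 0) (hq : ‖q‖ < 1)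
    {c : Fin 4 → ℂ} (hc : ∀ k, c k ≠ 0) (hc1 : ∀ k, ‖c k‖ < 1) (hqc : ‖q‖ < ‖c 3‖ ^ 2)
    (hcc : ‖c 0 * c 1 * c 2‖ < ‖c 3‖) (m : ℕ) {a b : ℂ} (ha : a ≠ 0) (ha1 : ‖a‖ < 1)
    (hbal : a * b * ∏ k, c k = p) (hcb : c 3 * b = q ^ m) :
    selbergConst p q * betaIntegral p q a (q * b) c = 2 * betaValue p q a (q * b) c := by
  induction m generalizing a b with
  | zero => exact betaIntegral_of_pole hp0 hp hq0 hq ha hc hbal ha1 hc1 (by simpa using hcb) hqc hcc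
  | succ m ih =>
    have hb : b ≠ 0 := by
      rintro rfl
      rw [mul_zero] at hcb
      exact pow_ne_zero _ hq0 hcb.symm
    have hb1 : ‖b‖ < 1 := by
      have h := congrArg norm hcb
      rw [norm_mul, norm_pow] at h
      have h2 : ‖q‖ ^ (m + 1) ≤ ‖q‖ := pow_le_of_le_one (norm_nonneg _) hq.le (by simp)
      have h3 : 0 < ‖c 3‖ := norm_pos_iff.mpr (hc 3)
      have h4 := hc1 3
      by_contra! hcon
      nlinarith
    -- The hypothesis at (qa, b/q) evaluates the integral at (qa, b); the contiguous relation
    -- carries it to (a, qb).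
    have h1 := ih (a := q * a) (b := b / q) (mul_ne_zero hq0 ha) (norm_q_mul_lt_one hq ha1)
      (by rw [← hbal]; field_simp) (by rw [mul_div_assoc', hcb, pow_succ, mul_div_cancel_right₀ _ hq0])
    rw [mul_div_cancel₀ b hq0] at h1
    have h2 := betaIntegral_contiguous hp0 hp hq0 hq ha hb hc hbal ha1 hb1 hc1
    have h3 := betaValue_contiguous hp hq0 hq ha1 hb1 hc1
    have hθ : ∏ k, modTheta p (c k * a) ≠ 0 := Finset.prod_ne_zero_iff.mpr fun k _ =>
      modTheta_ne_zero_of_norm hp (by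
        rw [norm_mul]; exact mul_lt_one_of_nonneg_of_lt_one_left (norm_nonneg _) (hc1 k) ha1.le)
        (norm_lt_norm_mul_of_prod ha hc hbal hb1 hc1 k)
    refine mul_left_cancel₀ hθ ?_
    linear_combination -selbergConst p q * h2 + (∏ k, modTheta p (c k * b)) * h1 + 2 * h3

/-! ### Holomorphic dependence of the beta integral on its parameters -/

/-- A family of functions on the unit circle that is jointly continuous and depends
holomorphically on the parameter. -/
def IsHolomorphicFamily (U : Set ℂ) (f : ℂ → ℂ → ℂ) : Prop :=
  ContinuousOn (Function.uncurry f) (U ×ˢ Metric.sphere 0 1) ∧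
    ∀ z ∈ Metric.sphere (0 : ℂ) 1, DifferentiableOn ℂ (fun s => f s z) U

namespace IsHolomorphicFamily

variable {U : Set ℂ} {f g : ℂ → ℂ → ℂ}

lemma mul (hf : IsHolomorphicFamily U f) (hg : IsHolomorphicFamily U g) :
    IsHolomorphicFamily U fun s z => f s z * g s z :=
  ⟨hf.1.mul hg.1, fun z hz => (hf.2 z hz).mul (hg.2 z hz)⟩

lemma div (hf : IsHolomorphicFamily U f) (hg : IsHolomorphicFamily U g)
    (h0 : ∀ s ∈ U, ∀ z ∈ Metric.sphere (0 : ℂ) 1, g s z ≠ 0) :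
    IsHolomorphicFamily U fun s z => f s z / g s z :=
  ⟨hf.1.div hg.1 fun x hx => h0 x.1 hx.1 x.2 hx.2,
    fun z hz => (hf.2 z hz).div (hg.2 z hz) fun s hs => h0 s hs z hz⟩

lemma finsetProd {ι : Type*} {f : ι → ℂ → ℂ → ℂ} (F : Finset ι)
    (hf : ∀ i, IsHolomorphicFamily U (f i)) :
    IsHolomorphicFamily U fun s z => ∏ i ∈ F, f i s z :=
  ⟨continuousOn_finsetProd F fun i _ => (hf i).1,
    fun z hz => DifferentiableOn.fun_finsetProd fun i _ => (hf i).2 z hz⟩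

lemma of_param {x : ℂ → ℂ} (hx : DifferentiableOn ℂ x U) : IsHolomorphicFamily U fun s _ => x s :=
  ⟨hx.continuousOn.comp continuousOn_fst fun _ hy => hy.1, fun _ _ => hx⟩

lemma of_circle {x : ℂ → ℂ} (hx : ContinuousOn x (Metric.sphere 0 1)) :
    IsHolomorphicFamily U fun _ z => x z :=
  ⟨hx.comp continuousOn_snd fun _ hy => hy.2, fun _ _ => differentiableOn_const _⟩

lemma doublePochhammer {q : ℂ} (hq : ‖q‖ < 1) (hU : IsOpen U) {P : ℂ → ℂ}
    (hP : DifferentiableOn ℂ P U) (hP1 : ∀ s ∈ U, ‖P s‖ < 1) (hf : IsHolomorphicFamily U f) :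
    IsHolomorphicFamily U fun s z => doublePochhammer (P s) q (f s z) := by
  refine ⟨?_, fun z hz => DifferentiableOn.doublePochhammer hq hU hP (hf.2 z hz) hP1⟩
  have h : ContinuousOn (fun y : ℂ × ℂ => _root_.doublePochhammer y.1 q y.2)
      (Metric.ball 0 1 ×ˢ univ) :=
    ContinuousOn.doublePochhammer hq (Metric.isOpen_ball.prod isOpen_univ) continuousOn_fst
      continuousOn_snd fun y hy => by simpa using hy.1
  have h1 : ContinuousOn (fun y : ℂ × ℂ => (P y.1, f y.1 y.2)) (U ×ˢ Metric.sphere 0 1) :=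
    (hP.continuousOn.comp continuousOn_fst fun _ hy => hy.1).prodMk hf.1
  exact ContinuousOn.comp (f := fun y : ℂ × ℂ => (P y.1, f y.1 y.2)) h h1
    fun y hy => ⟨by simpa using hP1 _ hy.1, mem_univ _⟩

/-- Circle averages of a holomorphic family are holomorphic in the parameter. -/
theorem differentiableOn_circleAverage (hU : IsOpen U) (hf : IsHolomorphicFamily U f) :
    DifferentiableOn ℂ (fun s => Real.circleAverage (f s) 0 1) U := by
  intro s₀ hs₀
  obtain ⟨r, hr, hrU⟩ := Metric.nhds_basis_closedBall.mem_iff.mp (hU.mem_nhds hs₀)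
  have hr2 : 0 < r / 2 := half_pos hr
  have hsph : ∀ θ, circleMap 0 1 θ ∈ Metric.sphere (0 : ℂ) 1 := fun θ =>
    circleMap_mem_sphere 0 zero_le_one θ
  obtain ⟨M, hM⟩ := ((isCompact_closedBall s₀ r).prod (isCompact_sphere (0 : ℂ) 1)).exists_bound_of_continuousOn
    (hf.1.mono (prod_mono hrU le_rfl))
  have hcont : ∀ s ∈ U, Continuous fun θ => f s (circleMap 0 1 θ) := fun s hs =>
    hf.1.comp_continuous (f := fun θ => (s, circleMap 0 1 θ)) (by fun_prop) fun θ => ⟨hs, hsph θ⟩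
  have hdiff : ∀ θ, ∀ s ∈ Metric.ball s₀ r,
      HasDerivAt (fun s => f s (circleMap 0 1 θ)) (deriv (fun s => f s (circleMap 0 1 θ)) s) s :=
    fun θ s hs => ((hf.2 _ (hsph θ)).differentiableAt
      (hU.mem_nhds (hrU (Metric.ball_subset_closedBall hs)))).hasDerivAt
  -- Cauchy's estimate on discs of radius r/2, all contained in the closed disc of radius r on which
  -- M bounds the family.
  have hbound : ∀ θ, ∀ s ∈ Metric.ball s₀ (r / 2),
      ‖deriv (fun s => f s (circleMap 0 1 θ)) s‖ ≤ M / (r / 2) := fun θ s hs => by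
    have hsub : Metric.closedBall s (r / 2) ⊆ Metric.closedBall s₀ r := fun w hw => by
      simp only [Metric.mem_closedBall, Metric.mem_ball] at *
      linarith [dist_triangle w s s₀]
    refine Complex.norm_deriv_le_of_forall_mem_sphere_norm_le hr2 ?_ fun w hw =>
      hM (w, circleMap 0 1 θ) ⟨hsub (Metric.sphere_subset_closedBall hw), hsph θ⟩
    refine DifferentiableOn.diffContOnCl ((hf.2 _ (hsph θ)).mono ?_)
    rw [closure_ball s hr2.ne']
    exact hsub.trans hrU
  have hmem : ∀ n : ℕ, s₀ + ((r / (n + 1) : ℝ) : ℂ) ∈ U := fun n => hrU (by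
    simp only [Metric.mem_closedBall, dist_self_add_left, Complex.norm_real]
    rw [Real.norm_of_nonneg (by positivity)]
    exact div_le_self hr.le (by linarith [n.cast_nonneg (α := ℝ)]))
  -- The derivative is measurable in the angle as a pointwise limit of continuous difference
  -- quotients.
  have hmeas : AEStronglyMeasurable (fun θ => deriv (fun s => f s (circleMap 0 1 θ)) s₀)
      (volume.restrict (Ioc 0 (2 * Real.pi))) := by
    refine aestronglyMeasurable_of_tendsto_ae atTop (f := fun (n : ℕ) θ =>
      ((r / (n + 1) : ℝ) : ℂ)⁻¹ • (f (s₀ + ((r / (n + 1) : ℝ) : ℂ)) (circleMap 0 1 θ)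
        - f s₀ (circleMap 0 1 θ))) (fun n => ?_) (Eventually.of_forall fun θ => ?_)
    · exact (((hcont _ (hmem n)).sub (hcont _ hs₀)).const_smul
        ((r / (n + 1) : ℝ) : ℂ)⁻¹).aestronglyMeasurable
    · refine (hasDerivAt_iff_tendsto_slope_zero.mp
        (hdiff θ s₀ (Metric.mem_ball_self hr))).comp (f := fun n : ℕ => ((r / (n + 1) : ℝ) : ℂ)) ?_
      refine tendsto_nhdsWithin_iff.mpr ⟨?_, Eventually.of_forall fun n => ?_⟩
      · have h1 : Tendsto (fun n : ℕ => r / ((n : ℝ) + 1)) atTop (𝓝 0) :=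
          tendsto_const_nhds.div_atTop (tendsto_atTop_add_const_right _ _ tendsto_natCast_atTop_atTop)
        exact ((Complex.continuous_ofReal.tendsto' 0 0 Complex.ofReal_zero).comp h1)
      · simp only [mem_compl_iff, mem_singleton_iff, Complex.ofReal_eq_zero]
        positivity
  have key := (hasDerivAt_integral_of_dominated_loc_of_deriv_le
    (μ := volume.restrict (Ioc 0 (2 * Real.pi)))
    (F := fun s θ => f s (circleMap 0 1 θ)) (x₀ := s₀) (Metric.ball_mem_nhds s₀ hr2)
    (bound := fun _ => M / (r / 2)) (by
      filter_upwards [hU.mem_nhds hs₀] with s hs using (hcont s hs).aestronglyMeasurable)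
    ((hcont s₀ hs₀).integrableOn_Ioc) hmeas
    (Eventually.of_forall fun θ s hs => hbound θ s hs)
    (integrable_const _) (Eventually.of_forall fun θ s hs =>
      hdiff θ s (Metric.ball_subset_ball (half_le_self hr.le) hs))).2
  have hfun : (fun s => Real.circleAverage (f s) 0 1)
      = fun s => ((2 * Real.pi)⁻¹ : ℝ) • ∫ θ in Ioc 0 (2 * Real.pi), f s (circleMap 0 1 θ) := by
    ext s
    rw [Real.circleAverage_def, intervalIntegral.integral_of_le (by positivity)]
  rw [hfun]
  exact (key.differentiableAt.const_smul ((2 * Real.pi)⁻¹ : ℝ)).differentiableWithinAt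

end IsHolomorphicFamily

/-- `Γ(x z^±)` written through double Pochhammer symbols, where `u = p q / x`. -/
def gammaPMRegular (p q x u z : ℂ) : ℂ :=
  doublePochhammer p q (u * z⁻¹) * doublePochhammer p q (u * z) /
    (doublePochhammer p q (x * z) * doublePochhammer p q (x * z⁻¹))

/-- With u carried as a separate function, the right-hand side stays holomorphic when x and `p` tend
to 0 together while u has a limit. -/
lemma ellipticGammaPM_eq_regular {p q x u : ℂ} (hx : x ≠ 0) (hxu : x * u = p * q) (z : ℂ) :
    ellipticGammaPM p q x z = gammaPMRegular p q x u z := by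
  rw [ellipticGammaPM, ellipticGamma_eq, ellipticGamma_eq, ← hxu, gammaPMRegular,
    div_mul_div_comm, mul_div_mul_left _ _ hx, div_eq_mul_inv u z, div_eq_mul_inv x z]
  congr 3
  rw [mul_div_assoc, div_mul_eq_div_div, div_inv_eq_mul, ← mul_assoc, mul_div_cancel₀ u hx]

/-- `1 / Γ(z^{±2})` written through double Pochhammer symbols. -/
def invGammaPMRegular (p q z : ℂ) : ℂ :=
  doublePochhammer p q (z ^ 2) * doublePochhammer p q (z ^ 2)⁻¹ /
    (doublePochhammer p q (p * (q * z ^ 2)) * doublePochhammer p q (p * (q * (z ^ 2)⁻¹)))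

lemma inv_ellipticGammaPM_one_eq_regular (p q z : ℂ) :
    (ellipticGammaPM p q 1 (z ^ 2))⁻¹ = invGammaPMRegular p q z := by
  rw [ellipticGammaPM, one_mul, one_div, ellipticGamma_eq, ellipticGamma_eq, div_inv_eq_mul,
    div_mul_div_comm, inv_div, invGammaPMRegular, ← mul_assoc, ← mul_assoc, ← div_eq_mul_inv
    (p * q), mul_comm (doublePochhammer p q (p * q / z ^ 2))]

section Family

variable {U : Set ℂ} {q : ℂ} {P : ℂ → ℂ}

lemma norm_mul_sphere_lt_one {x z : ℂ} (hx : ‖x‖ < 1) (hz : z ∈ Metric.sphere (0 : ℂ) 1) :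
    ‖x * z‖ < 1 ∧ ‖x * z⁻¹‖ < 1 := by
  have hz1 : ‖z‖ = 1 := by simpa using hz
  rw [norm_mul, norm_mul, norm_inv, hz1]
  simpa using hx

lemma isHolomorphicFamily_gammaPMRegular (hq : ‖q‖ < 1) (hU : IsOpen U)
    (hP : DifferentiableOn ℂ P U) (hP1 : ∀ s ∈ U, ‖P s‖ < 1) {x u : ℂ → ℂ}
    (hx : DifferentiableOn ℂ x U) (hu : DifferentiableOn ℂ u U) (hx1 : ∀ s ∈ U, ‖x s‖ < 1) :
    IsHolomorphicFamily U fun s z => gammaPMRegular (P s) q (x s) (u s) z := by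
  have hz : IsHolomorphicFamily U fun _ z => z := .of_circle continuousOn_id
  have hi : IsHolomorphicFamily U fun _ z => z⁻¹ := .of_circle (continuousOn_inv₀.mono
    fun z hz => by rintro rfl; simp at hz)
  refine IsHolomorphicFamily.div
    (((IsHolomorphicFamily.of_param hu).mul hi |>.doublePochhammer hq hU hP hP1).mul
      ((IsHolomorphicFamily.of_param hu).mul hz |>.doublePochhammer hq hU hP hP1))
    (((IsHolomorphicFamily.of_param hx).mul hz |>.doublePochhammer hq hU hP hP1).mul
      ((IsHolomorphicFamily.of_param hx).mul hi |>.doublePochhammer hq hU hP hP1))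
    fun s hs z hz => ?_
  have h := norm_mul_sphere_lt_one (hx1 s hs) hz
  exact mul_ne_zero (doublePochhammer_ne_zero_of_norm_lt (hP1 s hs) hq h.1)
    (doublePochhammer_ne_zero_of_norm_lt (hP1 s hs) hq h.2)

lemma isHolomorphicFamily_invGammaPMRegular (hq : ‖q‖ < 1) (hU : IsOpen U)
    (hP : DifferentiableOn ℂ P U) (hP1 : ∀ s ∈ U, ‖P s‖ < 1) :
    IsHolomorphicFamily U fun s z => invGammaPMRegular (P s) q z := by
  have h0 : ∀ z ∈ Metric.sphere (0 : ℂ) 1, z ^ 2 ≠ 0 := fun z hz => by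
    refine pow_ne_zero 2 ?_
    rintro rfl; simp at hz
  have hz : IsHolomorphicFamily U fun _ z => z ^ 2 := .of_circle (continuousOn_pow 2)
  have hi : IsHolomorphicFamily U fun _ z => (z ^ 2)⁻¹ :=
    .of_circle ((continuousOn_pow 2).inv₀ h0)
  have hqc : IsHolomorphicFamily U fun _ _ => q := .of_param (differentiableOn_const q)
  have hPf := IsHolomorphicFamily.of_param hP
  refine IsHolomorphicFamily.div
    ((hz.doublePochhammer hq hU hP hP1).mul (hi.doublePochhammer hq hU hP hP1))
    (((hPf.mul (hqc.mul hz)).doublePochhammer hq hU hP hP1).mul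
      ((hPf.mul (hqc.mul hi)).doublePochhammer hq hU hP hP1)) fun s hs z hz => ?_
  have hz1 : ‖z‖ = 1 := by simpa using hz
  have hz2 : z ^ 2 ∈ Metric.sphere (0 : ℂ) 1 := by simp [hz1]
  have h1 : ‖P s * q‖ < 1 := by
    rw [norm_mul]
    exact mul_lt_one_of_nonneg_of_lt_one_left (norm_nonneg _) (hP1 s hs) hq.le
  have h := norm_mul_sphere_lt_one h1 hz2
  rw [mul_assoc, mul_assoc] at h
  exact mul_ne_zero (doublePochhammer_ne_zero_of_norm_lt (hP1 s hs) hq h.1)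
    (doublePochhammer_ne_zero_of_norm_lt (hP1 s hs) hq h.2)

/-- With y u = pq this quotient is Γ(xy), since pq/(xy) = u/x. Only x occurs in a denominator, so y
may vanish. -/
lemma differentiableOn_gammaQuot (hq : ‖q‖ < 1) (hU : IsOpen U)
    (hP : DifferentiableOn ℂ P U) (hP1 : ∀ s ∈ U, ‖P s‖ < 1) {x y u : ℂ → ℂ}
    (hx : DifferentiableOn ℂ x U) (hy : DifferentiableOn ℂ y U) (hu : DifferentiableOn ℂ u U)
    (hx1 : ∀ s ∈ U, ‖x s‖ < 1) (hy1 : ∀ s ∈ U, ‖y s‖ < 1) (hx0 : ∀ s ∈ U, x s ≠ 0) :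
    DifferentiableOn ℂ (fun s => doublePochhammer (P s) q (u s / x s) /
      doublePochhammer (P s) q (x s * y s)) U := by
  refine DifferentiableOn.div (DifferentiableOn.doublePochhammer hq hU hP (hu.div hx hx0) hP1)
    (DifferentiableOn.doublePochhammer hq hU hP (hx.mul hy) hP1) fun s hs =>
      doublePochhammer_ne_zero_of_norm_lt (hP1 s hs) hq ?_
  rw [norm_mul]
  exact mul_lt_one_of_nonneg_of_lt_one_left (norm_nonneg _) (hx1 s hs) (hy1 s hs).le

lemma ellipticGamma_mul_eq_quot {p q x y u : ℂ} (hx : x ≠ 0) (hy : y ≠ 0) (hyu : y * u = p * q) :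
    ellipticGamma p q (x * y) = doublePochhammer p q (u / x) / doublePochhammer p q (x * y) := by
  rw [ellipticGamma_eq, ← hyu]
  congr 2
  field_simp

/-- Along a holomorphic family of parameters, the defect in the elliptic beta integral evaluation
extends holomorphically across `p = 0`. -/
lemma exists_differentiableOn_beta_defect (hq0 : q ≠ 0) (hq : ‖q‖ < 1) (hU : IsOpen U)
    (hP : DifferentiableOn ℂ P U) (hP1 : ∀ s ∈ U, ‖P s‖ < 1) {α β uα uβ : ℂ → ℂ}
    {γ uγ : Fin 4 → ℂ → ℂ} (hα : DifferentiableOn ℂ α U) (hβ : DifferentiableOn ℂ β U)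
    (hγ : ∀ k, DifferentiableOn ℂ (γ k) U) (huα : DifferentiableOn ℂ uα U)
    (huβ : DifferentiableOn ℂ uβ U) (huγ : ∀ k, DifferentiableOn ℂ (uγ k) U)
    (hα1 : ∀ s ∈ U, ‖α s‖ < 1) (hβ1 : ∀ s ∈ U, ‖β s‖ < 1) (hγ1 : ∀ k, ∀ s ∈ U, ‖γ k s‖ < 1)
    (hα0 : ∀ s ∈ U, α s ≠ 0) (hγ0 : ∀ k, ∀ s ∈ U, γ k s ≠ 0)
    (hαu : ∀ s ∈ U, α s * uα s = P s * q) (hβu : ∀ s ∈ U, β s * uβ s = P s * q)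
    (hγu : ∀ k, ∀ s ∈ U, γ k s * uγ k s = P s * q) :
    ∃ F : ℂ → ℂ, DifferentiableOn ℂ F U ∧ ∀ s ∈ U, P s ≠ 0 → F s =
      selbergConst (P s) q * betaIntegral (P s) q (α s) (β s) (fun k => γ k s)
        - 2 * betaValue (P s) q (α s) (β s) (fun k => γ k s) := by
  have hfam : IsHolomorphicFamily U fun s z =>
      gammaPMRegular (P s) q (α s) (uα s) z * gammaPMRegular (P s) q (β s) (uβ s) z *
      (∏ k, gammaPMRegular (P s) q (γ k s) (uγ k s) z) * invGammaPMRegular (P s) q z :=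
    (((isHolomorphicFamily_gammaPMRegular hq hU hP hP1 hα huα hα1).mul
      (isHolomorphicFamily_gammaPMRegular hq hU hP hP1 hβ huβ hβ1)).mul
      (IsHolomorphicFamily.finsetProd _ fun k =>
        isHolomorphicFamily_gammaPMRegular hq hU hP hP1 (hγ k) (huγ k) (hγ1 k))).mul
      (isHolomorphicFamily_invGammaPMRegular hq hU hP hP1)
  -- Here (P; P)_∞ is a quotient of double Pochhammer symbols, for which joint holomorphy in base
  -- and argument is available.
  have hC : DifferentiableOn ℂ (fun s => doublePochhammer (P s) q (P s) /
      doublePochhammer (P s) q (q * P s) * pochhammerInf q q) U := by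
    refine (DifferentiableOn.div (DifferentiableOn.doublePochhammer hq hU hP hP hP1)
      (DifferentiableOn.doublePochhammer hq hU hP (hP.const_mul q) hP1) fun s hs =>
        doublePochhammer_ne_zero_of_norm_lt (hP1 s hs) hq ?_).mul_const _
    rw [norm_mul]
    exact mul_lt_one_of_nonneg_of_lt_one_left (norm_nonneg _) hq (hP1 s hs).le
  refine ⟨_, (hC.mul (hfam.differentiableOn_circleAverage hU)).sub ((((
    (differentiableOn_gammaQuot hq hU hP hP1 hα hβ huβ hα1 hβ1 hα0).mul
    (DifferentiableOn.fun_finsetProd (u := Finset.univ) fun k _ =>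
      differentiableOn_gammaQuot hq hU hP hP1 hα (hγ k) (huγ k) hα1 (hγ1 k) hα0)).mul
    (DifferentiableOn.fun_finsetProd (u := Finset.univ) fun k _ =>
      differentiableOn_gammaQuot hq hU hP hP1 (hγ k) hβ huβ (hγ1 k) hβ1 (hγ0 k))).mul
    (DifferentiableOn.fun_finsetProd (u := Finset.univ) fun j _ =>
      DifferentiableOn.fun_finsetProd (u := Finset.Ioi j) fun k _ =>
      differentiableOn_gammaQuot hq hU hP hP1 (hγ j) (hγ k) (huγ k) (hγ1 j) (hγ1 k)
        (hγ0 j))).const_mul 2), fun s hs hs0 => ?_⟩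
  have hβ0 : β s ≠ 0 := fun h => by
    have := hβu s hs
    rw [h, zero_mul] at this
    exact mul_ne_zero hs0 hq0 this.symm
  have h1 : selbergConst (P s) q = doublePochhammer (P s) q (P s) /
      doublePochhammer (P s) q (q * P s) * pochhammerInf q q := by
    rw [selbergConst_eq (hP1 s hs) hq, doublePochhammer_eq (hP1 s hs) hq (P s),
      mul_div_cancel_right₀]
    refine doublePochhammer_ne_zero_of_norm_lt (hP1 s hs) hq ?_
    rw [norm_mul]
    exact mul_lt_one_of_nonneg_of_lt_one_left (norm_nonneg _) hq (hP1 s hs).le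
  have h2 : ∀ z, betaWeight (P s) q (α s) (β s) (fun k => γ k s) z =
      gammaPMRegular (P s) q (α s) (uα s) z * gammaPMRegular (P s) q (β s) (uβ s) z *
      (∏ k, gammaPMRegular (P s) q (γ k s) (uγ k s) z) * invGammaPMRegular (P s) q z := fun z => by
    rw [betaWeight, div_eq_mul_inv, inv_ellipticGammaPM_one_eq_regular,
      ellipticGammaPM_eq_regular (hα0 s hs) (hαu s hs), ellipticGammaPM_eq_regular hβ0 (hβu s hs)]
    simp only [ellipticGammaPM_eq_regular (hγ0 _ s hs) (hγu _ s hs)]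
  simp only [Pi.sub_apply, Pi.mul_apply]
  rw [h1, betaIntegral, funext h2, betaValue,
    ellipticGamma_mul_eq_quot (hα0 s hs) hβ0 (hβu s hs)]
  simp only [ellipticGamma_mul_eq_quot (hα0 s hs) (hγ0 _ s hs) (hγu _ s hs),
    mul_comm (β s), ellipticGamma_mul_eq_quot (hγ0 _ s hs) hβ0 (hβu s hs),
    ellipticGamma_mul_eq_quot (hγ0 _ s hs) (hγ0 _ s hs) (hγu _ s hs)]

end Family

/-! ### Analytic continuation to the full elliptic beta integral -/

/-- The elliptic beta integral for one large parameter, by analytic continuation in `p`. -/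
theorem betaIntegral_of_large_parameter {p q a b : ℂ} {c : Fin 4 → ℂ} (hp0 : p ≠ 0) (hp : ‖p‖ < 1)
    (hq0 : q ≠ 0) (hq : ‖q‖ < 1) (ha : a ≠ 0) (ha1 : ‖a‖ < 1) (hb1 : ‖b‖ < 1)
    (hc : ∀ k, c k ≠ 0) (hc1 : ∀ k, ‖c k‖ < 1) (hqc : ‖q‖ < ‖c 3‖ ^ 2)
    (hcc : ‖c 0 * c 1 * c 2‖ < ‖c 3‖) (hbal : a * b * ∏ k, c k = p * q) :
    selbergConst p q * betaIntegral p q a b c = 2 * betaValue p q a b c := by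
  set A := a * ∏ k, c k with hA
  have hA0 : A ≠ 0 := mul_ne_zero ha (Finset.prod_ne_zero_iff.mpr fun k _ => hc k)
  -- With a and c fixed, balancing makes b = s q / A a function of the base s. The radius encodes
  -- |s| < 1 and |b| < 1.
  let U : Set ℂ := Metric.ball 0 (min 1 (‖A / q‖))
  have hr : 0 < min 1 ‖A / q‖ := lt_min one_pos (norm_pos_iff.mpr (div_ne_zero hA0 hq0))
  have hU1 : ∀ s ∈ U, ‖s‖ < 1 := fun s hs => by
    rw [mem_ball_zero_iff] at hs
    exact hs.trans_le (min_le_left _ _)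
  have hU2 : ∀ s : ℂ, ‖s‖ < ‖A / q‖ → ‖s * q / A‖ < 1 := fun s hs => by
    rw [norm_div, lt_div_iff₀ (norm_pos_iff.mpr hq0)] at hs
    rwa [norm_div, norm_mul, div_lt_one (norm_pos_iff.mpr hA0)]
  obtain ⟨F, hF, hFeq⟩ := exists_differentiableOn_beta_defect (U := U) (P := fun s => s)
    (α := fun _ => a) (β := fun s => s * q / A) (uα := fun s => s * q / a) (uβ := fun _ => A)
    (γ := fun k _ => c k) (uγ := fun k s => s * q / c k) hq0 hq Metric.isOpen_ball (by fun_prop)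
    hU1 (by fun_prop) (by fun_prop) (fun k => by fun_prop) (by fun_prop) (by fun_prop)
    (fun k => by fun_prop) (fun _ _ => ha1) (fun s hs => hU2 s (by
      rw [mem_ball_zero_iff] at hs
      exact hs.trans_le (min_le_right _ _))) (fun k _ _ => hc1 k) (fun _ _ => ha)
    (fun k _ _ => hc k) (fun s _ => mul_div_cancel₀ _ ha) (fun s _ => div_mul_cancel₀ _ hA0)
    (fun k s _ => mul_div_cancel₀ _ (hc k))
  have hb : b = p * q / A := by
    rw [← hbal, hA]
    have : ∏ k, c k ≠ 0 := Finset.prod_ne_zero_iff.mpr fun k _ => hc k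
    field_simp
  have hpU : p ∈ U := by
    rw [mem_ball_zero_iff, lt_min_iff]
    refine ⟨hp, ?_⟩
    rw [hb, norm_div, div_lt_one (norm_pos_iff.mpr hA0), norm_mul] at hb1
    rwa [norm_div, lt_div_iff₀ (norm_pos_iff.mpr hq0)]
  -- At the base x m one has b = q · q^m / c 3, the case already evaluated. These bases tend to 0,
  -- an interior point of U where F is holomorphic.
  let x : ℕ → ℂ := fun m => q ^ m * (a * (c 0 * c 1 * c 2))
  have hx0 : ∀ m, x m ≠ 0 := fun m => mul_ne_zero (pow_ne_zero m hq0)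
    (mul_ne_zero ha (mul_ne_zero (mul_ne_zero (hc 0) (hc 1)) (hc 2)))
  have hxlim : Tendsto x atTop (𝓝[≠] 0) := by
    refine tendsto_nhdsWithin_iff.mpr ⟨?_, Eventually.of_forall hx0⟩
    simpa using (tendsto_pow_atTop_nhds_zero_of_norm_lt_one hq).mul_const (a * (c 0 * c 1 * c 2))
  have hAe : A = a * (c 0 * c 1 * c 2) * c 3 := by rw [hA, Fin.prod_univ_four]; ring
  have hzero : ∀ᶠ m in atTop, F (x m) = 0 := by
    have hxU : ∀ᶠ m in atTop, x m ∈ U :=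
      (tendsto_nhdsWithin_iff.mp hxlim).1 (Metric.isOpen_ball.mem_nhds (by simpa using hr))
    filter_upwards [hxU] with m hm
    rw [hFeq _ hm (hx0 m), sub_eq_zero]
    have hbe : x m * q / A = q * (q ^ m / c 3) := by
      rw [hAe]
      have h0 := hc 0
      have h1 := hc 1
      have h2 := hc 2
      have h3 := hc 3
      simp only [x]
      field_simp
    simp only [hbe]
    refine betaIntegral_of_q_pow (hx0 m) (hU1 _ hm) hq0 hq hc hc1 hqc hcc m ha ha1 ?_
      (mul_div_cancel₀ _ (hc 3))
    have h3 := hc 3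
    rw [Fin.prod_univ_four]
    simp only [x]
    field_simp
  have hFan : AnalyticOnNhd ℂ F U := hF.analyticOnNhd Metric.isOpen_ball
  have hFz := hFan.eqOn_zero_of_preconnected_of_frequently_eq_zero
    (convex_ball _ _).isPreconnected (Metric.mem_ball_self hr) (hxlim.frequently hzero.frequently)
  have := hFeq p hpU hp0
  rw [hFz hpU, Pi.zero_apply, ← hb] at this
  exact sub_eq_zero.mp this.symm

/-- **The elliptic beta integral.** -/
theorem betaIntegral_eq {p q a b : ℂ} {c : Fin 4 → ℂ} (hp0 : p ≠ 0) (hp : ‖p‖ < 1)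
    (hq0 : q ≠ 0) (hq : ‖q‖ < 1) (ha1 : ‖a‖ < 1) (hb1 : ‖b‖ < 1) (hc1 : ∀ k, ‖c k‖ < 1)
    (hbal : a * b * ∏ k, c k = p * q) :
    selbergConst p q * betaIntegral p q a b c = 2 * betaValue p q a b c := by
  have hne : a * b * ∏ k, c k ≠ 0 := by rw [hbal]; exact mul_ne_zero hp0 hq0
  have hc : ∀ k, c k ≠ 0 := fun k => Finset.prod_ne_zero_iff.mp (mul_ne_zero_iff.mp hne).2 k
    (Finset.mem_univ k)
  have ha : a ≠ 0 := (mul_ne_zero_iff.mp (mul_ne_zero_iff.mp hne).1).1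
  have hb : b ≠ 0 := (mul_ne_zero_iff.mp (mul_ne_zero_iff.mp hne).1).2
  let d : Fin 4 → ℂ → ℂ := fun k w => if k = 3 then c 3 * Complex.exp w else c k
  have hd0 : ∀ k w, d k w ≠ 0 := fun k w => by
    simp only [d]
    split_ifs
    · exact mul_ne_zero (hc 3) (Complex.exp_ne_zero w)
    · exact hc k
  have hd : ∀ k, Differentiable ℂ (d k) := fun k => by
    simp only [d]
    split_ifs <;> fun_prop
  -- The strip on which b e^{-w} and c 3 · e^w both have norm below 1; it contains 0.
  let U : Set ℂ := {w | Real.log ‖b‖ < w.re} ∩ {w | w.re < -Real.log ‖c 3‖}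
  have hUo : IsOpen U := (isOpen_lt continuous_const Complex.continuous_re).inter
    (isOpen_lt Complex.continuous_re continuous_const)
  have hUc : IsPreconnected U :=
    ((convex_halfSpace_re_gt _).inter (convex_halfSpace_re_lt _)).isPreconnected
  have hbp : 0 < ‖b‖ := norm_pos_iff.mpr hb
  have hcp : 0 < ‖c 3‖ := norm_pos_iff.mpr (hc 3)
  have hb' : ∀ w ∈ U, ‖b * Complex.exp (-w)‖ < 1 := fun w hw => by
    have h1 : Real.log ‖b‖ < w.re := hw.1
    rw [norm_mul, Complex.norm_exp, Complex.neg_re, ← Real.exp_log hbp, ← Real.exp_add,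
      Real.exp_lt_one_iff]
    linarith
  have hc' : ∀ w ∈ U, ‖c 3 * Complex.exp w‖ < 1 := fun w hw => by
    have h1 : w.re < -Real.log ‖c 3‖ := hw.2
    rw [norm_mul, Complex.norm_exp, ← Real.exp_log hcp, ← Real.exp_add, Real.exp_lt_one_iff]
    linarith
  have hd1 : ∀ k, ∀ w ∈ U, ‖d k w‖ < 1 := fun k w hw => by
    simp only [d]
    split_ifs
    · exact hc' w hw
    · exact hc1 k
  have hprod : ∀ w, a * (b * Complex.exp (-w)) * ∏ k, d k w = p * q := fun w => by
    rw [← hbal, Fin.prod_univ_four, Fin.prod_univ_four]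
    have : Complex.exp (-w) * Complex.exp w = 1 := by rw [← Complex.exp_add]; simp
    simp [d]
    linear_combination a * b * (c 0 * c 1 * c 2 * c 3) * this
  obtain ⟨F, hF, hFeq⟩ := exists_differentiableOn_beta_defect (U := U) (P := fun _ => p)
    (α := fun _ => a) (β := fun w => b * Complex.exp (-w)) (uα := fun _ => p * q / a)
    (uβ := fun w => p * q / (b * Complex.exp (-w))) (γ := d) (uγ := fun k w => p * q / d k w)
    hq0 hq hUo (by fun_prop) (fun _ _ => hp) (by fun_prop) (by fun_prop)
    (fun k => (hd k).differentiableOn) (by fun_prop)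
    (DifferentiableOn.div (by fun_prop) (by fun_prop) fun w _ =>
      mul_ne_zero hb (Complex.exp_ne_zero _))
    (fun k => DifferentiableOn.div (by fun_prop) (hd k).differentiableOn fun w _ => hd0 k w)
    (fun _ _ => ha1) hb' hd1 (fun _ _ => ha) (fun k w _ => hd0 k w)
    (fun w _ => mul_div_cancel₀ _ ha)
    (fun w _ => mul_div_cancel₀ _ (mul_ne_zero hb (Complex.exp_ne_zero _)))
    (fun k w _ => mul_div_cancel₀ _ (hd0 k w))
  have h0U : (0 : ℂ) ∈ U := ⟨by
    simpa using Real.log_neg hbp hb1, by simpa using Real.log_neg hcp (hc1 3)⟩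
  -- At the right edge |c 3 · e^w| tends to 1, while |q| < 1 and |c 0 · c 1 · c 2| < 1. Both
  -- inequalities of the large-parameter case therefore hold near that edge, and the identity
  -- theorem reaches w = 0.
  have hend : ∀ᶠ r : ℝ in 𝓝[<] (-Real.log ‖c 3‖), (r : ℂ) ∈ U ∧ ‖q‖ < ‖c 3 * Complex.exp r‖ ^ 2 ∧
      ‖c 0 * c 1 * c 2‖ < ‖c 3 * Complex.exp r‖ := by
    have hlim : Tendsto (fun r : ℝ => ‖c 3 * Complex.exp r‖) (𝓝[<] (-Real.log ‖c 3‖)) (𝓝 1) := by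
      refine Tendsto.mono_left ?_ nhdsWithin_le_nhds
      have hcont : Continuous fun r : ℝ => ‖c 3 * Complex.exp r‖ := by fun_prop
      refine hcont.tendsto' _ _ ?_
      rw [norm_mul, Complex.norm_exp, Complex.ofReal_re, Real.exp_neg, Real.exp_log hcp]
      exact mul_inv_cancel₀ hcp.ne'
    have h1 : Real.log ‖b‖ < -Real.log ‖c 3‖ := by
      linarith [Real.log_neg hbp hb1, Real.log_neg hcp (hc1 3)]
    have h2 : ‖c 0 * c 1 * c 2‖ < 1 := by
      rw [norm_mul, norm_mul]
      exact mul_lt_one_of_nonneg_of_lt_one_right (mul_le_one₀ (hc1 0).le (norm_nonneg _) (hc1 1).le)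
        (norm_nonneg _) (hc1 2)
    filter_upwards [self_mem_nhdsWithin, mem_nhdsWithin_of_mem_nhds (Ioi_mem_nhds h1),
      (hlim.pow 2).eventually (lt_mem_nhds (by simpa using hq)),
      hlim.eventually (lt_mem_nhds h2)] with r e1 e2 e3 e4
    exact ⟨⟨by simpa using e2, by simpa using e1⟩, e3, e4⟩
  obtain ⟨r, hrU, hr1, hr2⟩ := hend.exists
  have hnear : ∀ᶠ w in 𝓝 (r : ℂ), F w = 0 := by
    have hcont : Continuous fun w : ℂ => ‖c 3 * Complex.exp w‖ := by fun_prop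
    filter_upwards [hUo.mem_nhds hrU,
      ((hcont.pow 2).tendsto (r : ℂ)).eventually (lt_mem_nhds hr1),
      (hcont.tendsto (r : ℂ)).eventually (lt_mem_nhds hr2)] with w hw h1 h2
    rw [hFeq w hw hp0, sub_eq_zero]
    exact betaIntegral_of_large_parameter hp0 hp hq0 hq ha ha1 (hb' w hw) (fun k => hd0 k w)
      (fun k => hd1 k w hw) (by simpa [d] using h1) (by simpa [d] using h2) (hprod w)
  have hFz := (hF.analyticOnNhd hUo).eqOn_zero_of_preconnected_of_eventuallyEq_zero hUc hrU hnear
  have := hFeq 0 h0U hp0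
  rw [hFz h0U, Pi.zero_apply] at this
  have hd00 : (fun k => d k 0) = c := by
    ext k
    simp only [d, Complex.exp_zero, mul_one]
    split_ifs with h
    · rw [h]
    · rfl
  rw [hd00, neg_zero, Complex.exp_zero, mul_one] at this
  exact sub_eq_zero.mp this.symm

/-! ### Elliptic determinants of Vandermonde type -/

/-- A determinant of products of linear-like functions obeying a three-term relation. -/
theorem det_prod_of_three_term {F X Y : Type*} [Field F] {N : X → Y → F} {K : X → X → F}
    {V : Y → Y → F}
    (h : ∀ a b x y, N b x * N a y - N a x * N b y = K b a * V x y) (a b : ℕ → X) :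
    ∀ (m : ℕ) (v : Fin (m + 1) → Y), (∀ i j, N (b i) (v j) ≠ 0) →
    (Matrix.of fun j k : Fin (m + 1) => (∏ i ∈ Finset.range k, N (a i) (v j)) *
      ∏ i ∈ Finset.range (m - k), N (b i) (v j)).det =
    (∏ j, ∏ l ∈ Finset.Ioi j, V (v j) (v l)) *
      ∏ s ∈ Finset.range m, ∏ l ∈ Finset.range (s + 1), K (b (s - l)) (a l) := by
  intro m
  induction m with
  | zero =>
    intro v _
    simp
  | succ m ih =>
    intro v hv
    set A : Matrix (Fin (m + 2)) (Fin (m + 2)) F := Matrix.of fun j k =>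
      (∏ i ∈ Finset.range k, N (a i) (v j)) * ∏ i ∈ Finset.range (m + 1 - k), N (b i) (v j) with hA
    set R : Matrix (Fin (m + 1)) (Fin (m + 1)) F := Matrix.of fun j k =>
      (∏ i ∈ Finset.range k, N (a i) (v j.succ)) *
        ∏ i ∈ Finset.range (m - k), N (b i) (v j.succ) with hR
    -- Subtracting c k times the preceding column clears the first row after its first entry.
    let c : Fin (m + 1) → F := fun k => N (a k) (v 0) / N (b (m - k)) (v 0)
    let B : Matrix (Fin (m + 2)) (Fin (m + 2)) F := Matrix.of fun j k =>
      Fin.cases (A j 0) (fun k => A j k.succ - c k * A j k.castSucc) k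
    have hAB : A.det = B.det := by
      refine Matrix.det_eq_of_forall_col_eq_smul_add_pred c (fun i => by simp [B]) fun i j => ?_
      simp [B]
    -- The three-term relation splits each new entry into a column constant, the row factor V (v 0)
    -- (v j) and an entry of the same shape with m lowered by one.
    have hstep : ∀ j (k : Fin (m + 1)), A j k.succ - c k * A j k.castSucc =
        (N (b (m - k)) (v 0))⁻¹ * K (b (m - k)) (a k) * V (v 0) (v j) *
        ((∏ i ∈ Finset.range k, N (a i) (v j)) * ∏ i ∈ Finset.range (m - k), N (b i) (v j)) := by
      intro j k
      have hk : m + 1 - (k : ℕ) = m - k + 1 := by omega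
      have h3 := h (a k) (b (m - k)) (v 0) (v j)
      have h0 := hv (m - k) 0
      simp only [hA, Matrix.of_apply, Fin.val_succ, Fin.val_castSucc, c, hk,
        Finset.prod_range_succ, Nat.add_sub_add_right]
      field_simp
      rw [mul_assoc _ (K _ _), ← h3]
      ring
    have hV0 : ∀ k : Fin (m + 1), A 0 k.succ - c k * A 0 k.castSucc = 0 := by
      intro k
      have hk : m + 1 - (k : ℕ) = m - k + 1 := by omega
      have h0 := hv (m - k) 0
      simp only [hA, Matrix.of_apply, Fin.val_succ, Fin.val_castSucc, c, hk,
        Finset.prod_range_succ, Nat.add_sub_add_right]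
      field_simp
      ring
    have hB : B.det = A 0 0 * (B.submatrix Fin.succ Fin.succ).det := by
      rw [Matrix.det_succ_row_zero, Fin.sum_univ_succ]
      simp [B, hV0]
    have hsub : B.submatrix Fin.succ Fin.succ = Matrix.of fun j k =>
        V (v 0) (v j.succ) * (Matrix.of fun j k : Fin (m + 1) =>
          (N (b (m - k)) (v 0))⁻¹ * K (b (m - k)) (a k) * R j k) j k := by
      ext j k
      simp only [B, Matrix.submatrix_apply, Matrix.of_apply, Fin.cases_succ, hstep, hR]
      ring
    have hA0 : A 0 0 = ∏ k : Fin (m + 1), N (b (m - k)) (v 0) := by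
      simp only [hA, Matrix.of_apply, Fin.val_zero, Finset.range_zero, Finset.prod_empty, one_mul,
        Nat.sub_zero]
      rw [Fin.prod_univ_eq_prod_range (fun k => N (b (m - k)) (v 0)),
        ← Finset.prod_range_reflect]
      rfl
    rw [hAB, hB, hsub, Matrix.det_mul_column,
      Matrix.det_mul_row (fun k : Fin (m + 1) => (N (b (m - k)) (v 0))⁻¹ * K (b (m - k)) (a k)) R,
      hR, ih (fun j => v j.succ) (fun i j => hv i j.succ), hA0, Finset.prod_mul_distrib,
      Finset.prod_inv_distrib, Finset.prod_range_succ (n := m),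
      ← Fin.prod_univ_eq_prod_range (fun l => K (b (m - l)) (a l)) (m + 1),
      Fin.prod_univ_succ (fun j : Fin (m + 2) => ∏ l ∈ Finset.Ioi j, V (v j) (v l)),
      Fin.prod_Ioi_zero]
    simp only [Fin.prod_Ioi_succ]
    have hne : ∏ k : Fin (m + 1), N (b (m - k)) (v 0) ≠ 0 :=
      Finset.prod_ne_zero_iff.mpr fun k _ => hv _ _
    field_simp

/-- `θ(a x) θ(a w / x)`. -/
def thetaPair (p w a x : ℂ) : ℂ := modTheta p (a * x) * modTheta p (a * w / x)

/-- The factor of the three-term relation depending on the points. -/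
def thetaPoint (p w x y : ℂ) : ℂ := w / x * (modTheta p (x * y / w) * modTheta p (x / y))

/-- The factor of the three-term relation depending on the parameters. -/
def thetaCoeff (p w b a : ℂ) : ℂ := a * (modTheta p (a * b * w) * modTheta p (b / a))

lemma modThetaPM_eq_mul_thetaBracket {p a z : ℂ} (ha : a ≠ 0) :
    modThetaPM p a z = a * thetaBracket p a z := by
  rw [thetaBracket, mul_inv_cancel_left₀ ha]

/-- With r² = w, all three kinds of factors are multiples of theta brackets at a r, b r, x/r, y/r,
so this is Weierstrass' formula. -/
lemma thetaPair_three_term {p w : ℂ} (hp0 : p ≠ 0) (hp : ‖p‖ < 1) (hw : w ≠ 0) {a b x y : ℂ}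
    (ha : a ≠ 0) (hb : b ≠ 0) (hx : x ≠ 0) (hy : y ≠ 0) :
    thetaPair p w b x * thetaPair p w a y - thetaPair p w a x * thetaPair p w b y =
      thetaCoeff p w b a * thetaPoint p w x y := by
  obtain ⟨r, hr⟩ := IsAlgClosed.exists_pow_nat_eq w (n := 2) two_pos
  have hr0 : r ≠ 0 := by rintro rfl; simp at hr; exact hw hr.symm
  have h1 : ∀ a x, a ≠ 0 → x ≠ 0 →
      thetaPair p w a x = a * r * thetaBracket p (a * r) (x / r) := fun a x ha hx => by
    rw [← modThetaPM_eq_mul_thetaBracket (mul_ne_zero ha hr0), thetaPair, modThetaPM, ← hr]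
    congr 2 <;> field_simp
  have h2 : thetaCoeff p w b a = a * b * r * thetaBracket p (b * r) (a * r) := by
    rw [thetaCoeff, thetaBracket, modThetaPM, ← hr, show b * r * (a * r) = a * b * r ^ 2 by ring,
      mul_div_mul_right _ _ hr0]
    field_simp
  have h3 : thetaPoint p w x y = r * thetaBracket p (x / r) (y / r) := by
    rw [thetaPoint, thetaBracket, modThetaPM, ← hr, div_div_div_cancel_right₀ hr0,
      div_mul_div_comm, ← sq]
    field_simp
  have h4 := thetaBracket_plucker hp0 hp (mul_ne_zero hb hr0) (div_ne_zero hx hr0)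
    (mul_ne_zero ha hr0) (div_ne_zero hy hr0)
  rw [thetaBracket_comm (a := a * r) (b := x / r) hp0 hp (mul_ne_zero ha hr0)
    (div_ne_zero hx hr0)] at h4
  rw [h1 b x hb hx, h1 a y ha hy, h1 a x ha hx, h1 b y hb hy, h2, h3]
  linear_combination a * b * r ^ 2 * h4

lemma DifferentiableAt.thetaPair {p w x : ℂ} {f : ℂ → ℂ} {s : ℂ} (hf : DifferentiableAt ℂ f s)
    (hf0 : f s ≠ 0) (hp : ‖p‖ < 1) (hw : w ≠ 0) (hx : x ≠ 0) :
    DifferentiableAt ℂ (fun s => thetaPair p w (f s) x) s :=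
  (DifferentiableAt.modTheta (f := fun s => f s * x) (by fun_prop) (mul_ne_zero hf0 hx) hp).mul
    (DifferentiableAt.modTheta (f := fun s => f s * w / x) (by fun_prop)
      (div_ne_zero (mul_ne_zero hf0 hw) hx) hp)

lemma DifferentiableAt.thetaCoeff {p w a : ℂ} {f : ℂ → ℂ} {s : ℂ} (hf : DifferentiableAt ℂ f s)
    (hf0 : f s ≠ 0) (hp : ‖p‖ < 1) (hw : w ≠ 0) (ha : a ≠ 0) :
    DifferentiableAt ℂ (fun s => thetaCoeff p w (f s) a) s :=
  ((DifferentiableAt.modTheta (f := fun s => a * f s * w) (by fun_prop)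
    (mul_ne_zero (mul_ne_zero ha hf0) hw) hp).mul
    (DifferentiableAt.modTheta (f := fun s => f s / a) (by fun_prop)
      (div_ne_zero hf0 ha) hp)).const_mul a

/-- An elliptic determinant of Vandermonde type. -/
theorem det_thetaPair {p w : ℂ} (hp0 : p ≠ 0) (hp : ‖p‖ < 1) (hw : w ≠ 0) {a b : ℕ → ℂ}
    (ha : ∀ i, a i ≠ 0) (hb : ∀ i, b i ≠ 0) {m : ℕ} {x : Fin (m + 1) → ℂ} (hx : ∀ j, x j ≠ 0) :
    (Matrix.of fun j k : Fin (m + 1) => (∏ i ∈ Finset.range k, thetaPair p w (a i) (x j)) *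
      ∏ i ∈ Finset.range (m - k), thetaPair p w (b i) (x j)).det =
    (∏ j, ∏ l ∈ Finset.Ioi j, thetaPoint p w (x j) (x l)) *
      ∏ s ∈ Finset.range m, ∏ l ∈ Finset.range (s + 1), thetaCoeff p w (b (s - l)) (a l) := by
  -- Scaling every b i by s makes the required theta pairs non-zero off a countable set; continuity
  -- then gives s = 1.
  let f : ℂ → ℂ := fun s =>
    (Matrix.of fun j k : Fin (m + 1) => (∏ i ∈ Finset.range k, thetaPair p w (a i) (x j)) *
      ∏ i ∈ Finset.range (m - k), thetaPair p w (b i * s) (x j)).det -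
    (∏ j, ∏ l ∈ Finset.Ioi j, thetaPoint p w (x j) (x l)) *
      ∏ s' ∈ Finset.range m, ∏ l ∈ Finset.range (s' + 1), thetaCoeff p w (b (s' - l) * s) (a l)
  let S : Set ℂ := {0} ∪ ⋃ i, ⋃ j, ({s | ∃ k : ℤ, b i * x j * s ^ 1 = p ^ k} ∪
    {s | ∃ k : ℤ, b i * w / x j * s ^ 1 = p ^ k})
  have hS : S.Countable := (countable_singleton 0).union <| countable_iUnion fun i =>
    countable_iUnion fun j =>
      (countable_mul_pow_eq_zpow (mul_ne_zero (hb i) (hx j)) one_ne_zero).union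
        (countable_mul_pow_eq_zpow (div_ne_zero (mul_ne_zero (hb i) hw) (hx j)) one_ne_zero)
  have hf : ContinuousAt f 1 := by
    have hb1 : ∀ i, b i * 1 ≠ 0 := fun i => by rw [mul_one]; exact hb i
    refine ContinuousAt.sub ?_ (continuousAt_const.mul ?_)
    · simp only [Matrix.det_apply]
      refine tendsto_finsetSum _ fun σ _ => (tendsto_finsetProd _ fun k _ =>
        Tendsto.mul tendsto_const_nhds (tendsto_finsetProd _ fun i _ => ?_)).const_smul _
      exact (DifferentiableAt.thetaPair (f := fun s => b i * s) (by fun_prop) (hb1 i) hp hw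
        (hx _)).continuousAt
    · refine tendsto_finsetProd _ fun s _ => tendsto_finsetProd _ fun l _ => ?_
      exact (DifferentiableAt.thetaCoeff (f := fun z => b (s - l) * z) (by fun_prop) (hb1 _) hp hw
        (ha l)).continuousAt
  have h1 : f 1 = 0 := by
    refine eq_zero_of_continuousAt_of_countable hf hS fun s hs => sub_eq_zero.mpr ?_
    simp only [S, mem_union, mem_iUnion, not_or, not_exists, mem_singleton_iff] at hs
    obtain ⟨hs0, hs⟩ := hs
    refine det_prod_of_three_term (X := {z : ℂ // z ≠ 0}) (Y := {z : ℂ // z ≠ 0})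
      (N := fun a x => thetaPair p w a x) (K := fun b a => thetaCoeff p w b a)
      (V := fun x y => thetaPoint p w x y)
      (fun a b x y => thetaPair_three_term hp0 hp hw a.2 b.2 x.2 y.2)
      (fun i => ⟨a i, ha i⟩) (fun i => ⟨b i * s, mul_ne_zero (hb i) hs0⟩) m
      (fun j => ⟨x j, hx j⟩) fun i j => mul_ne_zero ?_ ?_
    · have := modTheta_ne_zero_of_notMem hp0 hp (mul_ne_zero (hb i) (hx j)) hs0 (hs i j).1
      rwa [pow_one, mul_right_comm] at this
    · have := modTheta_ne_zero_of_notMem hp0 hp (div_ne_zero (mul_ne_zero (hb i) hw) (hx j)) hs0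
        (hs i j).2
      rwa [pow_one, div_mul_eq_mul_div, mul_right_comm] at this
  simpa [f, sub_eq_zero] using h1

/-! ### Torus averages and Andréief's identity -/

/-- The average over the unit torus. -/
def torusAverage {n : ℕ} (F : (Fin n → ℂ) → ℂ) : ℂ :=
  ((2 * (Real.pi : ℂ)) ^ n)⁻¹ *
    ∫ θ : Fin n → ℝ in Icc 0 (fun _ => 2 * Real.pi), F (torusMap 0 1 θ)

lemma torusMap_zero_one_apply {n : ℕ} (θ : Fin n → ℝ) (j : Fin n) :
    torusMap 0 1 θ j = circleMap 0 1 (θ j) := by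
  simp [torusMap, circleMap]

lemma norm_torusMap_zero_one {n : ℕ} (θ : Fin n → ℝ) (j : Fin n) : ‖torusMap 0 1 θ j‖ = 1 := by
  rw [torusMap_zero_one_apply, norm_circleMap_zero, abs_one]

lemma continuous_torusMap_zero_one {n : ℕ} (j : Fin n) :
    Continuous fun θ : Fin n → ℝ => torusMap 0 1 θ j := by
  simp only [torusMap_zero_one_apply]
  exact (continuous_circleMap 0 1).comp (continuous_apply j)

lemma torusAverage_prod {n : ℕ} (g : Fin n → ℂ → ℂ) :
    torusAverage (fun z => ∏ j, g j (z j)) = ∏ j, Real.circleAverage (g j) 0 1 := by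
  have h : (Icc 0 (fun _ => 2 * Real.pi) : Set (Fin n → ℝ)) =
      univ.pi fun _ => Icc 0 (2 * Real.pi) := (pi_univ_Icc _ _).symm
  simp only [torusAverage, torusMap_zero_one_apply]
  rw [h, volume_pi, Measure.restrict_pi_pi,
    integral_fintype_prod_eq_prod (fun j (x : ℝ) => g j (circleMap 0 1 x))]
  have h2 : ∀ j, Real.circleAverage (g j) 0 1 = (2 * (Real.pi : ℂ))⁻¹ *
      ∫ x in Icc 0 (2 * Real.pi), g j (circleMap 0 1 x) := fun j => by
    rw [Real.circleAverage_def, intervalIntegral.integral_of_le Real.two_pi_pos.le,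
      integral_Icc_eq_integral_Ioc, Complex.real_smul]
    push_cast
    rfl
  simp only [h2, Finset.prod_mul_distrib, Finset.prod_const, Finset.card_univ, Fintype.card_fin,
    inv_pow]

lemma integrableOn_torus {n : ℕ} {F : (Fin n → ℂ) → ℂ}
    (hF : Continuous fun θ : Fin n → ℝ => F (torusMap 0 1 θ)) :
    IntegrableOn (fun θ : Fin n → ℝ => F (torusMap 0 1 θ)) (Icc 0 (fun _ => 2 * Real.pi)) :=
  hF.continuousOn.integrableOn_compact isCompact_Icc

lemma torusAverage_sum {n : ℕ} {ι : Type*} (s : Finset ι) {F : ι → (Fin n → ℂ) → ℂ}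
    (hF : ∀ i ∈ s, Continuous fun θ : Fin n → ℝ => F i (torusMap 0 1 θ)) :
    torusAverage (fun z => ∑ i ∈ s, F i z) = ∑ i ∈ s, torusAverage (F i) := by
  simp only [torusAverage]
  rw [integral_finsetSum s fun i hi => integrableOn_torus (hF i hi), Finset.mul_sum]

lemma torusAverage_const_mul {n : ℕ} (c : ℂ) (F : (Fin n → ℂ) → ℂ) :
    torusAverage (fun z => c * F z) = c * torusAverage F := by
  simp only [torusAverage]
  rw [integral_const_mul]
  ring

lemma torusAverage_congr {n : ℕ} {F G : (Fin n → ℂ) → ℂ}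
    (h : ∀ z : Fin n → ℂ, (∀ j, ‖z j‖ = 1) → F z = G z) : torusAverage F = torusAverage G := by
  simp only [torusAverage]
  simp only [h _ (norm_torusMap_zero_one _)]

/-- **Andréief's identity** on the torus. -/
theorem torusAverage_det_mul_det {n : ℕ} {φ ψ : Fin n → ℂ → ℂ} {f : ℂ → ℂ}
    (hφ : ∀ k, ContinuousOn (φ k) (Metric.sphere 0 1))
    (hψ : ∀ k, ContinuousOn (ψ k) (Metric.sphere 0 1)) (hf : ContinuousOn f (Metric.sphere 0 1)) :
    torusAverage (fun z : Fin n → ℂ => (Matrix.of fun j k => φ k (z j)).det *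
      (Matrix.of fun j k => ψ k (z j)).det * ∏ j, f (z j)) =
    n.factorial * (Matrix.of fun k l => Real.circleAverage (fun z => φ k z * ψ l z * f z) 0 1).det
      := by
  set A : Matrix (Fin n) (Fin n) ℂ :=
    Matrix.of fun k l => Real.circleAverage (fun z => φ k z * ψ l z * f z) 0 1 with hA
  let T : Equiv.Perm (Fin n) → Equiv.Perm (Fin n) → (Fin n → ℂ) → ℂ := fun σ τ z =>
      ((Equiv.Perm.sign σ : ℤ) : ℂ) * ((Equiv.Perm.sign τ : ℤ) : ℂ) *
        ∏ j, (φ (σ j) (z j) * ψ (τ j) (z j) * f (z j))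
  have hexp : ∀ z : Fin n → ℂ, (Matrix.of fun j k => φ k (z j)).det *
      (Matrix.of fun j k => ψ k (z j)).det * ∏ j, f (z j) =
      ∑ σ : Equiv.Perm (Fin n), ∑ τ : Equiv.Perm (Fin n),
        T σ τ z := fun z => by
    rw [← Matrix.det_transpose, ← Matrix.det_transpose (Matrix.of fun j k => ψ k (z j)),
      Matrix.det_apply', Matrix.det_apply', Finset.sum_mul_sum, Finset.sum_mul]
    refine Finset.sum_congr rfl fun σ _ => ?_
    rw [Finset.sum_mul]
    refine Finset.sum_congr rfl fun τ _ => ?_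
    simp only [T, Matrix.transpose_apply, Matrix.of_apply, Finset.prod_mul_distrib]
    ring
  have hc : ∀ {g : ℂ → ℂ} (_ : ContinuousOn g (Metric.sphere 0 1)) (j : Fin n),
      Continuous fun θ : Fin n → ℝ => g (torusMap 0 1 θ j) := fun hg j =>
    hg.comp_continuous (continuous_torusMap_zero_one j) fun θ => by
      simpa using norm_torusMap_zero_one θ j
  have hcont : ∀ σ τ : Equiv.Perm (Fin n), Continuous fun θ : Fin n → ℝ =>
      T σ τ (torusMap 0 1 θ) :=
    fun σ τ => continuous_const.mul (continuous_finsetProd _ fun j _ =>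
      ((hc (hφ _) j).mul (hc (hψ _) j)).mul (hc hf j))
  simp only [hexp]
  rw [torusAverage_sum Finset.univ (F := fun σ z => ∑ τ, T σ τ z)
    fun σ _ => continuous_finsetSum _ fun τ _ => hcont σ τ]
  -- The integral factorizes over the variables. For fixed σ the sum over τ is a determinant with
  -- rows permuted by σ, whose sign cancels that of σ, so all n! terms agree.
  have hσ : ∀ σ : Equiv.Perm (Fin n), torusAverage (fun z : Fin n → ℂ =>
      ∑ τ, T σ τ z) = A.det := fun σ => by
    rw [torusAverage_sum Finset.univ (F := fun τ z => T σ τ z) fun τ _ => hcont σ τ]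
    have hτ : ∀ τ : Equiv.Perm (Fin n), torusAverage (T σ τ) =
        ((Equiv.Perm.sign σ : ℤ) : ℂ) * (((Equiv.Perm.sign τ : ℤ) : ℂ) *
          ∏ j, (A.submatrix σ id).transpose (τ j) j) := fun τ => by
      rw [torusAverage_const_mul,
        torusAverage_prod fun j z => φ (σ j) z * ψ (τ j) z * f z, mul_assoc]
      rfl
    rw [Finset.sum_congr rfl fun τ _ => hτ τ, ← Finset.mul_sum, ← Matrix.det_apply',
      Matrix.det_transpose, Matrix.det_permute, ← mul_assoc, ← Int.cast_mul,
      ← Units.val_mul, Int.units_mul_self, Units.val_one, Int.cast_one, one_mul]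
  rw [Finset.sum_congr rfl fun σ _ => hσ σ, Finset.sum_const, Finset.card_univ, Fintype.card_perm,
    Fintype.card_fin, nsmul_eq_mul]

/-- The Jacobian ∏ i e^{iθ_j} of the torus integral cancels against ∏ 1/(2πi z_j), leaving
(2π)^{-n}. -/
lemma torusIntegral_selbergIntegrand {n : ℕ} (p q s : ℂ) (t : Fin 6 → ℂ) :
    torusIntegral (selbergIntegrand (n := n) p q s t) 0 1 =
      torusAverage (selbergWeight (n := n) p q s t) := by
  rw [torusIntegral, torusAverage, ← integral_const_mul]
  refine integral_congr_ae (Eventually.of_forall fun θ => ?_)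
  simp only [selbergIntegrand, smul_eq_mul]
  rw [mul_left_comm, mul_comm, ← Finset.prod_mul_distrib]
  congr 1
  rw [Finset.prod_congr rfl fun j _ => ?_, Finset.prod_const, Finset.card_univ, Fintype.card_fin,
    inv_pow]
  have h := Complex.exp_ne_zero (θ j * Complex.I)
  have hpi : (Real.pi : ℂ) ≠ 0 := by exact_mod_cast Real.pi_ne_zero
  have hI := Complex.I_ne_zero
  simp only [torusMap, Pi.zero_apply, Pi.one_apply, Complex.ofReal_one, one_mul, zero_add]
  field_simp

/-! ### The Selberg weight with coupling q -/

lemma Continuous.ellipticGamma {X : Type*} [TopologicalSpace X] [LocallyCompactSpace X] {p q : ℂ}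
    (hp : ‖p‖ < 1) (hq : ‖q‖ < 1) {f : X → ℂ} (hf : Continuous f) (hf0 : ∀ x, f x ≠ 0)
    (hf1 : ∀ x, ‖f x‖ < 1) : Continuous fun x => ellipticGamma p q (f x) := by
  simp only [ellipticGamma_eq]
  refine Continuous.div ?_ ?_ fun x => doublePochhammer_ne_zero_of_norm_lt hp hq (hf1 x)
  · rw [← continuousOn_univ]
    exact ContinuousOn.doublePochhammer hq isOpen_univ continuousOn_const
      (continuous_const.div hf hf0).continuousOn fun _ _ => hp
  · rw [← continuousOn_univ]
    exact ContinuousOn.doublePochhammer hq isOpen_univ continuousOn_const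
      hf.continuousOn fun _ _ => hp

lemma Continuous.ellipticGammaPM {X : Type*} [TopologicalSpace X] [LocallyCompactSpace X] {p q : ℂ}
    (hp : ‖p‖ < 1) (hq : ‖q‖ < 1) {a z : X → ℂ} (ha : Continuous a) (hz : Continuous z)
    (ha0 : ∀ x, a x ≠ 0) (ha1 : ∀ x, ‖a x‖ < 1) (hz1 : ∀ x, ‖z x‖ = 1) :
    Continuous fun x => ellipticGammaPM p q (a x) (z x) := by
  have hz0 : ∀ x, z x ≠ 0 := fun x => norm_ne_zero_iff.mp (by rw [hz1]; exact one_ne_zero)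
  exact (Continuous.ellipticGamma hp hq (ha.mul hz) (fun x => mul_ne_zero (ha0 x) (hz0 x))
    fun x => by rw [Pi.mul_apply, norm_mul, hz1, mul_one]; exact ha1 x).mul
    (Continuous.ellipticGamma hp hq (ha.div hz hz0) (fun x => div_ne_zero (ha0 x) (hz0 x))
    fun x => by rw [norm_div, hz1, div_one]; exact ha1 x)

lemma Continuous.modTheta {X : Type*} [TopologicalSpace X] {p : ℂ} {f : X → ℂ} (hf : Continuous f)
    (hf0 : ∀ x, f x ≠ 0) (hp : ‖p‖ < 1) : Continuous fun x => modTheta p (f x) :=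
  continuous_iff_continuousAt.mpr fun x => ContinuousAt.comp (f := f) (x := x)
    (DifferentiableAt.modTheta (f := id) differentiableAt_id (hf0 x) hp).continuousAt
    hf.continuousAt

/-- Away from x = 1 this is a q-shift. At x = 1 the denominator has a pole; division by zero returns
0, which is also the true value of the quotient and of the right-hand side. -/
lemma ellipticGammaPM_q_div_one {p q x : ℂ} (hp : ‖p‖ < 1) (hq0 : q ≠ 0)
    (hq : ‖q‖ < 1) (hx : ‖x‖ = 1) :
    ellipticGammaPM p q q x / ellipticGammaPM p q 1 x = modTheta p x * modTheta p x⁻¹ := by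
  rcases eq_or_ne x 1 with rfl | hx1
  · rw [div_eq_mul_inv, inv_ellipticGammaPM_one hp hq hx, modTheta_one hp]
    simp
  have hx0 : x ≠ 0 := by rintro rfl; simp at hx
  have hpoch : ∀ {r y : ℂ}, ‖r‖ < 1 → ‖y‖ = 1 → y ≠ 1 → pochhammerInf r y ≠ 0 := fun hr hy hy1 => by
    rw [pochhammerInf_eq hr]
    refine mul_ne_zero (sub_ne_zero.mpr hy1.symm) (pochhammerInf_ne_zero_of_norm_lt hr ?_)
    rwa [norm_mul, hy, mul_one]
  have hth : ∀ {r y : ℂ}, ‖r‖ < 1 → ‖y‖ = 1 → y ≠ 1 → _root_.modTheta r y ≠ 0 := fun hr hy hy1 =>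
    mul_ne_zero (hpoch hr hy hy1) (pochhammerInf_ne_zero_of_norm_lt hr (by
      rwa [norm_div, hy, div_one]))
  have hxi : ‖x⁻¹‖ = 1 := by rw [norm_inv, hx, inv_one]
  have hxi1 : x⁻¹ ≠ 1 := by simpa using hx1
  have h := ellipticGammaPM_q_mul (s := 1) (z := x) hp hq0 hq
    (by rw [one_mul]; exact hpoch hp hx hx1) (by rw [one_div]; exact hpoch hp hxi hxi1)
  have hne : ellipticGammaPM p q 1 x ≠ 0 := by
    refine fun h0 => mul_ne_zero (hth hp hx hx1) (hth hq hxi hxi1) ?_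
    rw [← inv_ellipticGammaPM_one hp hq hx, h0, inv_zero]
  rw [mul_one] at h
  rw [h, mul_div_cancel_right₀ _ hne, modThetaPM, one_mul, one_div]

/-- This is where the coupling `q` matters: the interaction is a perfect square, so the weight
contains a product of two Vandermonde determinants. It also shows that the weight is continuous
where the gamma functions in the denominator have poles. -/
lemma ellipticGammaPMPM_q_div_one {p q z w : ℂ} (hp0 : p ≠ 0) (hp : ‖p‖ < 1) (hq0 : q ≠ 0)
    (hq : ‖q‖ < 1) (hz : ‖z‖ = 1) (hw : ‖w‖ = 1) :
    ellipticGammaPMPM p q q z w / ellipticGammaPMPM p q 1 z w = thetaPoint p 1 z w ^ 2 := by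
  have hz0 : z ≠ 0 := by rintro rfl; simp at hz
  have hw0 : w ≠ 0 := by rintro rfl; simp at hw
  have h : ∀ s, ellipticGammaPMPM p q s z w =
      ellipticGammaPM p q s (z * w) * ellipticGammaPM p q s (z / w) := fun s => by
    rw [ellipticGammaPMPM, ellipticGammaPM, ellipticGammaPM, ← mul_assoc s z w, ← mul_div_assoc,
      div_div_eq_mul_div]
    ring
  rw [h, h, mul_div_mul_comm, ellipticGammaPM_q_div_one hp hq0 hq (by rw [norm_mul, hz, hw, one_mul]),
    ellipticGammaPM_q_div_one hp hq0 hq (by rw [norm_div, hz, hw, div_one]),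
    modTheta_inv hp0 hp (mul_ne_zero hz0 hw0), modTheta_inv hp0 hp (div_ne_zero hz0 hw0),
    thetaPoint, div_one]
  field_simp

/-- The one-variable factor of the Selberg weight. -/
def singleWeight (p q : ℂ) (t : Fin 6 → ℂ) (z : ℂ) : ℂ :=
  (∏ k : Fin 6, ellipticGammaPM p q (t k) z) / ellipticGammaPM p q 1 (z ^ 2)

lemma selbergWeight_eq {n : ℕ} {p q : ℂ} (hp0 : p ≠ 0) (hp : ‖p‖ < 1) (hq0 : q ≠ 0)
    (hq : ‖q‖ < 1) (t : Fin 6 → ℂ) {z : Fin n → ℂ} (hz : ∀ j, ‖z j‖ = 1) :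
    selbergWeight p q q t z = (∏ j, ∏ k ∈ Finset.Ioi j, thetaPoint p 1 (z j) (z k)) ^ 2 *
      ∏ j, singleWeight p q t (z j) := by
  simp only [selbergWeight, ellipticGammaPMPM_q_div_one hp0 hp hq0 hq (hz _) (hz _),
    Finset.prod_pow, singleWeight]

lemma Continuous.selbergWeight {X : Type*} [TopologicalSpace X] [LocallyCompactSpace X] {n : ℕ}
    {p q : ℂ} (hp0 : p ≠ 0) (hp : ‖p‖ < 1) (hq0 : q ≠ 0) (hq : ‖q‖ < 1) {t : Fin 6 → X → ℂ}
    {z : Fin n → X → ℂ} (ht : ∀ k, Continuous (t k)) (hz : ∀ j, Continuous (z j))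
    (ht0 : ∀ k x, t k x ≠ 0) (ht1 : ∀ k x, ‖t k x‖ < 1) (hz1 : ∀ j x, ‖z j x‖ = 1) :
    Continuous fun x => selbergWeight p q q (fun k => t k x) (fun j => z j x) := by
  have hz0 : ∀ j x, z j x ≠ 0 := fun j x => norm_ne_zero_iff.mp (by rw [hz1]; exact one_ne_zero)
  simp only [selbergWeight_eq hp0 hp hq0 hq _ fun j => hz1 j _]
  refine ((continuous_finsetProd _ fun j _ => continuous_finsetProd _ fun k _ => ?_).pow 2).mul
    (continuous_finsetProd _ fun j _ => ?_)
  · exact (continuous_const.div (hz j) (hz0 j)).mul ((Continuous.modTheta (((hz j).mul (hz k)).div_const 1)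
      (fun x => div_ne_zero (mul_ne_zero (hz0 j x) (hz0 k x)) one_ne_zero) hp).mul
      (Continuous.modTheta ((hz j).div (hz k) (hz0 k)) (fun x => div_ne_zero (hz0 j x) (hz0 k x)) hp))
  · simp only [singleWeight, div_eq_mul_inv]
    refine (continuous_finsetProd _ fun k _ => Continuous.ellipticGammaPM hp hq (ht k) (hz j) (ht0 k)
      (ht1 k) (hz1 j)).mul ?_
    have h2 : ∀ x, ‖z j x ^ 2‖ = 1 := fun x => by rw [norm_pow, hz1, one_pow]
    simp only [inv_ellipticGammaPM_one hp hq (h2 _)]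
    exact (Continuous.modTheta ((hz j).pow 2) (fun x => pow_ne_zero 2 (hz0 j x)) hp).mul
      (Continuous.modTheta (((hz j).pow 2).inv₀ fun x => pow_ne_zero 2 (hz0 j x))
        (fun x => inv_ne_zero (pow_ne_zero 2 (hz0 j x))) hq)

lemma torusIntegrable_selbergIntegrand {n : ℕ} {p q : ℂ} (hp0 : p ≠ 0) (hp : ‖p‖ < 1) (hq0 : q ≠ 0)
    (hq : ‖q‖ < 1) {t : Fin 6 → ℂ} (ht0 : ∀ k, t k ≠ 0) (ht1 : ∀ k, ‖t k‖ < 1) :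
    TorusIntegrable (selbergIntegrand (n := n) p q q t) 0 1 := by
  refine integrableOn_torus ?_
  have hz0 : ∀ (θ : Fin n → ℝ) j, torusMap 0 1 θ j ≠ 0 := fun θ j =>
    norm_ne_zero_iff.mp (by rw [norm_torusMap_zero_one]; exact one_ne_zero)
  refine (Continuous.selbergWeight (t := fun k _ => t k) (z := fun j θ => torusMap 0 1 θ j) hp0 hp
    hq0 hq (fun k => continuous_const) continuous_torusMap_zero_one (fun k _ => ht0 k)
    (fun k _ => ht1 k) fun j θ => norm_torusMap_zero_one θ j).mul
    (continuous_finsetProd _ fun j _ => continuous_const.div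
      (continuous_const.mul (continuous_torusMap_zero_one j)) fun θ =>
        mul_ne_zero (by simp [Real.pi_ne_zero]) (hz0 θ j))

lemma norm_mul_pow_lt_one {q s : ℂ} (hq : ‖q‖ < 1) (hs : ‖s‖ < 1) (k : ℕ) : ‖s * q ^ k‖ < 1 := by
  rw [norm_mul, norm_pow]
  exact mul_lt_one_of_nonneg_of_lt_one_left (norm_nonneg _) hs (pow_le_one₀ (norm_nonneg _) hq.le)

lemma norm_mul_lt_one {s t : ℂ} (hs : ‖s‖ < 1) (ht : ‖t‖ < 1) : ‖s * t‖ < 1 := by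
  rw [norm_mul]
  exact mul_lt_one_of_nonneg_of_lt_one_left (norm_nonneg _) hs ht.le

lemma ellipticGamma_mul_pow {p q s : ℂ} (hp : ‖p‖ < 1) (hq0 : q ≠ 0) (hq : ‖q‖ < 1)
    (hs : ‖s‖ < 1) (k : ℕ) :
    ellipticGamma p q (s * q ^ k) =
      (∏ i ∈ Finset.range k, modTheta p (s * q ^ i)) * ellipticGamma p q s := by
  induction k with
  | zero => simp
  | succ k ih =>
    rw [show s * q ^ (k + 1) = q * (s * q ^ k) by ring, ellipticGamma_q_mul hp hq0 hq
      (pochhammerInf_ne_zero_of_norm_lt hp (norm_mul_pow_lt_one hq hs k)), ih,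
      Finset.prod_range_succ]
    ring

lemma ellipticGammaPM_mul_pow {p q s z : ℂ} (hp : ‖p‖ < 1) (hq0 : q ≠ 0) (hq : ‖q‖ < 1)
    (hs : ‖s‖ < 1) (hz : ‖z‖ = 1) (k : ℕ) :
    ellipticGammaPM p q (s * q ^ k) z =
      (∏ i ∈ Finset.range k, thetaPair p 1 (s * q ^ i) z) * ellipticGammaPM p q s z := by
  have h : ∀ i, thetaPair p 1 (s * q ^ i) z =
      (modTheta p (s * z * q ^ i)) * modTheta p (s / z * q ^ i) := fun i => by
    rw [thetaPair, mul_one, mul_right_comm, mul_div_right_comm]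
  simp only [ellipticGammaPM, h, Finset.prod_mul_distrib]
  rw [mul_right_comm s, mul_div_right_comm, ellipticGamma_mul_pow hp hq0 hq
    (by rwa [norm_mul, hz, mul_one]), ellipticGamma_mul_pow hp hq0 hq
    (by rwa [norm_div, hz, div_one])]
  ring

/-! ### Reduction to a determinant of elliptic beta integrals -/

/-- The polynomial-like functions `∏_{i<k} θ(a q^i z^±) ∏_{i<m-k} θ(b q^i z^±)`. -/
def thetaBasis (p q w a b : ℂ) (m k : ℕ) (z : ℂ) : ℂ :=
  (∏ i ∈ Finset.range k, thetaPair p w (a * q ^ i) z) *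
    ∏ i ∈ Finset.range (m - k), thetaPair p w (b * q ^ i) z

/-- The constant in the determinant of the functions `thetaBasis`. -/
def thetaBasisConst (p q w a b : ℂ) (m : ℕ) : ℂ :=
  ∏ s ∈ Finset.range m, ∏ l ∈ Finset.range (s + 1), thetaCoeff p w (b * q ^ (s - l)) (a * q ^ l)

lemma det_thetaBasis {p q w a b : ℂ} (hp0 : p ≠ 0) (hp : ‖p‖ < 1) (hq0 : q ≠ 0) (hw : w ≠ 0)
    (ha : a ≠ 0) (hb : b ≠ 0) {m : ℕ} {x : Fin (m + 1) → ℂ} (hx : ∀ j, x j ≠ 0) :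
    (Matrix.of fun j k : Fin (m + 1) => thetaBasis p q w a b m k (x j)).det =
      (∏ j, ∏ l ∈ Finset.Ioi j, thetaPoint p w (x j) (x l)) * thetaBasisConst p q w a b m :=
  det_thetaPair hp0 hp hw (fun i => mul_ne_zero ha (pow_ne_zero i hq0))
    (fun i => mul_ne_zero hb (pow_ne_zero i hq0)) hx

lemma continuousOn_thetaBasis {p q a b : ℂ} (hp : ‖p‖ < 1) (hq0 : q ≠ 0) (ha : a ≠ 0)
    (hb : b ≠ 0) (m k : ℕ) : ContinuousOn (thetaBasis p q 1 a b m k) (Metric.sphere 0 1) := by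
  have hd : ∀ {c : ℂ} (_ : c ≠ 0) (i : ℕ),
      ContinuousOn (fun z => thetaPair p 1 (c * q ^ i) z) (Metric.sphere 0 1) := fun hc i z hz => by
    have hz0 : z ≠ 0 := by rintro rfl; simp at hz
    have hc' := mul_ne_zero hc (pow_ne_zero i hq0)
    exact ((DifferentiableAt.modTheta (f := fun z => _ * q ^ i * z) (by fun_prop)
      (mul_ne_zero hc' hz0) hp).mul (DifferentiableAt.modTheta (f := fun z => _ * q ^ i * 1 / z)
      (by fun_prop (disch := assumption)) (div_ne_zero (mul_ne_zero hc' one_ne_zero) hz0)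
      hp)).continuousAt.continuousWithinAt
  exact (continuousOn_finsetProd _ fun i _ => hd ha i).mul
    (continuousOn_finsetProd _ fun i _ => hd hb i)

lemma continuousOn_singleWeight {p q : ℂ} (hp : ‖p‖ < 1) (hq : ‖q‖ < 1) {t : Fin 6 → ℂ}
    (ht0 : ∀ k, t k ≠ 0) (ht1 : ∀ k, ‖t k‖ < 1) :
    ContinuousOn (singleWeight p q t) (Metric.sphere 0 1) := by
  simp only [funext fun z => show singleWeight p q t z = _ from div_eq_mul_inv _ _]
  exact (continuousOn_finsetProd _ fun k _ => continuousOn_ellipticGammaPM hp hq (ht0 k) (ht1 k)).mul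
    (continuousOn_inv_ellipticGammaPM_one hp hq)

/-- Each theta pair raises one of t 0, …, t 3 by a factor `q`. The total shift is q^{2m},
independently of k and l, so every entry is balanced. -/
lemma thetaBasis_mul_singleWeight {p q : ℂ} (hp : ‖p‖ < 1) (hq0 : q ≠ 0) (hq : ‖q‖ < 1)
    {t : Fin 6 → ℂ} (ht1 : ∀ k, ‖t k‖ < 1) (m k l : ℕ) {z : ℂ} (hz : ‖z‖ = 1) :
    thetaBasis p q 1 (t 0) (t 1) m k z * thetaBasis p q 1 (t 2) (t 3) m l z * singleWeight p q t z =
      betaWeight p q (t 0 * q ^ k) (t 1 * q ^ (m - k))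
        ![t 2 * q ^ l, t 3 * q ^ (m - l), t 4, t 5] z := by
  simp only [betaWeight, Fin.prod_univ_four, Matrix.cons_val, Matrix.cons_val_zero,
    Matrix.cons_val_one, ellipticGammaPM_mul_pow hp hq0 hq (ht1 _) hz, singleWeight,
    Fin.prod_univ_six, thetaBasis]
  ring

/-- The row factor of the elliptic beta evaluations. -/
def rowGamma (p q a b c d : ℂ) (m k : ℕ) : ℂ :=
  ellipticGamma p q (a * c * q ^ k) * ellipticGamma p q (a * d * q ^ k) *
    (ellipticGamma p q (b * c * q ^ (m - k)) * ellipticGamma p q (b * d * q ^ (m - k)))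

/-- The mixed column factor of the elliptic beta evaluations. -/
def colGamma (p q a b c d : ℂ) (m l : ℕ) : ℂ :=
  ellipticGamma p q (a * c * q ^ l) * ellipticGamma p q (b * c * q ^ l) *
    (ellipticGamma p q (a * d * q ^ (m - l)) * ellipticGamma p q (b * d * q ^ (m - l)))

/-- Only the gamma functions pairing t 0 or t 1 with t 2 or t 3 mix k and l. Removing their
k-dependent shifts leaves the basis function with w = t 2 · t 3 · q^m at the point t 2 · q^l. -/
lemma betaValue_shift {p q : ℂ} (hp : ‖p‖ < 1) (hq0 : q ≠ 0) (hq : ‖q‖ < 1) {t : Fin 6 → ℂ}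
    (ht0 : ∀ k, t k ≠ 0) (ht1 : ∀ k, ‖t k‖ < 1) {m k l : ℕ} (hk : k ≤ m) (hl : l ≤ m) :
    betaValue p q (t 0 * q ^ k) (t 1 * q ^ (m - k)) ![t 2 * q ^ l, t 3 * q ^ (m - l), t 4, t 5] =
      rowGamma p q (t 0) (t 1) (t 4) (t 5) m k *
      ((ellipticGamma p q (t 0 * t 1 * q ^ m) * ellipticGamma p q (t 2 * t 3 * q ^ m) *
        ellipticGamma p q (t 4 * t 5)) *
        (rowGamma p q (t 2) (t 3) (t 4) (t 5) m l * colGamma p q (t 0) (t 1) (t 2) (t 3) m l) *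
        thetaBasis p q (t 2 * t 3 * q ^ m) (t 0) (t 1) m k (t 2 * q ^ l)) := by
  have hqk : q ^ k * q ^ (m - k) = q ^ m := by rw [← pow_add]; congr 1; omega
  have hql : q ^ l * q ^ (m - l) = q ^ m := by rw [← pow_add]; congr 1; omega
  have hmix : ∀ {a : ℂ} (_ : ‖a‖ < 1) (r : ℕ),
      ellipticGamma p q (a * q ^ r * (t 2 * q ^ l)) *
        ellipticGamma p q (a * q ^ r * (t 3 * q ^ (m - l))) =
      (∏ i ∈ Finset.range r, thetaPair p (t 2 * t 3 * q ^ m) (a * q ^ i) (t 2 * q ^ l)) *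
        (ellipticGamma p q (a * t 2 * q ^ l) * ellipticGamma p q (a * t 3 * q ^ (m - l))) := by
    intro a ha r
    have e1 : a * q ^ r * (t 2 * q ^ l) = a * t 2 * q ^ l * q ^ r := by ring
    have e2 : a * q ^ r * (t 3 * q ^ (m - l)) = a * t 3 * q ^ (m - l) * q ^ r := by ring
    rw [e1, e2, ellipticGamma_mul_pow hp hq0 hq
      (norm_mul_pow_lt_one hq (norm_mul_lt_one ha (ht1 2)) l), ellipticGamma_mul_pow hp hq0 hq
      (norm_mul_pow_lt_one hq (norm_mul_lt_one ha (ht1 3)) (m - l))]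
    have e3 : ∀ i, thetaPair p (t 2 * t 3 * q ^ m) (a * q ^ i) (t 2 * q ^ l) =
        modTheta p (a * t 2 * q ^ l * q ^ i) * modTheta p (a * t 3 * q ^ (m - l) * q ^ i) := by
      intro i
      have h2 := ht0 2
      rw [thetaPair, ← hql]
      congr 2
      · ring
      · field_simp
    simp only [e3, Finset.prod_mul_distrib]
    ring
  have hm1 := hmix (ht1 0) k
  have hm2 := hmix (ht1 1) (m - k)
  have g1 : t 0 * q ^ k * (t 1 * q ^ (m - k)) = t 0 * t 1 * q ^ m := by rw [← hqk]; ring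
  have g2 : t 2 * q ^ l * (t 3 * q ^ (m - l)) = t 2 * t 3 * q ^ m := by rw [← hql]; ring
  have g3 : ∀ a b c : ℂ, a * b * c = a * c * b := fun a b c => mul_right_comm a b c
  have i0 : Finset.Ioi (0 : Fin 4) = {1, 2, 3} := by decide
  have i1 : Finset.Ioi (1 : Fin 4) = {2, 3} := by decide
  have i2 : Finset.Ioi (2 : Fin 4) = {3} := by decide
  have i3 : Finset.Ioi (3 : Fin 4) = ∅ := by decide
  simp only [betaValue, Fin.prod_univ_four, Matrix.cons_val, Matrix.cons_val_zero,
    Matrix.cons_val_one, i0, i1, i2, i3, Finset.prod_empty, Finset.prod_singleton, mul_one]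
  rw [Finset.prod_insert (by decide), Finset.prod_insert (by decide), Finset.prod_singleton,
    Finset.prod_insert (by decide), Finset.prod_singleton]
  simp only [Matrix.cons_val, Matrix.cons_val_zero, Matrix.cons_val_one]
  rw [hm1, hm2, g1, g2, g3 (t 0) _ (t 4), g3 (t 0) _ (t 5), g3 (t 1) _ (t 4), g3 (t 1) _ (t 5),
    g3 (t 2) _ (t 4), g3 (t 2) _ (t 5), g3 (t 3) _ (t 4), g3 (t 3) _ (t 5)]
  simp only [rowGamma, colGamma, thetaBasis]
  ring

/-- The torus integral as a determinant of elliptic beta integrals. -/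
theorem torusAverage_selbergWeight_mul {p q : ℂ} (hp0 : p ≠ 0) (hp : ‖p‖ < 1) (hq0 : q ≠ 0)
    (hq : ‖q‖ < 1) {t : Fin 6 → ℂ} (ht0 : ∀ k, t k ≠ 0) (ht1 : ∀ k, ‖t k‖ < 1) (m : ℕ) :
    torusAverage (selbergWeight (n := m + 1) p q q t) *
      (thetaBasisConst p q 1 (t 0) (t 1) m * thetaBasisConst p q 1 (t 2) (t 3) m) =
    (m + 1).factorial * (Matrix.of fun k l : Fin (m + 1) => betaIntegral p q (t 0 * q ^ (k : ℕ))
      (t 1 * q ^ (m - k)) ![t 2 * q ^ (l : ℕ), t 3 * q ^ (m - l), t 4, t 5]).det := by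
  have h := torusAverage_det_mul_det (n := m + 1)
    (φ := fun k => thetaBasis p q 1 (t 0) (t 1) m k) (ψ := fun k => thetaBasis p q 1 (t 2) (t 3) m k)
    (f := singleWeight p q t) (fun k => continuousOn_thetaBasis hp hq0 (ht0 0) (ht0 1) m k)
    (fun k => continuousOn_thetaBasis hp hq0 (ht0 2) (ht0 3) m k)
    (continuousOn_singleWeight hp hq ht0 ht1)
  have hA : ∀ k l : Fin (m + 1), Real.circleAverage (fun z =>
      thetaBasis p q 1 (t 0) (t 1) m k z * thetaBasis p q 1 (t 2) (t 3) m l z *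
        singleWeight p q t z) 0 1 = betaIntegral p q (t 0 * q ^ (k : ℕ)) (t 1 * q ^ (m - k))
        ![t 2 * q ^ (l : ℕ), t 3 * q ^ (m - l), t 4, t 5] := fun k l =>
    Real.circleAverage_congr_sphere fun z hz => by
      have hz1 : ‖z‖ = 1 := by simpa using hz
      exact thetaBasis_mul_singleWeight hp hq0 hq ht1 m k l hz1
  simp only [hA] at h
  rw [← h, mul_comm, ← torusAverage_const_mul]
  refine torusAverage_congr fun z hz => ?_
  have hz0 : ∀ j, z j ≠ 0 := fun j => norm_ne_zero_iff.mp (by rw [hz]; exact one_ne_zero)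
  rw [det_thetaBasis hp0 hp hq0 one_ne_zero (ht0 0) (ht0 1) hz0,
    det_thetaBasis hp0 hp hq0 one_ne_zero (ht0 2) (ht0 3) hz0, selbergWeight_eq hp0 hp hq0 hq t hz]
  ring

/-- Evaluation of the determinant of elliptic beta integrals. -/
theorem selbergConst_pow_mul_det_betaIntegral {p q : ℂ} (hp0 : p ≠ 0) (hp : ‖p‖ < 1) (hq0 : q ≠ 0)
    (hq : ‖q‖ < 1) {t : Fin 6 → ℂ} (ht0 : ∀ k, t k ≠ 0) (ht1 : ∀ k, ‖t k‖ < 1) {m : ℕ}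
    (hbal : q ^ (2 * m) * ∏ k : Fin 6, t k = p * q) :
    selbergConst p q ^ (m + 1) * (Matrix.of fun k l : Fin (m + 1) => betaIntegral p q
      (t 0 * q ^ (k : ℕ)) (t 1 * q ^ (m - k))
        ![t 2 * q ^ (l : ℕ), t 3 * q ^ (m - l), t 4, t 5]).det =
    2 ^ (m + 1) * ((∏ k : Fin (m + 1), rowGamma p q (t 0) (t 1) (t 4) (t 5) m k) *
      ((∏ l : Fin (m + 1), ((ellipticGamma p q (t 0 * t 1 * q ^ m) *
        ellipticGamma p q (t 2 * t 3 * q ^ m) * ellipticGamma p q (t 4 * t 5)) *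
        (rowGamma p q (t 2) (t 3) (t 4) (t 5) m l * colGamma p q (t 0) (t 1) (t 2) (t 3) m l))) *
      ((∏ j : Fin (m + 1), ∏ l ∈ Finset.Ioi j,
        thetaPoint p (t 2 * t 3 * q ^ m) (t 2 * q ^ (j : ℕ)) (t 2 * q ^ (l : ℕ))) *
        thetaBasisConst p q (t 2 * t 3 * q ^ m) (t 0) (t 1) m))) := by
  have hsmul : ∀ (c : ℂ) (M : Matrix (Fin (m + 1)) (Fin (m + 1)) ℂ),
      c ^ (m + 1) * M.det = (c • M).det := fun c M => by rw [Matrix.det_smul, Fintype.card_fin]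
  -- The right-hand side is folded back into a single determinant, row and column factors included,
  -- so that the identity can be checked entrywise.
  rw [← det_thetaBasis (x := fun j : Fin (m + 1) => t 2 * q ^ (j : ℕ)) hp0 hp hq0
    (mul_ne_zero (mul_ne_zero (ht0 2) (ht0 3)) (pow_ne_zero m hq0)) (ht0 0) (ht0 1)
    (fun j => mul_ne_zero (ht0 2) (pow_ne_zero _ hq0)), ← Matrix.det_mul_column,
    ← Matrix.det_transpose, ← Matrix.det_mul_row, hsmul, hsmul]
  congr 1
  ext l k
  have hk : (k : ℕ) ≤ m := Nat.lt_succ_iff.mp k.2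
  have hl : (l : ℕ) ≤ m := Nat.lt_succ_iff.mp l.2
  have hqk : q ^ (k : ℕ) * q ^ (m - k) = q ^ m := by rw [← pow_add]; congr 1; omega
  have hql : q ^ (l : ℕ) * q ^ (m - l) = q ^ m := by rw [← pow_add]; congr 1; omega
  simp only [Matrix.smul_apply, Matrix.of_apply, Matrix.transpose_apply, smul_eq_mul]
  rw [betaIntegral_eq hp0 hp hq0 hq (norm_mul_pow_lt_one hq (ht1 0) _)
    (norm_mul_pow_lt_one hq (ht1 1) _) ?_ ?_, betaValue_shift hp hq0 hq ht0 ht1 hk hl]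
  · intro i
    fin_cases i
    exacts [norm_mul_pow_lt_one hq (ht1 2) _, norm_mul_pow_lt_one hq (ht1 3) _, ht1 4, ht1 5]
  · rw [← hbal, Fin.prod_univ_four, Fin.prod_univ_six, two_mul, pow_add]
    simp only [Matrix.cons_val, Matrix.cons_val_zero, Matrix.cons_val_one]
    nth_rw 1 [← hqk]
    rw [← hql]
    ring

/-! ### Matching the products of gamma and theta functions -/

/-- Passing from Γ(a q^μ) to Γ(a q^m) costs θ(a q^s) for μ ≤ s < m, so θ(a q^s) occurs s + 1 times.
The constant inner product fits the triangular index set of `thetaBasisConst`. -/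
lemma ellipticGamma_pow_eq {p q a : ℂ} (hp : ‖p‖ < 1) (hq0 : q ≠ 0) (hq : ‖q‖ < 1) (ha : ‖a‖ < 1)
    (m : ℕ) : ellipticGamma p q (a * q ^ m) ^ (m + 1) =
      (∏ μ ∈ Finset.range (m + 1), ellipticGamma p q (a * q ^ μ)) *
        ∏ s ∈ Finset.range m, ∏ _l ∈ Finset.range (s + 1), modTheta p (a * q ^ s) := by
  simp only [Finset.prod_const, Finset.card_range]
  induction m with
  | zero => simp
  | succ m ih =>
    have h : ellipticGamma p q (a * q ^ (m + 1)) =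
        modTheta p (a * q ^ m) * ellipticGamma p q (a * q ^ m) := by
      rw [show a * q ^ (m + 1) = q * (a * q ^ m) by ring, ellipticGamma_q_mul hp hq0 hq
        (pochhammerInf_ne_zero_of_norm_lt hp (norm_mul_pow_lt_one hq ha m))]
    rw [pow_succ, Finset.prod_range_succ (fun μ => ellipticGamma p q (a * q ^ μ)) (m + 1),
      Finset.prod_range_succ (fun s => modTheta p (a * q ^ s) ^ (s + 1)) m]
    nth_rw 1 [h]
    rw [mul_pow, ih]
    ring

/-- Passing from Γ(a) to Γ(a q^μ) costs θ(a q^i) for i < μ. This factor occurs m - i times, which is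
s + 1 for i = m - 1 - s. -/
lemma prod_ellipticGamma_mul_pow {p q a : ℂ} (hp : ‖p‖ < 1) (hq0 : q ≠ 0) (hq : ‖q‖ < 1)
    (ha : ‖a‖ < 1) (m : ℕ) : ∏ μ ∈ Finset.range (m + 1), ellipticGamma p q (a * q ^ μ) =
      ellipticGamma p q a ^ (m + 1) *
        ∏ s ∈ Finset.range m, ∏ _l ∈ Finset.range (s + 1), modTheta p (a * q ^ (m - 1 - s)) := by
  simp only [Finset.prod_const, Finset.card_range]
  induction m with
  | zero => simp
  | succ m ih =>
    have h1 : ∏ s ∈ Finset.range (m + 1), modTheta p (a * q ^ (m - s)) ^ (s + 1) =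
        (∏ s ∈ Finset.range m, modTheta p (a * q ^ (m - 1 - s)) ^ (s + 1)) *
          ∏ s ∈ Finset.range (m + 1), modTheta p (a * q ^ s) := by
      rw [← Finset.prod_range_reflect (fun s => modTheta p (a * q ^ s)),
        Finset.prod_range_succ', Finset.prod_range_succ', ← mul_assoc, ← Finset.prod_mul_distrib]
      simp only [pow_succ _ (_ + 1), Nat.sub_zero, zero_add, pow_one, Nat.add_sub_cancel]
      congr 1
      refine Finset.prod_congr rfl fun s _ => ?_
      rw [show m - (s + 1) = m - 1 - s by omega]
    rw [Finset.prod_range_succ, ih, ellipticGamma_mul_pow hp hq0 hq ha, Nat.add_sub_cancel, h1]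
    ring

/-- Pairs are indexed by their smaller member l and their gap m - s. -/
lemma prod_Ioi_eq_prod_range {M : Type*} [CommMonoid M] (m : ℕ) (g : ℕ → ℕ → M) :
    ∏ j : Fin (m + 1), ∏ l ∈ Finset.Ioi j, g j l =
      ∏ s ∈ Finset.range m, ∏ l ∈ Finset.range (s + 1), g l (l + (m - s)) := by
  rw [Finset.prod_sigma', Finset.prod_sigma']
  refine Finset.prod_bij' (fun x _ => ⟨m - (x.2 - x.1), x.1⟩)
    (fun x hx => ⟨⟨x.2, ?_⟩, ⟨x.2 + (m - x.1), ?_⟩⟩) ?_ ?_ ?_ ?_ ?_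
  · simp only [Finset.mem_sigma, Finset.mem_range] at hx
    omega
  · simp only [Finset.mem_sigma, Finset.mem_range] at hx
    omega
  · rintro ⟨j, l⟩ hx
    simp only [Finset.mem_sigma, Finset.mem_univ, Finset.mem_Ioi, Fin.lt_def, true_and] at hx
    simp only [Finset.mem_sigma, Finset.mem_range]
    omega
  · rintro ⟨s, l⟩ hx
    simp only [Finset.mem_sigma, Finset.mem_range] at hx
    simp only [Finset.mem_sigma, Finset.mem_univ, Finset.mem_Ioi, Fin.lt_def, true_and]
    omega
  · rintro ⟨j, l⟩ hx
    simp only [Finset.mem_sigma, Finset.mem_univ, Finset.mem_Ioi, Fin.lt_def, true_and] at hx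
    have hl := l.2
    simp only [Sigma.mk.injEq, heq_eq_eq, Fin.ext_iff, true_and]
    omega
  · rintro ⟨s, l⟩ hx
    simp only [Finset.mem_sigma, Finset.mem_range] at hx
    simp only [Sigma.mk.injEq, heq_eq_eq, and_true]
    omega
  · rintro ⟨j, l⟩ hx
    simp only [Finset.mem_sigma, Finset.mem_univ, Finset.mem_Ioi, Fin.lt_def, true_and] at hx
    have hl := l.2
    simp only
    congr 1
    omega

/-- After inversion of two theta arguments, the points c q^l give θ(d q^{s-l} / (c q^l)), needed for
the second constant, and θ(q^{m-s}). Changing w from c d q^m to 1 trades θ(a b c d q^{m+s}) for θ(a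
b q^s). -/
lemma thetaPoint_mul_thetaCoeff {p q a b c d : ℂ} (hp0 : p ≠ 0) (hp : ‖p‖ < 1) (hq0 : q ≠ 0)
    (ha : a ≠ 0) (hc : c ≠ 0) (hd : d ≠ 0) {m s l : ℕ} (hs : s < m) (hl : l ≤ s) :
    modTheta p (a * b * q ^ s) * modTheta p (c * d * q ^ s) *
      thetaPoint p (c * d * q ^ m) (c * q ^ l) (c * q ^ (l + (m - s))) *
      thetaCoeff p (c * d * q ^ m) (b * q ^ (s - l)) (a * q ^ l) =
    thetaCoeff p 1 (b * q ^ (s - l)) (a * q ^ l) * thetaCoeff p 1 (d * q ^ (s - l)) (c * q ^ l) *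
      (modTheta p (q * q ^ (m - 1 - s)) * modTheta p (a * b * (c * d) * q ^ (m + s))) := by
  obtain ⟨r, rfl⟩ := Nat.exists_eq_add_of_le hl
  obtain ⟨e, rfl⟩ := Nat.exists_eq_add_of_lt hs
  have e1 : l + r + e + 1 - (l + r) = e + 1 := by omega
  have e2 : l + r + e + 1 - 1 - (l + r) = e := by omega
  have e3 : l + r - l = r := by omega
  rw [e1, e2, e3, ← pow_succ']
  have hX : d * q ^ r / (c * q ^ l) ≠ 0 := by positivity
  have h1 := modTheta_inv hp0 hp hX
  have h2 := modTheta_inv hp0 hp (pow_ne_zero (e + 1) hq0)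
  have g1 : c * q ^ l * (c * q ^ (l + (e + 1))) / (c * d * q ^ (l + r + e + 1)) =
      (d * q ^ r / (c * q ^ l))⁻¹ := by field_simp; ring
  have g2 : c * q ^ l / (c * q ^ (l + (e + 1))) = (q ^ (e + 1))⁻¹ := by field_simp; ring
  have g3 : a * q ^ l * (b * q ^ r) * 1 = a * b * q ^ (l + r) := by ring
  have g4 : c * q ^ l * (d * q ^ r) * 1 = c * d * q ^ (l + r) := by ring
  have g5 : a * q ^ l * (b * q ^ r) * (c * d * q ^ (l + r + e + 1)) =
      a * b * (c * d) * q ^ (l + r + e + 1 + (l + r)) := by ring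
  simp only [thetaPoint, thetaCoeff, g1, g2, g3, g4, g5, h1, h2]
  field_simp
  ring

lemma prod_rowGamma {p q a b c d : ℂ} (m : ℕ) :
    ∏ k : Fin (m + 1), rowGamma p q a b c d m k = ∏ μ ∈ Finset.range (m + 1),
      (ellipticGamma p q (a * c * q ^ μ) * ellipticGamma p q (a * d * q ^ μ) *
        (ellipticGamma p q (b * c * q ^ μ) * ellipticGamma p q (b * d * q ^ μ))) := by
  rw [Fin.prod_univ_eq_prod_range (rowGamma p q a b c d m)]
  simp only [rowGamma, Finset.prod_mul_distrib]
  congr 1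
  rw [← Finset.prod_range_reflect (fun μ => ellipticGamma p q (b * c * q ^ μ)),
    ← Finset.prod_range_reflect (fun μ => ellipticGamma p q (b * d * q ^ μ))]
  rfl

lemma prod_colGamma {p q a b c d : ℂ} (m : ℕ) :
    ∏ l : Fin (m + 1), colGamma p q a b c d m l = ∏ μ ∈ Finset.range (m + 1),
      (ellipticGamma p q (a * c * q ^ μ) * ellipticGamma p q (b * c * q ^ μ) *
        (ellipticGamma p q (a * d * q ^ μ) * ellipticGamma p q (b * d * q ^ μ))) := by
  rw [Fin.prod_univ_eq_prod_range (colGamma p q a b c d m)]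
  simp only [colGamma, Finset.prod_mul_distrib]
  congr 1
  rw [← Finset.prod_range_reflect (fun μ => ellipticGamma p q (a * d * q ^ μ)),
    ← Finset.prod_range_reflect (fun μ => ellipticGamma p q (b * d * q ^ μ))]
  rfl

/-- The right-hand side of the elliptic Selberg integral evaluation in `m + 1` variables. -/
def selbergValue (p q : ℂ) (m : ℕ) (t : Fin 6 → ℂ) : ℂ :=
  ∏ μ ∈ Finset.range (m + 1), (ellipticGamma p q (q ^ (μ + 1)) / ellipticGamma p q q *
    ∏ j : Fin 6, ∏ k ∈ Finset.Ioi j, ellipticGamma p q (q ^ μ * t j * t k))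

/-- The fifteen pairs of parameters split into four in each of the two row products, four in the
column product, and the three pairs 01, 23, 45. -/
lemma selbergValue_eq (p q : ℂ) (m : ℕ) (t : Fin 6 → ℂ) : selbergValue p q m t =
    (∏ k : Fin (m + 1), rowGamma p q (t 0) (t 1) (t 4) (t 5) m k) *
    ((∏ l : Fin (m + 1), rowGamma p q (t 2) (t 3) (t 4) (t 5) m l) *
      ∏ l : Fin (m + 1), colGamma p q (t 0) (t 1) (t 2) (t 3) m l) *
    ((∏ μ ∈ Finset.range (m + 1), ellipticGamma p q (q * q ^ μ) / ellipticGamma p q q) *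
      ((∏ μ ∈ Finset.range (m + 1), ellipticGamma p q (t 0 * t 1 * q ^ μ)) *
      (∏ μ ∈ Finset.range (m + 1), ellipticGamma p q (t 2 * t 3 * q ^ μ)) *
      ∏ μ ∈ Finset.range (m + 1), ellipticGamma p q (t 4 * t 5 * q ^ μ))) := by
  have i0 : Finset.Ioi (0 : Fin 6) = {1, 2, 3, 4, 5} := by decide
  have i1 : Finset.Ioi (1 : Fin 6) = {2, 3, 4, 5} := by decide
  have i2 : Finset.Ioi (2 : Fin 6) = {3, 4, 5} := by decide
  have i3 : Finset.Ioi (3 : Fin 6) = {4, 5} := by decide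
  have i4 : Finset.Ioi (4 : Fin 6) = {5} := by decide
  have i5 : Finset.Ioi (5 : Fin 6) = ∅ := by decide
  rw [prod_rowGamma, prod_rowGamma, prod_colGamma]
  simp only [← Finset.prod_mul_distrib, selbergValue]
  refine Finset.prod_congr rfl fun μ _ => ?_
  have hc : ∀ a b : ℂ, q ^ μ * a * b = a * b * q ^ μ := fun a b => by ring
  simp only [hc, Fin.prod_univ_six, i0, i1, i2, i3, i4, i5]
  simp only [Finset.prod_insert, Finset.mem_insert, Finset.mem_singleton, Fin.reduceEq, or_self,
    not_false_eq_true, Finset.prod_singleton, Finset.prod_empty, pow_succ' q μ]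
  ring

lemma ellipticGamma_self_ne_zero {p q : ℂ} (hp : ‖p‖ < 1) (hq0 : q ≠ 0) (hq : ‖q‖ < 1) :
    ellipticGamma p q q ≠ 0 := by
  rw [ellipticGamma_eq, mul_div_cancel_right₀ p hq0]
  exact div_ne_zero (doublePochhammer_ne_zero_of_norm_lt hp hq hp)
    (doublePochhammer_ne_zero_of_norm_lt hp hq hq)

theorem selbergValue_mul_thetaBasisConst {p q : ℂ} (hp0 : p ≠ 0) (hp : ‖p‖ < 1) (hq0 : q ≠ 0)
    (hq : ‖q‖ < 1) {t : Fin 6 → ℂ} (ht0 : ∀ k, t k ≠ 0) (ht1 : ∀ k, ‖t k‖ < 1) {m : ℕ}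
    (hbal : q ^ (2 * m) * ∏ k : Fin 6, t k = p * q) :
    (∏ k : Fin (m + 1), rowGamma p q (t 0) (t 1) (t 4) (t 5) m k) *
      ((∏ l : Fin (m + 1), ((ellipticGamma p q (t 0 * t 1 * q ^ m) *
        ellipticGamma p q (t 2 * t 3 * q ^ m) * ellipticGamma p q (t 4 * t 5)) *
        (rowGamma p q (t 2) (t 3) (t 4) (t 5) m l * colGamma p q (t 0) (t 1) (t 2) (t 3) m l))) *
      ((∏ j : Fin (m + 1), ∏ l ∈ Finset.Ioi j,
        thetaPoint p (t 2 * t 3 * q ^ m) (t 2 * q ^ (j : ℕ)) (t 2 * q ^ (l : ℕ))) *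
        thetaBasisConst p q (t 2 * t 3 * q ^ m) (t 0) (t 1) m)) =
    selbergValue p q m t *
      (thetaBasisConst p q 1 (t 0) (t 1) m * thetaBasisConst p q 1 (t 2) (t 3) m) := by
  -- By the balancing condition the two arguments multiply to `p`, and θ(p/x) = θ(x).
  have h45 : ∀ s ∈ Finset.range m, modTheta p (t 4 * t 5 * q ^ (m - 1 - s)) =
      modTheta p (t 0 * t 1 * (t 2 * t 3) * q ^ (m + s)) := fun s hs => by
    rw [Finset.mem_range] at hs
    obtain ⟨e, rfl⟩ := Nat.exists_eq_add_of_lt hs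
    rw [show s + e + 1 - 1 - s = e by omega]
    have hne : t 0 * t 1 * (t 2 * t 3) * q ^ (s + e + 1 + s) ≠ 0 :=
      mul_ne_zero (mul_ne_zero (mul_ne_zero (ht0 0) (ht0 1)) (mul_ne_zero (ht0 2) (ht0 3)))
        (pow_ne_zero _ hq0)
    rw [← modTheta_div hp0 hne]
    congr 1
    rw [eq_div_iff hne]
    refine mul_right_cancel₀ hq0 ?_
    rw [← hbal, Fin.prod_univ_six]
    ring
  have hpt : (∏ s ∈ Finset.range m, ∏ _l ∈ Finset.range (s + 1), modTheta p (t 0 * t 1 * q ^ s)) *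
      (∏ s ∈ Finset.range m, ∏ _l ∈ Finset.range (s + 1), modTheta p (t 2 * t 3 * q ^ s)) *
      (∏ j : Fin (m + 1), ∏ l ∈ Finset.Ioi j,
        thetaPoint p (t 2 * t 3 * q ^ m) (t 2 * q ^ (j : ℕ)) (t 2 * q ^ (l : ℕ))) *
      thetaBasisConst p q (t 2 * t 3 * q ^ m) (t 0) (t 1) m =
      thetaBasisConst p q 1 (t 0) (t 1) m * thetaBasisConst p q 1 (t 2) (t 3) m *
      ((∏ s ∈ Finset.range m, ∏ _l ∈ Finset.range (s + 1), modTheta p (q * q ^ (m - 1 - s))) *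
      ∏ s ∈ Finset.range m, ∏ _l ∈ Finset.range (s + 1),
        modTheta p (t 4 * t 5 * q ^ (m - 1 - s))) := by
    rw [prod_Ioi_eq_prod_range m fun j l =>
      thetaPoint p (t 2 * t 3 * q ^ m) (t 2 * q ^ j) (t 2 * q ^ l)]
    simp only [thetaBasisConst, ← Finset.prod_mul_distrib]
    refine Finset.prod_congr rfl fun s hs => Finset.prod_congr rfl fun l hl => ?_
    rw [h45 s hs]
    exact thetaPoint_mul_thetaCoeff hp0 hp hq0 (ht0 0) (ht0 2) (ht0 3) (Finset.mem_range.mp hs)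
      (Nat.lt_succ_iff.mp (Finset.mem_range.mp hl))
  have hqq := pow_ne_zero (m + 1) (ellipticGamma_self_ne_zero hp hq0 hq)
  have hconst : ∀ c : ℂ, ∏ _l : Fin (m + 1), c = c ^ (m + 1) := fun c => by simp
  rw [selbergValue_eq, Finset.prod_mul_distrib, hconst,
    Finset.prod_mul_distrib (f := fun l : Fin (m + 1) => rowGamma _ _ _ _ _ _ _ l), mul_pow,
    mul_pow, ellipticGamma_pow_eq hp hq0 hq (norm_mul_lt_one (ht1 0) (ht1 1)),
    ellipticGamma_pow_eq hp hq0 hq (norm_mul_lt_one (ht1 2) (ht1 3)),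
    prod_ellipticGamma_mul_pow hp hq0 hq (norm_mul_lt_one (ht1 4) (ht1 5)),
    Finset.prod_div_distrib, prod_ellipticGamma_mul_pow hp hq0 hq hq, Finset.prod_const,
    Finset.card_range, mul_div_cancel_left₀ _ hqq]
  linear_combination (∏ k : Fin (m + 1), rowGamma p q (t 0) (t 1) (t 4) (t 5) m k) *
    ((∏ l : Fin (m + 1), rowGamma p q (t 2) (t 3) (t 4) (t 5) m l) *
      ∏ l : Fin (m + 1), colGamma p q (t 0) (t 1) (t 2) (t 3) m l) *
    ((∏ μ ∈ Finset.range (m + 1), ellipticGamma p q (t 0 * t 1 * q ^ μ)) *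
      (∏ μ ∈ Finset.range (m + 1), ellipticGamma p q (t 2 * t 3 * q ^ μ)) *
      ellipticGamma p q (t 4 * t 5) ^ (m + 1)) * hpt

/-! ### Removing the genericity assumption -/

/-- The elliptic Selberg integral, up to a factor that is generically non-zero. -/
theorem selberg_mul_thetaBasisConst {p q : ℂ} (hp0 : p ≠ 0) (hp : ‖p‖ < 1) (hq0 : q ≠ 0)
    (hq : ‖q‖ < 1) {t : Fin 6 → ℂ} (ht0 : ∀ k, t k ≠ 0) (ht1 : ∀ k, ‖t k‖ < 1) {m : ℕ}
    (hbal : q ^ (2 * m) * ∏ k : Fin 6, t k = p * q) :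
    (selbergConst p q ^ (m + 1) * torusAverage (selbergWeight (n := m + 1) p q q t)
      - 2 ^ (m + 1) * (m + 1).factorial * selbergValue p q m t) *
      (thetaBasisConst p q 1 (t 0) (t 1) m * thetaBasisConst p q 1 (t 2) (t 3) m) = 0 := by
  have h1 := torusAverage_selbergWeight_mul hp0 hp hq0 hq ht0 ht1 m
  have h2 := selbergConst_pow_mul_det_betaIntegral hp0 hp hq0 hq ht0 ht1 hbal
  rw [selbergValue_mul_thetaBasisConst hp0 hp hq0 hq ht0 ht1 hbal] at h2
  linear_combination selbergConst p q ^ (m + 1) * h1 + ((m + 1).factorial : ℂ) * h2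

lemma thetaBasisConst_ne_zero {p q a b : ℂ} (hp0 : p ≠ 0) (hp : ‖p‖ < 1) (hq0 : q ≠ 0)
    (ha : a ≠ 0) (hb : b ≠ 0) (h1 : ∀ l r : ℕ, ∀ k : ℤ, a * q ^ l * (b * q ^ r) ≠ p ^ k)
    (h2 : ∀ l r : ℕ, ∀ k : ℤ, a * q ^ l / (b * q ^ r) ≠ p ^ k) (m : ℕ) :
    thetaBasisConst p q 1 a b m ≠ 0 := by
  refine Finset.prod_ne_zero_iff.mpr fun s _ => Finset.prod_ne_zero_iff.mpr fun l _ => ?_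
  have ha' : a * q ^ l ≠ 0 := mul_ne_zero ha (pow_ne_zero l hq0)
  have hb' : b * q ^ (s - l) ≠ 0 := mul_ne_zero hb (pow_ne_zero _ hq0)
  refine mul_ne_zero ha' (mul_ne_zero ?_ ?_)
  · rw [mul_one]
    exact modTheta_ne_zero hp0 hp (mul_ne_zero ha' hb') (h1 l (s - l))
  · refine modTheta_ne_zero hp0 hp (div_ne_zero hb' ha') fun k hk => h2 l (s - l) (-k) ?_
    rw [zpow_neg, ← hk, inv_div]

lemma exists_countable_thetaBasisConst_ne_zero {p q a b : ℂ} (hp0 : p ≠ 0) (hp : ‖p‖ < 1)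
    (hq0 : q ≠ 0) (ha : a ≠ 0) (hb : b ≠ 0) (m : ℕ) : ∃ S : Set ℂ, S.Countable ∧
      ∀ x ∉ S, x ≠ 0 → thetaBasisConst p q 1 (a * x) b m ≠ 0 := by
  refine ⟨⋃ l : ℕ, ⋃ r : ℕ, ({x | ∃ k : ℤ, a * q ^ l * (b * q ^ r) * x ^ 1 = p ^ k} ∪
    {x | ∃ k : ℤ, a * q ^ l / (b * q ^ r) * x ^ 1 = p ^ k}), ?_, fun x hx hx0 => ?_⟩
  · refine countable_iUnion fun l => countable_iUnion fun r => ?_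
    have ha' : a * q ^ l ≠ 0 := mul_ne_zero ha (pow_ne_zero l hq0)
    have hb' : b * q ^ r ≠ 0 := mul_ne_zero hb (pow_ne_zero r hq0)
    exact (countable_mul_pow_eq_zpow (mul_ne_zero ha' hb') one_ne_zero).union
      (countable_mul_pow_eq_zpow (div_ne_zero ha' hb') one_ne_zero)
  · simp only [mem_union, mem_iUnion, not_or, not_exists] at hx
    refine thetaBasisConst_ne_zero hp0 hp hq0 (mul_ne_zero ha hx0) hb (fun l r k h => ?_)
      (fun l r k h => ?_) m
    · exact (hx l r).1 ⟨k, by rw [← h]; ring⟩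
    · exact (hx l r).2 ⟨k, by rw [← h]; ring⟩

/-- A parametrization of the unit circle without the point `-1`. -/
def cayley (τ : ℝ) : ℂ := (1 + τ * Complex.I) / (1 - τ * Complex.I)

lemma one_sub_mul_I_ne_zero (τ : ℝ) : 1 - τ * Complex.I ≠ 0 := fun h => by
  simpa using congrArg Complex.re h

lemma norm_cayley (τ : ℝ) : ‖cayley τ‖ = 1 := by
  have h : (starRingEnd ℂ) (1 - τ * Complex.I) = 1 + τ * Complex.I := by simp
  rw [cayley, ← h, norm_div, Complex.norm_conj,
    div_self (norm_ne_zero_iff.mpr (one_sub_mul_I_ne_zero τ))]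

lemma cayley_ne_zero (τ : ℝ) : cayley τ ≠ 0 :=
  norm_ne_zero_iff.mp (by rw [norm_cayley]; exact one_ne_zero)

lemma continuous_cayley : Continuous cayley :=
  Continuous.div (by fun_prop) (by fun_prop) one_sub_mul_I_ne_zero

lemma cayley_injective : Function.Injective cayley := fun σ τ h => by
  rw [cayley, cayley, div_eq_div_iff (one_sub_mul_I_ne_zero σ) (one_sub_mul_I_ne_zero τ)] at h
  have h1 : ((σ : ℂ) - τ) * (2 * Complex.I) = 0 := by linear_combination h
  have h2 : (σ : ℂ) - τ = 0 := (mul_eq_zero.mp h1).resolve_right (by simp)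
  exact_mod_cast sub_eq_zero.mp h2

lemma continuous_torusAverage_selbergWeight {n : ℕ} {p q : ℂ} (hp0 : p ≠ 0) (hp : ‖p‖ < 1)
    (hq0 : q ≠ 0) (hq : ‖q‖ < 1) {T : Fin 6 → ℝ → ℂ} (hT : ∀ k, Continuous (T k))
    (hT0 : ∀ k τ, T k τ ≠ 0) (hT1 : ∀ k τ, ‖T k τ‖ < 1) :
    Continuous fun τ => torusAverage (selbergWeight (n := n) p q q fun k => T k τ) := by
  refine continuous_const.mul (continuous_parametric_integral_of_continuous
    (f := fun τ θ => selbergWeight p q q (fun k => T k τ) (torusMap 0 1 θ)) ?_ isCompact_Icc)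
  exact Continuous.selbergWeight (X := ℝ × (Fin n → ℝ)) (t := fun k x => T k x.1)
    (z := fun j x => torusMap 0 1 x.2 j) hp0 hp hq0 hq (fun k => (hT k).comp continuous_fst)
    (fun j => (continuous_torusMap_zero_one j).comp continuous_snd) (fun k x => hT0 k x.1)
    (fun k x => hT1 k x.1) fun j x => norm_torusMap_zero_one x.2 j

lemma continuous_selbergValue {p q : ℂ} (hp : ‖p‖ < 1) (hq0 : q ≠ 0) (hq : ‖q‖ < 1) (m : ℕ)
    {T : Fin 6 → ℝ → ℂ} (hT : ∀ k, Continuous (T k)) (hT0 : ∀ k τ, T k τ ≠ 0)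
    (hT1 : ∀ k τ, ‖T k τ‖ < 1) : Continuous fun τ => selbergValue p q m fun k => T k τ := by
  refine continuous_finsetProd _ fun μ _ => continuous_const.mul
    (continuous_finsetProd _ fun j _ => continuous_finsetProd _ fun k _ => ?_)
  refine Continuous.ellipticGamma hp hq ((continuous_const.mul (hT j)).mul (hT k))
    (fun τ => mul_ne_zero (mul_ne_zero (pow_ne_zero μ hq0) (hT0 j τ)) (hT0 k τ)) fun τ => ?_
  rw [mul_comm (q ^ μ)]
  exact norm_mul_lt_one (norm_mul_pow_lt_one hq (hT1 j τ) μ) (hT1 k τ)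

/-- The elliptic Selberg integral in `m + 1` variables. -/
theorem torusAverage_selbergWeight {p q : ℂ} (hp0 : p ≠ 0) (hp : ‖p‖ < 1) (hq0 : q ≠ 0)
    (hq : ‖q‖ < 1) {t : Fin 6 → ℂ} (ht0 : ∀ k, t k ≠ 0) (ht1 : ∀ k, ‖t k‖ < 1) {m : ℕ}
    (hbal : q ^ (2 * m) * ∏ k : Fin 6, t k = p * q) :
    selbergConst p q ^ (m + 1) * torusAverage (selbergWeight (n := m + 1) p q q t) =
      2 ^ (m + 1) * (m + 1).factorial * selbergValue p q m t := by
  -- The exponents sum to zero, preserving the balancing, and unimodular factors preserve |t k| < 1.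
  -- Moving t 0 against t 1 and t 2 against t 3 makes both constants non-zero off a countable set.
  let e : Fin 6 → ℤ := ![1, 0, 1, 0, -1, -1]
  let T : Fin 6 → ℝ → ℂ := fun k τ => t k * cayley τ ^ e k
  have hT : ∀ k, Continuous (T k) := fun k =>
    continuous_const.mul (continuous_cayley.zpow₀ (e k) fun τ => Or.inl (cayley_ne_zero τ))
  have hT0 : ∀ k τ, T k τ ≠ 0 := fun k τ =>
    mul_ne_zero (ht0 k) (zpow_ne_zero _ (cayley_ne_zero τ))
  have hT1 : ∀ k τ, ‖T k τ‖ < 1 := fun k τ => by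
    simp only [T, norm_mul, norm_zpow, norm_cayley, one_zpow, mul_one]
    exact ht1 k
  have hTbal : ∀ τ, q ^ (2 * m) * ∏ k, T k τ = p * q := fun τ => by
    have h0 := cayley_ne_zero τ
    rw [← hbal, Finset.prod_mul_distrib]
    have : ∏ k, cayley τ ^ e k = 1 := by
      simp only [e, Fin.prod_univ_six, Matrix.cons_val, Matrix.cons_val_zero, Matrix.cons_val_one,
        zpow_one, zpow_zero, zpow_neg]
      field_simp
    rw [this, mul_one]
  let f : ℝ → ℂ := fun τ => selbergConst p q ^ (m + 1) *
    torusAverage (selbergWeight (n := m + 1) p q q fun k => T k τ)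
      - 2 ^ (m + 1) * (m + 1).factorial * selbergValue p q m fun k => T k τ
  have hf : Continuous f :=
    (continuous_const.mul (continuous_torusAverage_selbergWeight hp0 hp hq0 hq hT hT0 hT1)).sub
      (continuous_const.mul (continuous_selbergValue hp hq0 hq m hT hT0 hT1))
  obtain ⟨S, hS, hS0⟩ :=
    exists_countable_thetaBasisConst_ne_zero hp0 hp hq0 (ht0 0) (ht0 1) m
  obtain ⟨S', hS', hS0'⟩ :=
    exists_countable_thetaBasisConst_ne_zero hp0 hp hq0 (ht0 2) (ht0 3) m
  have hdense : Dense (cayley ⁻¹' (S ∪ S'))ᶜ :=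
    ((hS.union hS').preimage cayley_injective).dense_compl ℝ
  have hzero : EqOn f (fun _ => 0) (cayley ⁻¹' (S ∪ S'))ᶜ := fun τ hτ => by
    have hτ' : cayley τ ∉ S ∧ cayley τ ∉ S' := not_or.mp hτ
    have h := selberg_mul_thetaBasisConst hp0 hp hq0 hq (fun k => hT0 k τ) (fun k => hT1 k τ)
      (hTbal τ)
    refine (mul_eq_zero.mp h).resolve_right (mul_ne_zero ?_ ?_)
    · simpa [T, e] using hS0 _ hτ'.1 (cayley_ne_zero τ)
    · simpa [T, e] using hS0' _ hτ'.2 (cayley_ne_zero τ)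
  -- The value 0 of the real parameter is the point 1 of the circle, where the original parameters
  -- are recovered.
  have h0 := congrFun (Continuous.ext_on hdense hf continuous_const hzero) 0
  have hT00 : (fun k => T k 0) = t := by
    ext k
    simp [T, cayley]
  simp only [f, hT00] at h0
  exact sub_eq_zero.mp h0

end

theorem mainTheorem1 (n : ℕ) (hn : 1 ≤ n) (p q : ℂ) (hp0 : p ≠ 0) (hp : ‖p‖ < 1)
    (hq0 : q ≠ 0) (hq : ‖q‖ < 1) (t : Fin 6 → ℂ) (ht : ∀ k, ‖t k‖ < 1)
    (hbal : q ^ (2 * n - 2) * ∏ k : Fin 6, t k = p * q) :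
    TorusIntegrable (selbergIntegrand (n := n) p q q t) 0 1 ∧
    selbergConst p q ^ n / (2 ^ n * (n.factorial : ℂ)) *
        torusIntegral (selbergIntegrand (n := n) p q q t) 0 1 =
      ∏ m ∈ Finset.Icc 1 n, (ellipticGamma p q (q ^ m) / ellipticGamma p q q *
        ∏ j : Fin 6, ∏ k ∈ Finset.Ioi j, ellipticGamma p q (q ^ (m - 1) * t j * t k)) := by
  obtain ⟨m, rfl⟩ := Nat.exists_eq_add_of_le' hn
  -- Balancing with pq ≠ 0 rules out zero parameters.
  have hne : q ^ (2 * (m + 1) - 2) * ∏ k : Fin 6, t k ≠ 0 := by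
    rw [hbal]; exact mul_ne_zero hp0 hq0
  have ht0 : ∀ k, t k ≠ 0 := fun k =>
    Finset.prod_ne_zero_iff.mp (mul_ne_zero_iff.mp hne).2 k (Finset.mem_univ k)
  rw [show 2 * (m + 1) - 2 = 2 * m by omega] at hbal
  refine ⟨torusIntegrable_selbergIntegrand hp0 hp hq0 hq ht0 ht, ?_⟩
  have hfac : (2 ^ (m + 1) * ((m + 1).factorial : ℂ)) ≠ 0 :=
    mul_ne_zero (pow_ne_zero _ two_ne_zero) (by exact_mod_cast (m + 1).factorial_ne_zero)
  rw [torusIntegral_selbergIntegrand, div_mul_eq_mul_div,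
    torusAverage_selbergWeight hp0 hp hq0 hq ht0 ht hbal, mul_div_cancel_left₀ _ hfac, selbergValue,
    ← Finset.Ico_add_one_right_eq_Icc, Finset.prod_Ico_eq_prod_range]
  simp only [Nat.add_sub_cancel, add_comm 1]
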